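/- All graphs are finite, simple and have at least one vertex. A vertex $v$ of a connected graph $H$ is a cut vertex if $H-v$ is not connected; a connected graph without cut vertices is called 2-connected; a block of a graph is an inclusion-maximal 2-connected induced subgraph; and a graph (not necessarily connected) is a block graph if all its blocks are cliques. The Partially Ordered Hamiltonian Path Problem (POHPP) asks, given a graph $G$ and a partial order $\pi$ on $V(G)$, whether $G$ has an ordered Hamiltonian path $(v_1,\dots,v_n)$ such that $(v_i,v_j)\in\pi$ implies $i\le j$ for all $i,j\in\{1,\dots,n\}$. The Partially Ordered Hamiltonian Cycle Problem (POHCP) asks whether there is such an ordered Hamiltonian path for which, in addition, $v_1$ and $v_n$ are adjacent. Theorem. For each of the problems POHPP and POHCP there are a deterministic algorithm (a program for a unit-cost random access machine whose arithmetic operations are successor and predecessor) and a polynomial bound $n^{O(1)}$, both independent of $k$, such that the following holds. For every $k\ge 0$, given an $n$-vertex graph $G$, a partial order $\pi$ on $V(G)$ (both as $0$-$1$ matrices) and a set $F\subseteq E(G)$ with $|F|\le k$ such that $G-F$ is a block graph, the algorithm correctly decides the problem on $(G,\pi)$ in time $(k+1)!\cdot 2^k\cdot n^{O(1)}$. -/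

import Mathlib

namespace POH

/-! ### Graphs: cut vertices, blocks, block graphs -/

/-- `v` is a cut vertex of the connected graph `G`: the graph `G - v` is not connected.
(`Preconnected` is used so that the empty graph `K₁ - v` does not make `v` a cut vertex.) -/
def IsCutVertex {V : Type*} (G : SimpleGraph V) (v : V) : Prop :=
  G.Connected ∧ ¬ (G.induce ({v}ᶜ : Set V)).Preconnected

/-- A connected graph without cut vertices. -/
def IsTwoConnected {V : Type*} (G : SimpleGraph V) : Prop :=
  G.Connected ∧ ∀ v, ¬ IsCutVertex G v

/-- `S` is the vertex set of an inclusion-maximal 2-connected induced subgraph of `G`. -/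
def IsBlock {V : Type*} (G : SimpleGraph V) (S : Set V) : Prop :=
  Maximal (fun T : Set V => IsTwoConnected (G.induce T)) S

/-- Every block is a clique; the graph need not be connected. -/
def IsBlockGraph {V : Type*} (G : SimpleGraph V) : Prop :=
  ∀ S : Set V, IsBlock G S → G.IsClique S

/-! ### The two decision problems -/

/-- The order in which the walk `p` visits its vertices respects the relation `r`. -/
def Extends {V : Type*} {G : SimpleGraph V} (r : V → V → Prop) {u v : V} (p : G.Walk u v) : Prop :=
  ∀ i j : ℕ, i ≤ p.length → j ≤ p.length → r (p.getVert i) (p.getVert j) → i ≤ j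

/-- Partially Ordered Hamiltonian Path Problem: is there an ordered Hamiltonian path whose order
extends `r`? -/
def POHPP {V : Type*} [DecidableEq V] (G : SimpleGraph V) (r : V → V → Prop) : Prop :=
  ∃ (u v : V) (p : G.Walk u v), p.IsHamiltonian ∧ Extends r p

/-- Partially Ordered Hamiltonian Cycle Problem: is there an ordered Hamiltonian path with adjacent
end vertices whose order extends `r`? -/
def POHCP {V : Type*} [DecidableEq V] (G : SimpleGraph V) (r : V → V → Prop) : Prop :=
  ∃ (u v : V) (p : G.Walk u v), p.IsHamiltonian ∧ G.Adj u v ∧ Extends r p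

/-! ### A random access machine with a step count

Programs are structured and use natural-number registers and finitely many (those named in the
program) two-dimensional arrays with random access. The only arithmetic is successor and
predecessor, so after `t` steps every number and every address in use is at most
`t` plus the largest number in the program and in the input: all words have logarithmic
length, and unit cost is justified. -/

/-- Register contents, and the entries `mem a i j` of the arrays `a`. -/
structure State where
  reg : ℕ → ℕ
  mem : ℕ → ℕ → ℕ → ℕ

/-- Expressions: constants, registers, `e + 1`, `e - 1` (truncated), array entries. -/
inductive Expr where
  | const (c : ℕ)
  | reg (x : ℕ)
  | succ (e : Expr)
  | pred (e : Expr)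
  | get (a : ℕ) (i j : Expr)

def Expr.eval (s : State) : Expr → ℕ
  | .const c => c
  | .reg x => s.reg x
  | .succ e => e.eval s + 1
  | .pred e => e.eval s - 1
  | .get a i j => s.mem a (i.eval s) (j.eval s)

/-- One time unit for each node of the expression. -/
def Expr.cost : Expr → ℕ
  | .const _ => 1
  | .reg _ => 1
  | .succ e => e.cost + 1
  | .pred e => e.cost + 1
  | .get _ i j => i.cost + j.cost + 1

/-- Tests. -/
inductive Cond where
  | eq (e f : Expr)
  | lt (e f : Expr)
  | not (b : Cond)
  | and (b c : Cond)
  | or (b c : Cond)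

def Cond.eval (s : State) : Cond → Prop
  | .eq e f => e.eval s = f.eval s
  | .lt e f => e.eval s < f.eval s
  | .not b => ¬ b.eval s
  | .and b c => b.eval s ∧ c.eval s
  | .or b c => b.eval s ∨ c.eval s

def Cond.cost : Cond → ℕ
  | .eq e f => e.cost + f.cost + 1
  | .lt e f => e.cost + f.cost + 1
  | .not b => b.cost + 1
  | .and b c => b.cost + c.cost + 1
  | .or b c => b.cost + c.cost + 1

/-- Programs. `store a i j e` writes the value of `e` into entry `(i, j)` of the array `a`. -/
inductive Prog where
  | skip
  | assign (x : ℕ) (e : Expr)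
  | store (a : ℕ) (i j e : Expr)
  | seq (P Q : Prog)
  | ite (b : Cond) (P Q : Prog)
  | loop (b : Cond) (P : Prog)

def State.setReg (s : State) (x v : ℕ) : State :=
  { s with reg := Function.update s.reg x v }

def State.setMem (s : State) (a i j v : ℕ) : State :=
  { s with mem := fun a' i' j' => if a' = a ∧ i' = i ∧ j' = j then v else s.mem a' i' j' }

/-- `Exec P s s' t`: started in `s`, the program `P` halts in `s'` after exactly `t` time units. -/
inductive Exec : Prog → State → State → ℕ → Prop where
  | skip (s : State) : Exec .skip s s 1
  | assign (s : State) (x : ℕ) (e : Expr) :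
      Exec (.assign x e) s (s.setReg x (e.eval s)) (e.cost + 1)
  | store (s : State) (a : ℕ) (i j e : Expr) :
      Exec (.store a i j e) s (s.setMem a (i.eval s) (j.eval s) (e.eval s))
        (i.cost + j.cost + e.cost + 1)
  | seq {P Q : Prog} {s s' s'' : State} {t t' : ℕ} :
      Exec P s s' t → Exec Q s' s'' t' → Exec (.seq P Q) s s'' (t + t')
  | ite_true {b : Cond} {P Q : Prog} {s s' : State} {t : ℕ} :
      b.eval s → Exec P s s' t → Exec (.ite b P Q) s s' (b.cost + 1 + t)
  | ite_false {b : Cond} {P Q : Prog} {s s' : State} {t : ℕ} :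
      ¬ b.eval s → Exec Q s s' t → Exec (.ite b P Q) s s' (b.cost + 1 + t)
  | loop_done {b : Cond} {P : Prog} {s : State} :
      ¬ b.eval s → Exec (.loop b P) s s (b.cost + 1)
  | loop_step {b : Cond} {P : Prog} {s s' s'' : State} {t t' : ℕ} :
      b.eval s → Exec P s s' t → Exec (.loop b P) s' s'' t' →
      Exec (.loop b P) s s'' (b.cost + 1 + t + t')

/-- Execution is deterministic, in the result and in the time. -/
theorem Exec.deterministic {P : Prog} {s s₁ s₂ : State} {t₁ t₂ : ℕ}
    (h₁ : Exec P s s₁ t₁) (h₂ : Exec P s s₂ t₂) : s₁ = s₂ ∧ t₁ = t₂ := by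
  induction h₁ generalizing s₂ t₂ with
  | skip s => cases h₂; exact ⟨rfl, rfl⟩
  | assign s x e => cases h₂; exact ⟨rfl, rfl⟩
  | store s a i j e => cases h₂; exact ⟨rfl, rfl⟩
  | seq _ _ ih ih' =>
    cases h₂ with
    | seq g g' =>
      obtain ⟨rfl, rfl⟩ := ih g
      obtain ⟨rfl, rfl⟩ := ih' g'
      exact ⟨rfl, rfl⟩
  | ite_true hb _ ih =>
    cases h₂ with
    | ite_true _ g => obtain ⟨rfl, rfl⟩ := ih g; exact ⟨rfl, rfl⟩
    | ite_false hb' _ => exact absurd hb hb'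
  | ite_false hb _ ih =>
    cases h₂ with
    | ite_true hb' _ => exact absurd hb' hb
    | ite_false _ g => obtain ⟨rfl, rfl⟩ := ih g; exact ⟨rfl, rfl⟩
  | loop_done hb =>
    cases h₂ with
    | loop_done _ => exact ⟨rfl, rfl⟩
    | loop_step hb' _ _ => exact absurd hb' hb
  | loop_step hb _ _ ih ih' =>
    cases h₂ with
    | loop_done hb' => exact absurd hb hb'
    | loop_step _ g g' =>
      obtain ⟨rfl, rfl⟩ := ih g
      obtain ⟨rfl, rfl⟩ := ih' g'
      exact ⟨rfl, rfl⟩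

/-- The program `P` halts on the initial state `s` within `T` time units, and then register `0`
contains the answer: `1` if `Q` holds, `0` if not. -/
def Decides (P : Prog) (s : State) (Q : Prop) (T : ℕ) : Prop :=
  ∃ (s' : State) (t : ℕ), Exec P s s' t ∧ t ≤ T ∧
    (Q → s'.reg 0 = 1) ∧ (¬ Q → s'.reg 0 = 0)

/-! ### Input -/

open Classical in
/-- The 0-1 matrix of a relation on `Fin n`, extended by zeros. -/
noncomputable def boolMatrix {n : ℕ} (R : Fin n → Fin n → Prop) (i j : ℕ) : ℕ :=
  if ∃ u v : Fin n, u.val = i ∧ v.val = j ∧ R u v then 1 else 0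

/-- The input `(G, r, F)`: register `0` contains the number of vertices, and the arrays `0`, `1`,
`2` contain the adjacency matrix of `G`, the matrix of `r` and the matrix of the edge set `F`.
Everything else is zero. -/
noncomputable def input {n : ℕ} (G : SimpleGraph (Fin n)) (r : Fin n → Fin n → Prop)
    (F : Finset (Sym2 (Fin n))) : State where
  reg := fun x => if x = 0 then n else 0
  mem := fun a => match a with
    | 0 => boolMatrix G.Adj
    | 1 => boolMatrix r
    | 2 => boolMatrix (fun u v => s(u, v) ∈ F)
    | _ => fun _ _ => 0

end POH

namespace POH

/-! ### Counting loops: a sublanguage with a total semantics -/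

/-! Write `B` for `G - F`. An ordered Hamiltonian path uses some edges of `F`, in some order and
with some directions, and between them it runs inside the block graph `B`. The vertices of a cycle
of `B` lie in one block, so they form a clique (`adj_of_cycle`). Hence, if `y` is a neighbour of `x`
that is closer to `a`, every path from `x` to `a` passes through `y`, and what it visits between `x`
and `y` is adjacent to both (`closer_neighbour_mem_path`). So once the sequence of oriented
`F`-edges and the two end vertices are guessed, the shortest `B`-paths joining them form a skeleton
that every matching solution visits in this order. All other vertices lie in gaps between
consecutive skeleton vertices, and the vertices in one gap are pairwise adjacent
(`adj_of_common_neighbours`).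

The gaps are filled greedily: an unmarked common neighbour of the two skeleton vertices is appended
as soon as its predecessors have been visited and it is adjacent to the end of the path. An exchange
argument shows that this loses nothing: on reaching a skeleton vertex, the greedy path has visited
at least what the tour has visited up to there (`Between.fill`, `At.next`). A vertex taken early
blocks no other one, because the vertices of a gap form a clique. Skeleton vertices are marked
beforehand, so they are never taken early. A right guess therefore reaches all `n` vertices
(`Guide.den_trial`). Conversely, for every guess the list built is a path that respects the order
(`Track`), so success is never recorded wrongly (`den_trials_sound`).

A guess is a permutation of the `K` edges and one separator, of which only the part before the
separator is used, with one orientation bit per entry. A mixed radix counter runs through the `(K +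
1)! * 2 ^ (K + 1)` guesses (`den_nextDigits`, `enumeration`), and each is tested with all pairs of
end vertices in polynomial time.

For the machine, commands whose only loops are counting loops have a total semantics `den` and a
time bound, tied to execution by `exec_compile`. Only the loop over the guesses is a general one
(`exec_loop`). -/

/-- Programs whose only loops are `forto x y P`: run `P` with `x = 0, …, y - 1`. -/
inductive Cmd where
  | skip
  | assign (x : ℕ) (e : Expr)
  | store (a : ℕ) (i j e : Expr)
  | seq (P Q : Cmd)
  | cond (b : Cond) (P Q : Cmd)
  | forto (x y : ℕ) (P : Cmd)

namespace Cmd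

/-- The translation into programs of the machine. -/
def compile : Cmd → Prog
  | .skip => .skip
  | .assign x e => .assign x e
  | .store a i j e => .store a i j e
  | .seq P Q => .seq P.compile Q.compile
  | .cond b P Q => .ite b P.compile Q.compile
  | .forto x y P => .seq (.assign x (.const 0))
      (.loop (.lt (.reg x) (.reg y)) (.seq P.compile (.assign x (.succ (.reg x)))))

open Classical in
/-- The state after running the command; the loop with bound register `y` is run `nb y` times. -/
noncomputable def den (nb : ℕ → ℕ) : Cmd → State → State
  | .skip, s => s
  | .assign x e, s => s.setReg x (e.eval s)
  | .store a i j e, s => s.setMem a (i.eval s) (j.eval s) (e.eval s)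
  | .seq P Q, s => Q.den nb (P.den nb s)
  | .cond b P Q, s => if b.eval s then P.den nb s else Q.den nb s
  | .forto x y P, s =>
      Nat.rec (s.setReg x 0) (fun i s' => (P.den nb s').setReg x (i + 1)) (nb y)

/-- The registers a command may write. -/
def regs : Cmd → List ℕ
  | .skip => []
  | .assign x _ => [x]
  | .store _ _ _ _ => []
  | .seq P Q => P.regs ++ Q.regs
  | .cond _ P Q => P.regs ++ Q.regs
  | .forto x _ P => x :: P.regs

/-- The arrays a command may write. -/
def arrs : Cmd → List ℕ
  | .skip => []
  | .assign _ _ => []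
  | .store a _ _ _ => [a]
  | .seq P Q => P.arrs ++ Q.arrs
  | .cond _ P Q => P.arrs ++ Q.arrs
  | .forto _ _ P => P.arrs

/-- All loop bounds are registers from `bs`, and loop variables are not written in loop bodies. -/
def wf (bs : List ℕ) : Cmd → Bool
  | .skip => true
  | .assign _ _ => true
  | .store _ _ _ _ => true
  | .seq P Q => P.wf bs && Q.wf bs
  | .cond _ P Q => P.wf bs && Q.wf bs
  | .forto x y P => P.wf bs && decide (y ∈ bs) && decide (x ∉ P.regs)

/-- A bound for the running time. -/
def time (nb : ℕ → ℕ) : Cmd → ℕ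
  | .skip => 1
  | .assign _ e => e.cost + 1
  | .store _ i j e => i.cost + j.cost + e.cost + 1
  | .seq P Q => P.time nb + Q.time nb
  | .cond b P Q => b.cost + 1 + (P.time nb + Q.time nb)
  | .forto _ y P => 2 + (nb y * (4 + (P.time nb + 3)) + 4)

variable {nb : ℕ → ℕ}

@[simp] theorem den_skip (s : State) : Cmd.skip.den nb s = s := rfl

@[simp] theorem den_assign (x : ℕ) (e : Expr) (s : State) :
    (Cmd.assign x e).den nb s = s.setReg x (e.eval s) := rfl

@[simp] theorem den_store (a : ℕ) (i j e : Expr) (s : State) :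
    (Cmd.store a i j e).den nb s = s.setMem a (i.eval s) (j.eval s) (e.eval s) := rfl

@[simp] theorem den_seq (P Q : Cmd) (s : State) :
    (Cmd.seq P Q).den nb s = Q.den nb (P.den nb s) := rfl

theorem den_cond_pos {b : Cond} {s : State} (h : b.eval s) (P Q : Cmd) :
    (Cmd.cond b P Q).den nb s = P.den nb s := by
  simp [den, h]

theorem den_cond_neg {b : Cond} {s : State} (h : ¬ b.eval s) (P Q : Cmd) :
    (Cmd.cond b P Q).den nb s = Q.den nb s := by
  simp [den, h]

end Cmd

@[simp] theorem State.setReg_reg (s : State) (x v y : ℕ) :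
    (s.setReg x v).reg y = if y = x then v else s.reg y := by
  simp [State.setReg, Function.update_apply]

@[simp] theorem State.setReg_mem (s : State) (x v : ℕ) : (s.setReg x v).mem = s.mem := rfl

@[simp] theorem State.setMem_reg (s : State) (a i j v : ℕ) : (s.setMem a i j v).reg = s.reg := rfl

theorem State.setMem_mem (s : State) (a i j v a' i' j' : ℕ) :
    (s.setMem a i j v).mem a' i' j' = if a' = a ∧ i' = i ∧ j' = j then v else s.mem a' i' j' := rfl

theorem State.setMem_mem_ne (s : State) {a a' : ℕ} (h : a' ≠ a) (i j v : ℕ) :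
    (s.setMem a i j v).mem a' = s.mem a' := by
  funext i' j'
  simp [State.setMem, h]

theorem State.setMem_mem_same (s : State) (a i j v i' j' : ℕ) :
    (s.setMem a i j v).mem a i' j' = if i' = i ∧ j' = j then v else s.mem a i' j' := by
  simp [State.setMem]

/-! ### Loop invariants, frame rules and running times -/

namespace Cmd

variable {nb : ℕ → ℕ}

/-- Rule for loops: an invariant indexed by the loop variable. -/
theorem forto_inv {x y : ℕ} {P : Cmd} {s : State} (I : ℕ → State → Prop)
    (h0 : I 0 (s.setReg x 0))
    (hs : ∀ i s', i < nb y → s'.reg x = i → I i s' → I (i + 1) ((P.den nb s').setReg x (i + 1))) :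
    I (nb y) ((Cmd.forto x y P).den nb s) := by
  -- The induction also carries that the loop variable equals the number of completed rounds, which
  -- `hs` may assume.
  have key : ∀ m ≤ nb y,
      I m (Nat.rec (s.setReg x 0) (fun i s' => (P.den nb s').setReg x (i + 1)) m) ∧
      (Nat.rec (motive := fun _ => State) (s.setReg x 0)
        (fun i s' => (P.den nb s').setReg x (i + 1)) m).reg x = m := by
    intro m
    induction m with
    | zero => intro _; exact ⟨h0, by simp⟩
    | succ m ih =>
      intro hm
      obtain ⟨h1, h2⟩ := ih (by omega)
      exact ⟨hs m _ (by omega) h2 h1, by simp⟩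
  exact (key _ le_rfl).1

/-- Registers that are not written keep their values. -/
theorem frame_reg (c : Cmd) (s : State) {z : ℕ} (h : z ∉ c.regs) :
    (c.den nb s).reg z = s.reg z := by
  induction c generalizing s with
  | skip => rfl
  | assign x e => simp [regs] at h; simp [h]
  | store a i j e => rfl
  | seq P Q ihP ihQ => simp [regs] at h; simp [ihP _ h.1, ihQ _ h.2]
  | cond b P Q ihP ihQ =>
    simp [regs] at h
    by_cases hb : b.eval s
    · rw [den_cond_pos hb, ihP _ h.1]
    · rw [den_cond_neg hb, ihQ _ h.2]
  | forto x y P ih =>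
    simp [regs] at h
    refine forto_inv (fun _ s' => s'.reg z = s.reg z) (by simp [h.1]) ?_
    intro i s' _ _ hs
    simp [h.1, ih _ h.2, hs]

/-- Arrays that are not written keep their values. -/
theorem frame_mem (c : Cmd) (s : State) {a : ℕ} (h : a ∉ c.arrs) :
    (c.den nb s).mem a = s.mem a := by
  induction c generalizing s with
  | skip => rfl
  | assign x e => rfl
  | store a' i j e => simp [arrs] at h; simp [State.setMem_mem_ne _ h]
  | seq P Q ihP ihQ => simp [arrs] at h; simp [ihP _ h.1, ihQ _ h.2]
  | cond b P Q ihP ihQ =>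
    simp [arrs] at h
    by_cases hb : b.eval s
    · rw [den_cond_pos hb, ihP _ h.1]
    · rw [den_cond_neg hb, ihQ _ h.2]
  | forto x y P ih =>
    simp [arrs] at h
    refine forto_inv (fun _ s' => s'.mem a = s.mem a) (by simp) ?_
    intro i s' _ _ hs
    simp [ih _ h, hs]

/-- The compiled command computes `den` within the time bound. -/
theorem exec_compile (c : Cmd) (bs : List ℕ) (hwf : c.wf bs = true) (hw : ∀ y ∈ bs, y ∉ c.regs)
    (s : State) (hb : ∀ y ∈ bs, s.reg y = nb y) :
    ∃ t ≤ c.time nb, Exec c.compile s (c.den nb s) t := by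
  induction c generalizing s with
  | skip => exact ⟨1, le_rfl, .skip s⟩
  | assign x e => exact ⟨_, le_rfl, .assign s x e⟩
  | store a i j e => exact ⟨_, le_rfl, .store s a i j e⟩
  | seq P Q ihP ihQ =>
    simp only [wf, Bool.and_eq_true] at hwf
    simp only [regs, List.mem_append, not_or] at hw
    obtain ⟨t, ht, e⟩ := ihP hwf.1 (fun y hy => (hw y hy).1) s hb
    obtain ⟨t', ht', e'⟩ := ihQ hwf.2 (fun y hy => (hw y hy).2) (P.den nb s)
      (fun y hy => by rw [frame_reg P s (hw y hy).1, hb y hy])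
    exact ⟨t + t', by simp only [time]; omega, .seq e e'⟩
  | cond b P Q ihP ihQ =>
    simp only [wf, Bool.and_eq_true] at hwf
    simp only [regs, List.mem_append, not_or] at hw
    by_cases h : b.eval s
    · obtain ⟨t, ht, e⟩ := ihP hwf.1 (fun y hy => (hw y hy).1) s hb
      refine ⟨_, ?_, by rw [den_cond_pos h]; exact .ite_true h e⟩
      simp only [time]; omega
    · obtain ⟨t, ht, e⟩ := ihQ hwf.2 (fun y hy => (hw y hy).2) s hb
      refine ⟨_, ?_, by rw [den_cond_neg h]; exact .ite_false h e⟩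
      simp only [time]; omega
  | forto x y P ih =>
    simp only [wf, Bool.and_eq_true, decide_eq_true_eq] at hwf
    simp only [regs, List.mem_cons, not_or] at hw
    obtain ⟨⟨hP, hy⟩, hx⟩ := hwf
    have hxy : y ≠ x := (hw y hy).1
    -- `g m` is the state at the test that follows `m` rounds.
    let g : ℕ → State := fun m => Nat.rec (motive := fun _ => State) (s.setReg x 0)
      (fun i s' => (P.den nb s').setReg x (i + 1)) m
    have hgx : ∀ m, (g m).reg x = m := fun m => by cases m <;> simp [g]
    have hgb : ∀ m, ∀ z ∈ bs, (g m).reg z = nb z := by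
      intro m z hz
      induction m with
      | zero => simp [g, (hw z hz).1, hb z hz]
      | succ m ihm =>
        change ((P.den nb (g m)).setReg x (m + 1)).reg z = nb z
        simp [(hw z hz).1, frame_reg P (g m) (hw z hz).2, ihm]
    have key : ∀ d m, m + d = nb y → ∃ t ≤ d * (4 + (P.time nb + 3)) + 4,
        Exec (.loop (.lt (.reg x) (.reg y)) (.seq P.compile (.assign x (.succ (.reg x)))))
          (g m) (g (nb y)) t := by
      intro d
      induction d with
      | zero =>
        intro m hm
        have : m = nb y := by omega
        subst this
        exact ⟨4, by omega, .loop_done (by simp [Cond.eval, Expr.eval, hgx, hgb _ y hy])⟩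
      | succ d ihd =>
        intro m hm
        obtain ⟨t, ht, e⟩ := ih hP (fun z hz => (hw z hz).2) (g m) (hgb m)
        obtain ⟨t', ht', e'⟩ := ihd (m + 1) (by omega)
        have hstep : Exec (.assign x (.succ (.reg x))) (P.den nb (g m)) (g (m + 1)) 3 := by
          have h := Exec.assign (P.den nb (g m)) x (.succ (.reg x))
          have h' : (Expr.succ (.reg x)).eval (P.den nb (g m)) = m + 1 := by
            simp [Expr.eval, frame_reg P (g m) hx, hgx]
          rw [h'] at h
          exact h
        refine ⟨4 + (t + 3) + t', ?_, .loop_step ?_ (.seq e hstep) e'⟩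
        · rw [Nat.succ_mul]; omega
        · simp [Cond.eval, Expr.eval, hgx, hgb _ y hy]; omega
    obtain ⟨t, ht, e⟩ := key (nb y) 0 (by omega)
    exact ⟨2 + t, by simp only [time]; omega, .seq (.assign s x (.const 0)) e⟩

/-- Running times are polynomial if the loop bounds are. -/
theorem time_poly (c : Cmd) : ∃ C d : ℕ, ∀ (n : ℕ) (nb : ℕ → ℕ), 1 ≤ n →
    (∀ y, nb y ≤ 2 * n ^ 2) → c.time nb ≤ C * n ^ d := by
  have two : ∀ P Q : Cmd, ∀ A : ℕ, (∃ C d : ℕ, ∀ (n : ℕ) (nb : ℕ → ℕ), 1 ≤ n →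
      (∀ y, nb y ≤ 2 * n ^ 2) → P.time nb ≤ C * n ^ d) → (∃ C d : ℕ, ∀ (n : ℕ) (nb : ℕ → ℕ),
      1 ≤ n → (∀ y, nb y ≤ 2 * n ^ 2) → Q.time nb ≤ C * n ^ d) →
      ∃ C d : ℕ, ∀ (n : ℕ) (nb : ℕ → ℕ), 1 ≤ n →
      (∀ y, nb y ≤ 2 * n ^ 2) → A + (P.time nb + Q.time nb) ≤ C * n ^ d := by
    rintro P Q A ⟨C, d, h⟩ ⟨C', d', h'⟩
    refine ⟨A + (C + C'), d + d', fun n nb hn hb => ?_⟩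
    have h1 := h n nb hn hb
    have h2 := h' n nb hn hb
    have h3 : n ^ d ≤ n ^ (d + d') := Nat.pow_le_pow_right hn (by omega)
    have h4 : n ^ d' ≤ n ^ (d + d') := Nat.pow_le_pow_right hn (by omega)
    have h5 : 1 ≤ n ^ (d + d') := Nat.one_le_pow _ _ hn
    have h6 := Nat.mul_le_mul_left C h3
    have h7 := Nat.mul_le_mul_left C' h4
    have h8 := Nat.mul_le_mul_left A h5
    rw [Nat.add_mul, Nat.add_mul]
    omega
  induction c with
  | skip => exact ⟨1, 0, fun n nb _ _ => by simp [time]⟩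
  | assign x e => exact ⟨e.cost + 1, 0, fun n nb _ _ => by simp [time]⟩
  | store a i j e => exact ⟨i.cost + j.cost + e.cost + 1, 0, fun n nb _ _ => by simp [time]⟩
  | seq P Q ihP ihQ => simpa [time] using two P Q 0 ihP ihQ
  | cond b P Q ihP ihQ => exact two P Q _ ihP ihQ
  | forto x y P ih =>
    obtain ⟨C, d, h⟩ := ih
    -- A round costs at most `(7 + C) * n ^ d` and there are at most `2 * n ^ 2` rounds; the 6 is
    -- the overhead outside the rounds.
    refine ⟨6 + 2 * (7 + C), d + 2, fun n nb hn hb => ?_⟩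
    have h1 := h n nb hn hb
    have h3 : 1 ≤ n ^ d := Nat.one_le_pow _ _ hn
    have h5 : 1 ≤ n ^ (d + 2) := Nat.one_le_pow _ _ hn
    have h6 : 4 + (P.time nb + 3) ≤ (7 + C) * n ^ d := by
      rw [Nat.add_mul]; omega
    have h7 := Nat.mul_le_mul (hb y) h6
    have h8 : 2 * n ^ 2 * ((7 + C) * n ^ d) = 2 * (7 + C) * n ^ (d + 2) := by ring
    simp only [time]
    rw [Nat.add_mul]
    omega

/-- A loop whose body is executed exactly `m` times. -/
theorem exec_loop {b : Cond} {P : Prog} {T : ℕ} (m : ℕ) (f : ℕ → State)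
    (hrun : ∀ i < m, b.eval (f i) ∧ ∃ t ≤ T, Exec P (f i) (f (i + 1)) t) (hend : ¬ b.eval (f m)) :
    ∃ t ≤ m * (b.cost + 1 + T) + (b.cost + 1), Exec (.loop b P) (f 0) (f m) t := by
  have key : ∀ d i, i + d = m → ∃ t ≤ d * (b.cost + 1 + T) + (b.cost + 1),
      Exec (.loop b P) (f i) (f m) t := by
    intro d
    induction d with
    | zero =>
      intro i hi
      have : i = m := by omega
      subst this
      exact ⟨_, by omega, .loop_done hend⟩
    | succ d ih =>
      intro i hi
      obtain ⟨hb, t, ht, e⟩ := hrun i (by omega)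
      obtain ⟨t', ht', e'⟩ := ih (i + 1) (by omega)
      refine ⟨_, ?_, .loop_step hb e e'⟩
      rw [Nat.succ_mul]; omega
  exact key m 0 (by omega)

end Cmd

end POH

namespace POH

/-! ### Cycles in block graphs are cliques -/

section BlockGraph

variable {V : Type*} {B : SimpleGraph V}

/-- The vertices of a chain are mutually reachable in every graph that contains the chain. -/
theorem reachable_of_isChain {W : Type*} {H : SimpleGraph W} (φ : W → V)
    (hinj : Function.Injective φ) (hadj : ∀ w w', B.Adj (φ w) (φ w') → H.Adj w w') :
    ∀ c : List V, c.IsChain B.Adj → (∀ x ∈ c, ∃ w, φ w = x) →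
      ∀ w w', φ w ∈ c → φ w' ∈ c → H.Reachable w w' := by
  intro c
  induction c with
  | nil => intro _ _ w _ hw; simp at hw
  | cons x c ih =>
    intro hc hl
    have hc' : c.IsChain B.Adj := hc.tail
    have ih' := ih hc' (fun y hy => hl y (by simp [hy]))
    have hx : ∀ w w', φ w = x → φ w' ∈ c → H.Reachable w w' := by
      intro w w' hw hw'
      cases c with
      | nil => simp at hw'
      | cons y c =>
        obtain ⟨v, hv⟩ := hl y (by simp)
        have h1 : B.Adj x y := by simpa using (List.isChain_cons_cons.1 hc).1
        have h2 : H.Adj w v := hadj _ _ (by rw [hw, hv]; exact h1)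
        exact h2.reachable.trans (ih' v w' (by simp [hv]) hw')
    intro w w' hw hw'
    rcases List.mem_cons.1 hw with h | h <;> rcases List.mem_cons.1 hw' with hq | hq
    · rw [hinj (h.trans hq.symm)]
    · exact hx w w' h hq
    · exact (hx w' w hq h).symm
    · exact ih' w w' h hq

/-- The vertex set of a cycle induces a 2-connected graph. -/
theorem isTwoConnected_of_cycle (c : List V) (hne : c ≠ []) (hnd : c.Nodup)
    (hc : c.IsChain B.Adj)
    (hclose : ∀ x ∈ c.getLast?, ∀ y ∈ c.head?, B.Adj x y) :
    IsTwoConnected (B.induce {v | v ∈ c}) := by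
  have hlift : ∀ x ∈ c, ∃ w : {v | v ∈ c}, (w : V) = x := fun x hx => ⟨⟨x, hx⟩, rfl⟩
  have hpre : (B.induce {v | v ∈ c}).Preconnected := fun w w' =>
    reachable_of_isChain (B := B) Subtype.val Subtype.val_injective (fun _ _ h => h) c hc hlift w w'
      w.2 w'.2
  obtain ⟨x, hx⟩ := List.exists_mem_of_ne_nil c hne
  have hconn : (B.induce {v | v ∈ c}).Connected :=
    { preconnected := hpre, nonempty := ⟨⟨x, hx⟩⟩ }
  refine ⟨hconn, ?_⟩
  rintro ⟨v, hv⟩ ⟨-, hcut⟩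
  apply hcut
  -- Deleting `v` from the cycle `c₁ v c₂` leaves the chain `c₂ c₁`, whose two parts are joined by
  -- the closing edge.
  obtain ⟨c₁, c₂, rfl⟩ := List.append_of_mem hv
  have hrot : (c₂ ++ c₁).IsChain B.Adj := by
    rw [List.isChain_append] at hc
    obtain ⟨h1, h2, -⟩ := hc
    rw [List.isChain_append]
    refine ⟨h2.tail, h1, ?_⟩
    intro a ha b hb
    apply hclose
    · cases c₂ with
      | nil => simp at ha
      | cons z c₂ => simpa [List.getLast?_append, List.getLast?_cons_cons] using ha
    · cases c₁ with
      | nil => simp at hb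
      | cons z c₁ => simpa using hb
  have hmem : ∀ w : ({u | u ∈ c₁ ++ v :: c₂} : Set V), w ≠ ⟨v, hv⟩ → (w : V) ∈ c₂ ++ c₁ := by
    intro w hw
    have h1 : (w : V) ∈ c₁ ++ v :: c₂ := w.2
    have h2 : (w : V) ≠ v := fun h => hw (Subtype.ext h)
    simp only [List.mem_append, List.mem_cons] at h1 ⊢
    tauto
  have hv1 : v ∉ c₂ ++ c₁ := by
    have := List.nodup_middle.1 hnd
    simp only [List.nodup_cons, List.mem_append] at this
    simp only [List.mem_append]
    tauto
  intro w w'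
  refine reachable_of_isChain (B := B) (fun z => (z.1 : V))
    (fun a b h => Subtype.ext (Subtype.ext h)) (fun _ _ h => h) (c₂ ++ c₁) hrot ?_ w w'
    (hmem w.1 w.2) (hmem w'.1 w'.2)
  intro x hx
  refine ⟨⟨⟨x, ?_⟩, ?_⟩, rfl⟩
  · simp only [Set.mem_ofPred_eq, List.mem_append, List.mem_cons] at hx ⊢
    tauto
  · intro h
    have : x = v := congrArg Subtype.val h
    exact hv1 (this ▸ hx)

/-- In a block graph, the vertices of a cycle are pairwise adjacent. -/
theorem adj_of_cycle [Finite V] (hB : IsBlockGraph B) (c : List V) (hnd : c.Nodup)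
    (hc : c.IsChain B.Adj) (hclose : ∀ x ∈ c.getLast?, ∀ y ∈ c.head?, B.Adj x y)
    {u v : V} (hu : u ∈ c) (hv : v ∈ c) (huv : u ≠ v) : B.Adj u v := by
  have h2 := isTwoConnected_of_cycle c (List.ne_nil_of_mem hu) hnd hc hclose
  obtain ⟨S, hS, hmax⟩ := Set.Finite.exists_le_maximal
    (s := {T : Set V | IsTwoConnected (B.induce T)}) (Set.toFinite _) h2
  exact hB S hmax (hS hu) (hS hv) huv

/-- Two common neighbours of adjacent vertices are adjacent. -/
theorem adj_of_common_neighbours [Finite V] (hB : IsBlockGraph B) {x y v w : V} (hxy : B.Adj x y)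
    (hxv : B.Adj x v) (hvy : B.Adj v y) (hxw : B.Adj x w) (hwy : B.Adj w y) (hvw : v ≠ w) :
    B.Adj v w := by
  refine adj_of_cycle hB [x, v, y, w] ?_ ?_ ?_ (by simp) (by simp) hvw
  · simp [hxy.ne, hxv.ne, hxw.ne, hvy.ne, hvw, hwy.ne']
  · simp [hxv, hvy, hwy.symm]
  · simp [hxw.symm]

/-- A chain from `y` to `a` along which the level `δ` decreases to `1`. -/
theorem exists_descending_chain {δ : V → ℕ} {a : V} (h1 : ∀ u, δ u = 1 → u = a)
    (h2 : ∀ u d, δ u = d + 2 → ∃ w, B.Adj u w ∧ δ w = d + 1) :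
    ∀ d y, δ y = d + 1 → ∃ q : List V, (y :: q).IsChain B.Adj ∧ a ∈ y :: q ∧ (y :: q).Nodup ∧
      ∀ z ∈ q, 0 < δ z ∧ δ z < δ y := by
  intro d
  induction d with
  | zero =>
    intro y hy
    exact ⟨[], by simp, by simp [h1 y hy], by simp, by simp⟩
  | succ d ih =>
    intro y hy
    obtain ⟨w, hw, hd⟩ := h2 y d hy
    obtain ⟨q, hq1, hq2, hq3, hq4⟩ := ih w hd
    have hlt : ∀ z ∈ w :: q, 0 < δ z ∧ δ z < δ y := by
      intro z hz
      rcases List.mem_cons.1 hz with rfl | hz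
      · omega
      · have := hq4 z hz; omega
    refine ⟨w :: q, List.isChain_cons_cons.2 ⟨hw, hq1⟩, List.mem_cons_of_mem _ hq2,
      List.nodup_cons.2 ⟨fun h => lt_irrefl _ (hlt y h).2, hq3⟩, hlt⟩

/-- In a block graph, let `y` be a neighbour of `x` which is closer to `a` (`δ` is one plus the
distance from `a`). Then every path from `x` to `a` visits `y`, and the vertices which it visits
between `x` and `y` are adjacent to both. -/
theorem closer_neighbour_mem_path [Finite V] (hB : IsBlockGraph B) {δ : V → ℕ} {a x y : V}
    (h1 : ∀ u, δ u = 1 → u = a) (h2 : ∀ u d, δ u = d + 2 → ∃ w, B.Adj u w ∧ δ w = d + 1)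
    (h3 : ∀ u w, B.Adj u w → 0 < δ w → δ u ≤ δ w + 1)
    (hxy : B.Adj x y) (hy : 0 < δ y) (hd : δ x = δ y + 1)
    (p : List V) (hp : (x :: p).IsChain B.Adj) (hnd : (x :: p).Nodup) (ha : a ∈ p) :
    ∃ P p', p = P ++ y :: p' ∧ ∀ v ∈ P, B.Adj x v ∧ B.Adj v y := by
  classical
  obtain ⟨d, hd'⟩ : ∃ d, δ y = d + 1 := ⟨δ y - 1, by omega⟩
  obtain ⟨q, hq1, hq2, hq3, hq4⟩ := exists_descending_chain h1 h2 d y hd'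
  -- `z` is the first vertex of `p` on the descending chain `y :: q`. The path from `x` to `z`, the
  -- chain back from `z` to `y` and the edge `y x` form a cycle, hence a clique.
  obtain ⟨z, hz⟩ : ∃ z, p.find? (fun v => decide (v ∈ y :: q)) = some z := by
    rw [← Option.isSome_iff_exists, List.find?_isSome]
    exact ⟨a, ha, by simpa using hq2⟩
  rw [List.find?_eq_some_iff_append] at hz
  obtain ⟨hzq, P, p', rfl, hP⟩ := hz
  simp only [decide_eq_true_eq] at hzq
  have hP' : ∀ v ∈ P, v ∉ y :: q := fun v hv => by simpa using hP v hv
  obtain ⟨S, S', hS⟩ := List.append_of_mem hzq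
  have hxq : x ∉ y :: q := by
    intro h
    rcases List.mem_cons.1 h with h | h
    · subst h; omega
    · have := hq4 x h; omega
  have hcP : (x :: P ++ [z]).IsChain B.Adj := by
    have : x :: (P ++ z :: p') = (x :: P ++ [z]) ++ p' := by simp
    rw [this] at hp
    exact hp.left_of_append
  have hcS : (S ++ [z]).IsChain B.Adj := by
    have : y :: q = (S ++ [z]) ++ S' := by simp [hS]
    rw [this] at hq1
    exact hq1.left_of_append
  have hcyc : (x :: P ++ z :: S.reverse).IsChain B.Adj := by
    have hr : (z :: S.reverse).IsChain B.Adj := by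
      have := List.isChain_reverse.2 (hcS.imp (fun a b h => h.symm))
      simpa using this
    have h := List.isChain_append.1 hcP
    rw [List.isChain_append]
    refine ⟨h.1, hr, ?_⟩
    intro u hu v hv
    exact h.2.2 u hu v (by simpa using hv)
  have hndc : (x :: P ++ z :: S.reverse).Nodup := by
    have hSz : (S ++ z :: S').Nodup := hS ▸ hq3
    have hzS : (z :: S.reverse).Nodup := by
      have h := List.nodup_middle.1 hSz
      simp only [List.nodup_cons, List.mem_append, List.nodup_append] at h
      simp only [List.nodup_cons, List.mem_reverse, List.nodup_reverse]
      tauto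
    have hxP : (x :: P).Nodup := by
      have : x :: (P ++ z :: p') = (x :: P) ++ z :: p' := by simp
      rw [this] at hnd
      exact (List.nodup_append.1 hnd).1
    have hsub : ∀ v ∈ z :: S.reverse, v ∈ y :: q := by
      intro v hv
      rw [hS]
      simp only [List.mem_cons, List.mem_reverse, List.mem_append] at hv ⊢
      tauto
    refine List.nodup_append.2 ⟨hxP, hzS, ?_⟩
    rintro u hu v hv rfl
    rcases List.mem_cons.1 hu with rfl | hu
    · exact hxq (hsub _ hv)
    · exact hP' _ hu (hsub _ hv)
  have hclose : ∀ u ∈ (x :: P ++ z :: S.reverse).getLast?,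
      ∀ v ∈ (x :: P ++ z :: S.reverse).head?, B.Adj u v := by
    intro u hu v hv
    have hv' : x = v := by simpa using hv
    have hu' : y = u := by
      rw [List.getLast?_append_of_ne_nil _ (by simp)] at hu
      cases S with
      | nil =>
        simp only [List.nil_append, List.cons.injEq] at hS
        rw [hS.1]
        simpa using hu
      | cons b S =>
        simp only [List.cons_append, List.cons.injEq] at hS
        rw [hS.1]
        rw [List.reverse_cons, ← List.cons_append, List.getLast?_append_of_ne_nil _ (by simp)] at hu
        simpa using hu
    rw [← hv', ← hu']
    exact hxy.symm
  have hadj : ∀ {u v}, u ∈ x :: P ++ z :: S.reverse → v ∈ x :: P ++ z :: S.reverse → u ≠ v →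
      B.Adj u v := fun hu hv huv => adj_of_cycle hB _ hndc hcyc hclose hu hv huv
  have hxz : B.Adj x z := hadj (by simp) (by simp) (fun h => hxq (h ▸ hzq))
  -- A vertex of `q` is at least two levels below `x`, so it cannot be adjacent to `x`.
  have hzy : z = y := by
    rcases List.mem_cons.1 hzq with h | h
    · exact h
    · have := hq4 z h
      have := h3 x z hxz this.1
      omega
  subst hzy
  refine ⟨P, p', rfl, fun v hv => ⟨hadj (by simp) (by simp [hv]) ?_, hadj (by simp [hv]) (by simp) ?_⟩⟩
  · rintro rfl
    simp [hv] at hnd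
  · rintro rfl
    exact hP' _ hv hzq

end BlockGraph

end POH

/-! ### The program -/

namespace POH

infixr:60 ";;" => Cmd.seq

/-! Registers: number of vertices, number of edges in `F` plus one, loop variables, … -/

notation "rN" => (1 : ℕ)
notation "rK" => (2 : ℕ)
notation "rU" => (3 : ℕ)
notation "rW" => (4 : ℕ)
notation "rA" => (5 : ℕ)
notation "rH" => (6 : ℕ)
notation "rJ" => (7 : ℕ)
notation "rT" => (8 : ℕ)
notation "rS" => (9 : ℕ)
notation "rE" => (10 : ℕ)
notation "rX" => (11 : ℕ)
notation "rM" => (12 : ℕ)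
notation "rY" => (13 : ℕ)
notation "rV" => (14 : ℕ)
notation "rO" => (15 : ℕ)
notation "rC" => (16 : ℕ)
notation "rL" => (17 : ℕ)
notation "rB" => (18 : ℕ)
notation "rG" => (19 : ℕ)
notation "rZ" => (20 : ℕ)
notation "rI" => (22 : ℕ)

/-! Arrays: adjacency, order, `F`, list of the edges in `F`, levels and predecessors of the breadth
first search, digits of the enumeration, permutation, visited vertices, vertices on the skeleton. -/

notation "mA" => (0 : ℕ)
notation "mR" => (1 : ℕ)
notation "mF" => (2 : ℕ)
notation "mE" => (3 : ℕ)
notation "mD" => (4 : ℕ)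
notation "mX" => (5 : ℕ)
notation "mQ" => (6 : ℕ)
notation "mP" => (7 : ℕ)
notation "mV" => (8 : ℕ)
notation "mI" => (9 : ℕ)

/-- Run `P` if the test succeeds. -/
def Cmd.when (b : Cond) (P : Cmd) : Cmd := .cond b P .skip

/-- The test for adjacency in `G - F`. -/
def Cond.adjB (e f : Expr) : Cond :=
  .and (.eq (.get mA e f) (.const 1)) (.eq (.get mF e f) (.const 0))

/-- List the edges `{u, v}` of `F`: row `i` of the array is `u, v, u`. -/
def listEdges : Cmd :=
  .forto rU rN <| .forto rW rN <|
    .when (.and (.lt (.reg rU) (.reg rW)) (.eq (.get mF (.reg rU) (.reg rW)) (.const 1))) <|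
      .store mE (.pred (.reg rK)) (.const 0) (.reg rU) ;;
      .store mE (.pred (.reg rK)) (.const 1) (.reg rW) ;;
      .store mE (.pred (.reg rK)) (.const 2) (.reg rU) ;;
      .assign rK (.succ (.reg rK))

/-- Level `rH + 2` of the breadth first search from `rA`. -/
def searchLevel : Cmd :=
  .forto rU rN <| .forto rW rN <|
    .when (.and (.eq (.get mD (.reg rA) (.reg rU)) (.const 0))
      (.and (.eq (.get mD (.reg rA) (.reg rW)) (.succ (.reg rH)))
        (.adjB (.reg rU) (.reg rW)))) <|
      .store mD (.reg rA) (.reg rU) (.succ (.succ (.reg rH))) ;;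
      .store mX (.reg rA) (.reg rU) (.reg rW)

/-- Breadth first searches in `G - F`, from all vertices. -/
def searchAll : Cmd :=
  .forto rA rN <|
    .store mD (.reg rA) (.reg rA) (.const 1) ;;
    .forto rH rN searchLevel

/-- The first digits of the enumeration. -/
def initDigits : Cmd :=
  .forto rJ rK <| .store mQ (.reg rJ) (.const 0) (.reg rJ)

/-- The permutation given by the current digits. -/
def makePerm : Cmd :=
  (.forto rJ rK <| .store mP (.reg rJ) (.const 0) (.reg rJ)) ;;
  (.forto rJ rK <|
    .assign rT (.get mP (.reg rJ) (.const 0)) ;;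
    .store mP (.reg rJ) (.const 0) (.get mP (.get mQ (.reg rJ) (.const 0)) (.const 0)) ;;
    .store mP (.get mQ (.reg rJ) (.const 0)) (.const 0) (.reg rT))

/-- Go from `rX` to the next vertex of the skeleton; `rJ` edges of `F` have been used so far. -/
def step : Cmd :=
  -- `rK` holds `K + 1`, so this detects the separator `K`: no further edge of `F` is used, and the
  -- skeleton runs to the end vertex `rE` and stays there.
  .cond (.eq (.succ (.get mP (.reg rJ) (.const 0))) (.reg rK))
    (.cond (.eq (.reg rX) (.reg rE)) .skip (.assign rX (.get mX (.reg rE) (.reg rX))))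
    -- Since a row is `u, v, u`, the entry at the orientation bit and the one after it are the start
    -- and the end of the oriented edge.
    (.assign rA (.get mE (.get mP (.reg rJ) (.const 0)) (.get mQ (.reg rJ) (.const 1))) ;;
      .cond (.eq (.reg rX) (.reg rA))
        (.assign rX (.get mE (.get mP (.reg rJ) (.const 0)) (.succ (.get mQ (.reg rJ) (.const 1))))
          ;; .assign rJ (.succ (.reg rJ)))
        (.assign rX (.get mX (.reg rA) (.reg rX))))

/-- Append `rV` to the path if this is possible. -/
def tryVisit : Cmd :=
  .assign rO (.const 1) ;;
  (.forto rI rN <|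
    .when (.and (.eq (.get mR (.reg rI) (.reg rV)) (.const 1)) (.and (.not (.eq (.reg rI) (.reg rV)))
      (.eq (.get mV (.reg rI) (.const 0)) (.const 0)))) (.assign rO (.const 0))) ;;
  .when (.and (.and (.eq (.reg rO) (.const 1)) (.lt (.reg rV) (.reg rN)))
      (.and (.eq (.get mV (.reg rV) (.const 0)) (.const 0)) (.or (.eq (.reg rL) (.const 0))
        (.eq (.get mA (.reg rC) (.reg rV)) (.const 1)))))
    (.when (.eq (.reg rL) (.const 0)) (.assign rB (.reg rV)) ;;
      .store mV (.reg rV) (.const 0) (.const 1) ;;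
      .assign rC (.reg rV) ;;
      .assign rL (.succ (.reg rL)))

/-- Forget the previous path. -/
def clear : Cmd :=
  (.forto rU rN <| .store mV (.reg rU) (.const 0) (.const 0) ;;
    .store mI (.reg rU) (.const 0) (.const 0)) ;;
  .assign rL (.const 0)

/-- Mark the vertices of the skeleton. -/
def markSkeleton : Cmd :=
  .assign rX (.reg rS) ;; .assign rJ (.const 0) ;;
  .store mI (.reg rX) (.const 0) (.const 1) ;;
  (.forto rM rN <| step ;; .store mI (.reg rX) (.const 0) (.const 1))

/-- Visit vertices between the consecutive skeleton vertices `rY` and `rX`. -/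
def fill : Cmd :=
  -- A vertex may become available only after others of the gap have been visited, so the sweep over
  -- all candidates is repeated `n` times.
  .forto rH rN <| .forto rW rN <|
    .when (.and (.eq (.get mI (.reg rW) (.const 0)) (.const 0))
      (.and (.adjB (.reg rY) (.reg rW)) (.adjB (.reg rW) (.reg rX))))
      (.assign rV (.reg rW) ;; tryVisit)

/-- Follow the skeleton, visiting as many other vertices as possible. -/
def follow : Cmd :=
  .assign rX (.reg rS) ;; .assign rJ (.const 0) ;;
  .assign rV (.reg rX) ;; tryVisit ;;
  (.forto rM rN <|
    .assign rY (.reg rX) ;; step ;; fill ;; .assign rV (.reg rX) ;; tryVisit)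

/-- Record success. -/
def record (cyc : Bool) : Cmd :=
  .when (.and (.eq (.reg rL) (.reg rN))
    (if cyc then .eq (.get mA (.reg rB) (.reg rC)) (.const 1) else .eq (.const 0) (.const 0)))
    (.assign rG (.const 1))

/-- Test the current digits, for all pairs of end vertices. -/
def trials (cyc : Bool) : Cmd :=
  .forto rS rN <| .forto rE rN <| clear ;; markSkeleton ;; follow ;; record cyc

/-- Next digits; `rZ` is the carry. -/
def nextDigits : Cmd :=
  .assign rZ (.const 1) ;;
  (.forto rJ rK <| .when (.eq (.reg rZ) (.const 1)) <|
    .cond (.eq (.get mQ (.reg rJ) (.const 1)) (.const 0))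
      (.store mQ (.reg rJ) (.const 1) (.const 1) ;; .assign rZ (.const 0))
      (.store mQ (.reg rJ) (.const 1) (.const 0) ;;
        .cond (.lt (.succ (.get mQ (.reg rJ) (.const 0))) (.reg rK))
          (.store mQ (.reg rJ) (.const 0) (.succ (.get mQ (.reg rJ) (.const 0))) ;;
            .assign rZ (.const 0))
          (.store mQ (.reg rJ) (.const 0) (.reg rJ))))

/-- The first part of the preparation. -/
def setupEdges : Cmd := .assign rK (.const 1) ;; listEdges

/-- The second part of the preparation. -/
def setupSearch : Cmd := searchAll ;; initDigits

/-- One round of the enumeration. -/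
def round (cyc : Bool) : Cmd := makePerm ;; trials cyc ;; nextDigits

/-- The program for the path problem (`cyc = false`) and the cycle problem (`cyc = true`). -/
def program (cyc : Bool) : Prog :=
  .seq (.assign rN (.reg 0)) <| .seq setupEdges.compile <| .seq setupSearch.compile <|
    -- The carry left by `nextDigits` is the stopping flag: it is 1 when the counter overflows.
    .seq (.loop (.eq (.reg rZ) (.const 0)) (round cyc).compile) (.assign 0 (.reg rG))

/-! ### Static data -/

/-- The instance, on natural numbers: `n` vertices, `K` edges to be deleted. -/
structure Env where
  n : ℕ
  K : ℕ
  A : ℕ → ℕ → Prop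
  R : ℕ → ℕ → Prop
  F : ℕ → ℕ → Prop

/-- Adjacency after the deletion. -/
def Env.B (Γ : Env) (u v : ℕ) : Prop := Γ.A u v ∧ ¬ Γ.F u v

/-- The loop bounds. -/
def Env.nb (Γ : Env) (y : ℕ) : ℕ := if y = rK then Γ.K + 1 else Γ.n

@[simp] theorem Env.nb_n (Γ : Env) : Γ.nb rN = Γ.n := rfl

@[simp] theorem Env.nb_K (Γ : Env) : Γ.nb rK = Γ.K + 1 := rfl

open Classical in
/-- The 0-1 matrix of a relation. -/
noncomputable def mat (R : ℕ → ℕ → Prop) (i j : ℕ) : ℕ := if R i j then 1 else 0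

@[simp] theorem mat_eq_one {R : ℕ → ℕ → Prop} {i j : ℕ} : mat R i j = 1 ↔ R i j := by
  simp [mat]

@[simp] theorem mat_eq_zero {R : ℕ → ℕ → Prop} {i j : ℕ} : mat R i j = 0 ↔ ¬ R i j := by
  simp [mat]

/-- The state contains the input. -/
structure Static (Γ : Env) (s : State) : Prop where
  hN : s.reg rN = Γ.n
  hA : s.mem mA = mat Γ.A
  hR : s.mem mR = mat Γ.R
  hF : s.mem mF = mat Γ.F

theorem Static.frame {Γ : Env} {s : State} (h : Static Γ s) {nb : ℕ → ℕ} (c : Cmd)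
    (h1 : rN ∉ c.regs) (h2 : mA ∉ c.arrs ∧ mR ∉ c.arrs ∧ mF ∉ c.arrs) :
    Static Γ (c.den nb s) :=
  ⟨by rw [Cmd.frame_reg c s h1, h.hN], by rw [Cmd.frame_mem c s h2.1, h.hA],
    by rw [Cmd.frame_mem c s h2.2.1, h.hR], by rw [Cmd.frame_mem c s h2.2.2, h.hF]⟩

theorem Static.setReg {Γ : Env} {s : State} (h : Static Γ s) {x v : ℕ} (hx : x ≠ rN) :
    Static Γ (s.setReg x v) :=
  ⟨by simp [hx.symm, h.hN], h.hA, h.hR, h.hF⟩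

theorem Static.adjB {Γ : Env} {s : State} (h : Static Γ s) (e f : Expr) :
    (Cond.adjB e f).eval s ↔ Γ.B (e.eval s) (f.eval s) := by
  simp [Cond.adjB, Cond.eval, Expr.eval, h.hA, h.hF, Env.B]

/-! ### The visited vertices form a path -/

/-- The list `l` is a path in `G`, and each of its vertices comes after all its predecessors. -/
structure GoodPath (Γ : Env) (l : List ℕ) : Prop where
  nodup : l.Nodup
  lt : ∀ v ∈ l, v < Γ.n
  chain : l.IsChain Γ.A
  closed : ∀ l₁ v l₂, l = l₁ ++ v :: l₂ → ∀ w < Γ.n, Γ.R w v → w ≠ v → w ∈ l₁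

/-- The list `l` is the path built so far. -/
structure Track (Γ : Env) (s : State) (l : List ℕ) : Prop where
  good : GoodPath Γ l
  vis : ∀ v < Γ.n, s.mem mV v 0 = 0 ↔ v ∉ l
  len : s.reg rL = l.length
  first : ∀ v ∈ l.head?, s.reg rB = v
  last : ∀ v ∈ l.getLast?, s.reg rC = v

theorem Track.congr {Γ : Env} {s s' : State} {l : List ℕ} (h : Track Γ s l)
    (hV : s'.mem mV = s.mem mV) (hL : s'.reg rL = s.reg rL) (hB : s'.reg rB = s.reg rB)
    (hC : s'.reg rC = s.reg rC) : Track Γ s' l :=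
  ⟨h.good, by rw [hV]; exact h.vis, by rw [hL]; exact h.len, by rw [hB]; exact h.first,
    by rw [hC]; exact h.last⟩

/-- The vertex in `rV` can be appended. -/
def CanVisit (Γ : Env) (s : State) : Prop :=
  (∀ w < Γ.n, Γ.R w (s.reg rV) → w ≠ s.reg rV → s.mem mV w 0 ≠ 0) ∧ s.reg rV < Γ.n ∧
    s.mem mV (s.reg rV) 0 = 0 ∧ (s.reg rL = 0 ∨ Γ.A (s.reg rC) (s.reg rV))

/-- The flag `rO` is cleared by any unvisited proper predecessor of `rV`, and nothing in the loop
sets it again. -/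
theorem den_predLoop {Γ : Env} {s : State} (h : Static Γ s) (hO : s.reg rO = 1) {s' : State}
    (hs' : s' = (Cmd.forto rI rN <|
      .when (.and (.eq (.get mR (.reg rI) (.reg rV)) (.const 1))
        (.and (.not (.eq (.reg rI) (.reg rV)))
        (.eq (.get mV (.reg rI) (.const 0)) (.const 0)))) (.assign rO (.const 0))).den Γ.nb s) :
    s'.reg rO = 1 ↔ ∀ w < Γ.n, Γ.R w (s.reg rV) → w ≠ s.reg rV → s.mem mV w 0 ≠ 0 := by
  subst hs'
  have key := Cmd.forto_inv (nb := Γ.nb) (x := rI) (y := rN) (s := s)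
    (P := .when (.and (.eq (.get mR (.reg rI) (.reg rV)) (.const 1))
        (.and (.not (.eq (.reg rI) (.reg rV)))
        (.eq (.get mV (.reg rI) (.const 0)) (.const 0)))) (.assign rO (.const 0)))
    (fun i s' => s'.mem = s.mem ∧ s'.reg rV = s.reg rV ∧
      (s'.reg rO = 1 ↔ ∀ w < i, Γ.R w (s.reg rV) → w ≠ s.reg rV → s.mem mV w 0 ≠ 0))
    (by simp [hO]) ?_
  · exact key.2.2
  · rintro i s' - hi ⟨hm, hv, ho⟩
    by_cases hc : Γ.R i (s.reg rV) ∧ i ≠ s.reg rV ∧ s.mem mV i 0 = 0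
    · rw [Cmd.when, Cmd.den_cond_pos (by simpa [Cond.eval, Expr.eval, hm, hv, hi, h.hR] using hc)]
      refine ⟨by simp [hm], by simp [hv], ?_⟩
      simp only [Cmd.den_assign, Expr.eval, State.setReg_reg]
      simp
      exact ⟨i, by omega, hc⟩
    · rw [Cmd.when, Cmd.den_cond_neg (by simpa [Cond.eval, Expr.eval, hm, hv, hi, h.hR] using hc)]
      refine ⟨by simp [hm], by simp [hv], ?_⟩
      simp only [Cmd.den_skip, State.setReg_reg]
      simp
      rw [ho]
      constructor
      · intro H w hw h1 h2 h3
        rcases Nat.lt_or_eq_of_le hw with h4 | rfl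
        · exact H w h4 h1 h2 h3
        · exact hc ⟨h1, h2, h3⟩
      · intro H w hw
        exact H w (by omega)

/-- These four quantities are all that the invariants below read among the things that `tryVisit`
may change. -/
theorem den_tryVisit {Γ : Env} {s : State} (h : Static Γ s) :
    (CanVisit Γ s → (∀ v, (tryVisit.den Γ.nb s).mem mV v 0 =
        if v = s.reg rV then 1 else s.mem mV v 0) ∧
      (tryVisit.den Γ.nb s).reg rL = s.reg rL + 1 ∧ (tryVisit.den Γ.nb s).reg rC = s.reg rV ∧
      (tryVisit.den Γ.nb s).reg rB = if s.reg rL = 0 then s.reg rV else s.reg rB) ∧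
    (¬ CanVisit Γ s → (tryVisit.den Γ.nb s).mem mV = s.mem mV ∧
      (tryVisit.den Γ.nb s).reg rL = s.reg rL ∧ (tryVisit.den Γ.nb s).reg rC = s.reg rC ∧
      (tryVisit.den Γ.nb s).reg rB = s.reg rB) := by
  rw [tryVisit, Cmd.den_seq, Cmd.den_seq]
  set c := (Cmd.forto rI rN <|
      .when (.and (.eq (.get mR (.reg rI) (.reg rV)) (.const 1))
        (.and (.not (.eq (.reg rI) (.reg rV)))
        (.eq (.get mV (.reg rI) (.const 0)) (.const 0)))) (.assign rO (.const 0))) with hc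
  set s₀ := (Cmd.assign rO (.const 1)).den Γ.nb s with hs₀
  have h0 : Static Γ s₀ := h.setReg (by decide)
  have hO := den_predLoop h0 (by simp [hs₀, Expr.eval]) (s' := c.den Γ.nb s₀) rfl
  have h1 : Static Γ (c.den Γ.nb s₀) := h0.frame c (by decide) (by decide)
  have hV : (c.den Γ.nb s₀).mem mV = s.mem mV := by
    rw [Cmd.frame_mem c s₀ (by decide)]; rfl
  have hreg : ∀ z, z ≠ rO → z ≠ rI → (c.den Γ.nb s₀).reg z = s.reg z := by
    intro z hz hz'
    rw [Cmd.frame_reg c s₀ (by simp [hc, Cmd.regs, Cmd.when, hz, hz'])]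
    simp [hs₀, hz]
  have hrV : s₀.reg rV = s.reg rV := by simp [hs₀]
  have hmV : s₀.mem mV = s.mem mV := rfl
  rw [hrV, hmV] at hO
  generalize c.den Γ.nb s₀ = s₁ at *
  have eV := hreg rV (by decide) (by decide)
  have eL := hreg rL (by decide) (by decide)
  have eC := hreg rC (by decide) (by decide)
  have eB := hreg rB (by decide) (by decide)
  have hcond : Cond.eval s₁ (.and (.and (.eq (.reg rO) (.const 1)) (.lt (.reg rV) (.reg rN)))
      (.and (.eq (.get mV (.reg rV) (.const 0)) (.const 0)) (.or (.eq (.reg rL) (.const 0))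
        (.eq (.get mA (.reg rC) (.reg rV)) (.const 1))))) ↔ CanVisit Γ s := by
    simp only [Cond.eval, Expr.eval, hO, h1.hN, eV, eL, eC, hV, h1.hA, mat_eq_one, CanVisit]
    tauto
  constructor
  · intro hcan
    rw [Cmd.when, Cmd.den_cond_pos (hcond.2 hcan)]
    by_cases h0 : s.reg rL = 0
    · rw [Cmd.den_seq, Cmd.when, Cmd.den_cond_pos (by simpa [Cond.eval, Expr.eval, eL] using h0)]
      simp [Expr.eval, State.setMem_mem_same, hV, eV, eL, h0]
    · rw [Cmd.den_seq, Cmd.when, Cmd.den_cond_neg (by simpa [Cond.eval, Expr.eval, eL] using h0)]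
      simp [Expr.eval, State.setMem_mem_same, hV, eV, eL, eB, h0]
  · intro hcan
    rw [Cmd.when, Cmd.den_cond_neg (fun h => hcan (hcond.1 h))]
    simp [hV, eL, eC, eB]

/-- `CanVisit` suffices to extend the path, whatever the other tables contain. This is why soundness
does not depend on the guess. -/
theorem Track.append_or_keep {Γ : Env} {s : State} {l : List ℕ} (h : Static Γ s) (ht : Track Γ s l) :
    (CanVisit Γ s → Track Γ (tryVisit.den Γ.nb s) (l ++ [s.reg rV])) ∧
    (¬ CanVisit Γ s → Track Γ (tryVisit.den Γ.nb s) l) := by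
  obtain ⟨h1, h2⟩ := den_tryVisit h
  refine ⟨fun hc => ?_, fun hc => ?_⟩
  · obtain ⟨hV, hL, hC, hB⟩ := h1 hc
    obtain ⟨c1, c2, c3, c4⟩ := hc
    have hnot : s.reg rV ∉ l := (ht.vis _ c2).1 c3
    refine ⟨⟨?_, ?_, ?_, ?_⟩, ?_, ?_, ?_, ?_⟩
    · simp only [List.nodup_append, List.nodup_singleton, List.mem_singleton, true_and]
      exact ⟨ht.good.nodup, fun a ha b hb e => hnot (by rw [← hb, ← e]; exact ha)⟩
    · intro v hv
      rcases List.mem_append.1 hv with hv | hv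
      · exact ht.good.lt v hv
      · rw [List.mem_singleton.1 hv]; exact c2
    · rw [List.isChain_append]
      refine ⟨ht.good.chain, by simp, fun x hx y hy => ?_⟩
      have hy' : s.reg rV = y := by simpa using hy
      rw [← ht.last x hx, ← hy']
      rcases c4 with c4 | c4
      · rw [ht.len, List.length_eq_zero_iff] at c4
        subst c4
        simp at hx
      · exact c4
    · intro l₁ v l₂ hl w hw hR hne
      -- Either `v` is the appended vertex, whose predecessors are checked by `CanVisit`, or the
      -- splitting takes place inside the old list.
      rcases List.eq_nil_or_concat l₂ with rfl | ⟨l₃, z, rfl⟩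
      · obtain ⟨e1, e2⟩ := List.append_inj' hl rfl
        have e3 : s.reg rV = v := by simpa using e2
        rw [← e1]
        by_contra hwl
        exact c1 w hw (e3 ▸ hR) (e3 ▸ hne) ((ht.vis w hw).2 hwl)
      · rw [List.concat_eq_append, ← List.cons_append, ← List.append_assoc] at hl
        obtain ⟨e1, -⟩ := List.append_inj' hl rfl
        exact ht.good.closed l₁ v l₃ e1 w hw hR hne
    · intro v hv
      rw [hV, List.mem_append, List.mem_singleton]
      split_ifs with e
      · simp [e]
      · rw [ht.vis v hv]; simp [e]
    · rw [hL, ht.len]; simp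
    · intro v hv
      rw [hB]
      cases l with
      | nil => simpa [ht.len] using hv
      | cons a l =>
        have : s.reg rL ≠ 0 := by rw [ht.len]; simp
        rw [if_neg this]
        exact ht.first v (by simpa using hv)
    · intro v hv
      rw [hC]
      simpa using hv
  · obtain ⟨hV, hL, hC, hB⟩ := h2 hc
    exact ht.congr hV hL hB hC

theorem exists_track_tryVisit {Γ : Env} {s : State} (h : Static Γ s) (ht : ∃ l, Track Γ s l) :
    ∃ l, Track Γ (tryVisit.den Γ.nb s) l := by
  obtain ⟨l, hl⟩ := ht
  by_cases hc : CanVisit Γ s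
  · exact ⟨_, (hl.append_or_keep h).1 hc⟩
  · exact ⟨_, (hl.append_or_keep h).2 hc⟩

/-- A solution: an ordered Hamiltonian path, with adjacent end vertices if `cyc` is true. -/
structure Sol (Γ : Env) (cyc : Bool) (l : List ℕ) : Prop where
  good : GoodPath Γ l
  len : l.length = Γ.n
  adj : cyc = true → ∀ u ∈ l.head?, ∀ v ∈ l.getLast?, Γ.A u v

/-! ### Soundness of the trials -/

theorem den_clear {Γ : Env} {s : State} :
    (∀ v < Γ.n, (clear.den Γ.nb s).mem mV v 0 = 0 ∧ (clear.den Γ.nb s).mem mI v 0 = 0) ∧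
      (clear.den Γ.nb s).reg rL = 0 := by
  refine ⟨?_, by simp [clear, Expr.eval]⟩
  have key := Cmd.forto_inv (nb := Γ.nb) (x := rU) (y := rN) (s := s)
    (P := .store mV (.reg rU) (.const 0) (.const 0) ;; .store mI (.reg rU) (.const 0) (.const 0))
    (fun i s' => ∀ v < i, s'.mem mV v 0 = 0 ∧ s'.mem mI v 0 = 0) (by simp) ?_
  · simpa [clear] using key
  · intro i s' _ hi hs v hv
    rcases Nat.lt_or_eq_of_le (Nat.le_of_lt_succ hv) with h | rfl
    · simp [State.setMem_mem, Expr.eval, hi, hs v h]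
    · simp [State.setMem_mem, Expr.eval, hi]

theorem track_clear {Γ : Env} {s : State} : Track Γ (clear.den Γ.nb s) [] := by
  obtain ⟨h1, h2⟩ := den_clear (Γ := Γ) (s := s)
  exact ⟨⟨by simp, by simp, by simp, by simp⟩, fun v hv => by simp [(h1 v hv).1], by simp [h2],
    by simp, by simp⟩

theorem exists_track_fill {Γ : Env} {s : State} (h : Static Γ s) (ht : ∃ l, Track Γ s l) :
    ∃ l, Track Γ (fill.den Γ.nb s) l := by
  have hreg : ∀ {s : State} {x v}, x ≠ rL → x ≠ rB → x ≠ rC → (∃ l, Track Γ s l) →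
      ∃ l, Track Γ (s.setReg x v) l := by
    rintro s x v h1 h2 h3 ⟨l, hl⟩
    exact ⟨l, hl.congr rfl (by simp [h1.symm]) (by simp [h2.symm]) (by simp [h3.symm])⟩
  refine (Cmd.forto_inv (fun _ s' => Static Γ s' ∧ ∃ l, Track Γ s' l)
    ⟨h.setReg (by decide), hreg (by decide) (by decide) (by decide) ht⟩ ?_).2
  rintro i s' - - ⟨h, ht⟩
  suffices H : ∀ {s'' : State}, Static Γ s'' ∧ (∃ l, Track Γ s'' l) →
      Static Γ (s''.setReg rH (i + 1)) ∧ (∃ l, Track Γ (s''.setReg rH (i + 1)) l) by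
    apply H
    refine Cmd.forto_inv (fun _ s' => Static Γ s' ∧ ∃ l, Track Γ s' l)
      ⟨h.setReg (by decide), hreg (by decide) (by decide) (by decide) ht⟩ ?_
    rintro j s' - - ⟨h, ht⟩
    by_cases hb : (Cond.and (.eq (.get mI (.reg rW) (.const 0)) (.const 0))
        (.and (.adjB (.reg rY) (.reg rW)) (.adjB (.reg rW) (.reg rX)))).eval s'
    · rw [Cmd.when, Cmd.den_cond_pos hb, Cmd.den_seq, Cmd.den_assign]
      have h' : Static Γ (s'.setReg rV ((Expr.reg rW).eval s')) := h.setReg (by decide)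
      exact ⟨(h'.frame tryVisit (by decide) (by decide)).setReg (by decide),
        hreg (by decide) (by decide) (by decide) (exists_track_tryVisit h'
          (hreg (by decide) (by decide) (by decide) ht))⟩
    · rw [Cmd.when, Cmd.den_cond_neg hb]
      exact ⟨h.setReg (by decide), hreg (by decide) (by decide) (by decide) ht⟩
  rintro s'' ⟨h, ht⟩
  exact ⟨h.setReg (by decide), hreg (by decide) (by decide) (by decide) ht⟩

theorem Track.frame {Γ : Env} {s : State} {l : List ℕ} (h : Track Γ s l) {nb : ℕ → ℕ} (c : Cmd)
    (h1 : rL ∉ c.regs ∧ rB ∉ c.regs ∧ rC ∉ c.regs) (h2 : mV ∉ c.arrs) : Track Γ (c.den nb s) l :=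
  h.congr (Cmd.frame_mem c s h2) (Cmd.frame_reg c s h1.1) (Cmd.frame_reg c s h1.2.1)
    (Cmd.frame_reg c s h1.2.2)

/-- Of `step` only its footprint is needed: it does not touch the path, and nothing is assumed about
the tables that it reads. -/
theorem exists_track_follow {Γ : Env} {s : State} (h : Static Γ s) (ht : ∃ l, Track Γ s l) :
    ∃ l, Track Γ (follow.den Γ.nb s) l := by
  rw [follow, Cmd.den_seq, Cmd.den_seq, Cmd.den_seq, Cmd.den_seq]
  have h0 : Static Γ ((Cmd.assign rV (.reg rX)).den Γ.nb ((Cmd.assign rJ (.const 0)).den Γ.nb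
      ((Cmd.assign rX (.reg rS)).den Γ.nb s))) :=
    ((h.frame _ (by decide) (by decide)).frame _ (by decide) (by decide)).frame _ (by decide)
      (by decide)
  have ht0 := exists_track_tryVisit h0 (by
    obtain ⟨l, hl⟩ := ht
    exact ⟨l, ((hl.frame _ (by decide) (by decide)).frame _ (by decide) (by decide)).frame _
      (by decide) (by decide)⟩)
  have h1 := h0.frame (nb := Γ.nb) tryVisit (by decide) (by decide)
  refine (Cmd.forto_inv (fun _ s' => Static Γ s' ∧ ∃ l, Track Γ s' l)
    ⟨h1.setReg (by decide), ?_⟩ ?_).2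
  · obtain ⟨l, hl⟩ := ht0
    exact ⟨l, hl.congr rfl (by simp) (by simp) (by simp)⟩
  rintro i s' - - ⟨h, l, hl⟩
  rw [Cmd.den_seq, Cmd.den_seq, Cmd.den_seq, Cmd.den_seq]
  have g1 := (h.frame (nb := Γ.nb) (.assign rY (.reg rX)) (by decide) (by decide)).frame
    (nb := Γ.nb) step (by decide) (by decide)
  have t1 := (hl.frame (nb := Γ.nb) (.assign rY (.reg rX)) (by decide) (by decide)).frame
    (nb := Γ.nb) step (by decide) (by decide)
  obtain ⟨l', hl'⟩ := exists_track_fill g1 ⟨l, t1⟩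
  have g2 := (g1.frame (nb := Γ.nb) fill (by decide) (by decide)).frame (nb := Γ.nb)
    (.assign rV (.reg rX)) (by decide) (by decide)
  have t2 := hl'.frame (nb := Γ.nb) (.assign rV (.reg rX)) (by decide) (by decide)
  obtain ⟨l'', hl''⟩ := exists_track_tryVisit g2 ⟨l', t2⟩
  exact ⟨(g2.frame tryVisit (by decide) (by decide)).setReg (by decide), l'',
    hl''.congr rfl (by simp) (by simp) (by simp)⟩

/-- One trial: clear the memory, build a path, check it. -/
theorem den_trial_sound {Γ : Env} {cyc : Bool} {s : State} (h : Static Γ s) :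
    ((clear ;; markSkeleton ;; follow ;; record cyc).den Γ.nb s).reg rG = s.reg rG ∨
    ((clear ;; markSkeleton ;; follow ;; record cyc).den Γ.nb s).reg rG = 1 ∧
      ∃ l, Sol Γ cyc l := by
  rw [Cmd.den_seq, Cmd.den_seq, Cmd.den_seq]
  have g1 := (h.frame (nb := Γ.nb) clear (by decide) (by decide)).frame
    (nb := Γ.nb) markSkeleton (by decide) (by decide)
  have t1 := (track_clear (Γ := Γ) (s := s)).frame (nb := Γ.nb) markSkeleton (by decide)
    (by decide)
  obtain ⟨l, hl⟩ := exists_track_follow g1 ⟨_, t1⟩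
  have g2 := g1.frame (nb := Γ.nb) follow (by decide) (by decide)
  have hG : (follow.den Γ.nb (markSkeleton.den Γ.nb (clear.den Γ.nb s))).reg rG = s.reg rG := by
    rw [Cmd.frame_reg follow _ (by decide), Cmd.frame_reg markSkeleton _ (by decide),
      Cmd.frame_reg clear _ (by decide)]
  generalize follow.den Γ.nb (markSkeleton.den Γ.nb (clear.den Γ.nb s)) = s' at *
  rw [record, Cmd.when]
  by_cases hb : Cond.eval s' (.and (.eq (.reg rL) (.reg rN))
    (if cyc then .eq (.get mA (.reg rB) (.reg rC)) (.const 1) else .eq (.const 0) (.const 0)))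
  · right
    rw [Cmd.den_cond_pos hb]
    refine ⟨by simp [Expr.eval], l, hl.good, ?_, ?_⟩
    · have := hb.1
      simp only [Cond.eval, Expr.eval, hl.len, g2.hN] at this
      exact this
    · rintro rfl u hu v hv
      have := hb.2
      simp only [if_true, Cond.eval, Expr.eval, g2.hA, mat_eq_one, hl.first u hu, hl.last v hv]
        at this
      exact this
  · left
    rw [Cmd.den_cond_neg hb]
    exact hG

/-- If a trial records success then there is a solution. -/
theorem den_trials_sound {Γ : Env} {cyc : Bool} {s : State} (h : Static Γ s) :
    ((trials cyc).den Γ.nb s).reg rG = s.reg rG ∨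
    ((trials cyc).den Γ.nb s).reg rG = 1 ∧ ∃ l, Sol Γ cyc l := by
  have hfr : rN ∉ (clear ;; markSkeleton ;; follow ;; record cyc).regs ∧
      mA ∉ (clear ;; markSkeleton ;; follow ;; record cyc).arrs ∧
      mR ∉ (clear ;; markSkeleton ;; follow ;; record cyc).arrs ∧
      mF ∉ (clear ;; markSkeleton ;; follow ;; record cyc).arrs := by
    revert cyc; decide
  refine (Cmd.forto_inv (fun _ s' => Static Γ s' ∧ (s'.reg rG = s.reg rG ∨ s'.reg rG = 1 ∧
    ∃ l, Sol Γ cyc l)) ⟨h.setReg (by decide), by simp⟩ ?_).2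
  rintro i s' - - hs'
  suffices H : ∀ {s'' : State}, Static Γ s'' ∧ (s''.reg rG = s.reg rG ∨ s''.reg rG = 1 ∧
      ∃ l, Sol Γ cyc l) → ∀ {x v : ℕ}, x ≠ rN → x ≠ rG → Static Γ (s''.setReg x v) ∧
      ((s''.setReg x v).reg rG = s.reg rG ∨ (s''.setReg x v).reg rG = 1 ∧
      ∃ l, Sol Γ cyc l) by
    refine H ?_ (by decide) (by decide)
    refine Cmd.forto_inv (fun _ s' => Static Γ s' ∧ (s'.reg rG = s.reg rG ∨ s'.reg rG = 1 ∧
      ∃ l, Sol Γ cyc l)) (H hs' (by decide) (by decide)) ?_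
    rintro j s' - - ⟨h, hs'⟩
    refine H ⟨h.frame _ hfr.1 hfr.2, ?_⟩ (by decide) (by decide)
    rcases den_trial_sound (cyc := cyc) h with e | e
    · rw [e]; exact hs'
    · exact Or.inr e
  rintro s'' ⟨h, hs⟩ x v h1 h2
  refine ⟨h.setReg h1, ?_⟩
  simpa [h2.symm] using hs

end POH

namespace POH

/-! ### A trial with the right guess finds a solution -/

open Classical in
/-- The next vertex of the skeleton, and the number of edges of `F` used until then. -/
noncomputable def stepFun (s : State) (x j : ℕ) : ℕ × ℕ :=
  if s.mem mP j 0 + 1 = s.reg rK then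
    if x = s.reg rE then (x, j) else (s.mem mX (s.reg rE) x, j)
  else if x = s.mem mE (s.mem mP j 0) (s.mem mQ j 1) then
    (s.mem mE (s.mem mP j 0) (s.mem mQ j 1 + 1), j + 1)
  else (s.mem mX (s.mem mE (s.mem mP j 0) (s.mem mQ j 1)) x, j)

theorem den_step {nb : ℕ → ℕ} (s : State) :
    ((step.den nb s).reg rX, (step.den nb s).reg rJ) = stepFun s (s.reg rX) (s.reg rJ) := by
  rw [step, stepFun]
  by_cases h1 : s.mem mP (s.reg rJ) 0 + 1 = s.reg rK
  · rw [if_pos h1, Cmd.den_cond_pos (by simpa [Cond.eval, Expr.eval] using h1)]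
    by_cases h2 : s.reg rX = s.reg rE
    · rw [if_pos h2, Cmd.den_cond_pos (by simpa [Cond.eval, Expr.eval] using h2)]
      simp
    · rw [if_neg h2, Cmd.den_cond_neg (by simpa [Cond.eval, Expr.eval] using h2)]
      simp [Expr.eval]
  · rw [if_neg h1, Cmd.den_cond_neg (by simpa [Cond.eval, Expr.eval] using h1), Cmd.den_seq]
    by_cases h2 : s.reg rX = s.mem mE (s.mem mP (s.reg rJ) 0) (s.mem mQ (s.reg rJ) 1)
    · rw [if_pos h2, Cmd.den_cond_pos (by simpa [Cond.eval, Expr.eval] using h2)]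
      simp [Expr.eval]
    · rw [if_neg h2, Cmd.den_cond_neg (by simpa [Cond.eval, Expr.eval] using h2)]
      simp [Expr.eval]

/-! ### Tours, skeletons and the exchange argument -/

/-- The vertices `y 0, …, y (n - 1)` form an ordered Hamiltonian path. -/
structure Tour (Γ : Env) (y : ℕ → ℕ) : Prop where
  pos : 1 ≤ Γ.n
  lt : ∀ i < Γ.n, y i < Γ.n
  inj : ∀ i < Γ.n, ∀ j < Γ.n, y i = y j → i = j
  surj : ∀ v < Γ.n, ∃ i < Γ.n, y i = v
  adj : ∀ i, i + 1 < Γ.n → Γ.A (y i) (y (i + 1))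
  ord : ∀ i < Γ.n, ∀ j < Γ.n, Γ.R (y i) (y j) → i ≤ j

/-- A tour with a skeleton: after position `p`, the next skeleton vertex is at position `g p`, and
`c p` edges of `F` occur before position `p`. -/
structure Guide (Γ : Env) (y c g : ℕ → ℕ) : Prop extends Tour Γ y where
  c_zero : c 0 = 0
  g_lt : ∀ p < Γ.n, g p < Γ.n
  g_last : ∀ p, p + 1 = Γ.n → g p = p
  g_gt : ∀ p, p + 1 < Γ.n → p < g p
  between : ∀ p < Γ.n, p + 1 < g p → Γ.B (y p) (y (g p)) ∧
    ∀ i, p < i → i < g p → Γ.B (y p) (y i) ∧ Γ.B (y i) (y (g p))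
  clique : ∀ a b v w, Γ.B a b → Γ.B a v → Γ.B v b → Γ.B a w → Γ.B w b → v ≠ w → Γ.B v w

namespace Guide

variable {Γ : Env} {y c g : ℕ → ℕ}

/-- The tables in the state make `step` follow the skeleton. -/
def Follows (Γ : Env) (y c g : ℕ → ℕ) (s : State) : Prop :=
  ∀ p < Γ.n, stepFun s (y p) (c p) = (y (g p), c (g p))

theorem Follows.congr {s s' : State} (h : Follows Γ y c g s) (hP : s'.mem mP = s.mem mP)
    (hQ : s'.mem mQ = s.mem mQ) (hE : s'.mem mE = s.mem mE) (hX : s'.mem mX = s.mem mX)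
    (hK : s'.reg rK = s.reg rK) (ht : s'.reg rE = s.reg rE) : Follows Γ y c g s' := by
  intro p hp
  rw [← h p hp]
  simp only [stepFun, hP, hQ, hE, hX, hK, ht]

theorem Follows.frame {s : State} (h : Follows Γ y c g s) {nb : ℕ → ℕ} (d : Cmd)
    (h1 : mP ∉ d.arrs ∧ mQ ∉ d.arrs ∧ mE ∉ d.arrs ∧ mX ∉ d.arrs)
    (h2 : rK ∉ d.regs ∧ rE ∉ d.regs) : Follows Γ y c g (d.den nb s) :=
  h.congr (Cmd.frame_mem d s h1.1) (Cmd.frame_mem d s h1.2.1) (Cmd.frame_mem d s h1.2.2.1)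
    (Cmd.frame_mem d s h1.2.2.2) (Cmd.frame_reg d s h2.1) (Cmd.frame_reg d s h2.2)

theorem Follows.setReg {s : State} (h : Follows Γ y c g s) {x v : ℕ} (h1 : x ≠ rK) (h2 : x ≠ rE) :
    Follows Γ y c g (s.setReg x v) :=
  h.congr rfl rfl rfl rfl (by simp [h1.symm]) (by simp [h2.symm])

theorem iterate_lt (H : Guide Γ y c g) (m : ℕ) : g^[m] 0 < Γ.n := by
  induction m with
  | zero => exact H.pos
  | succ m ih => rw [Function.iterate_succ_apply']; exact H.g_lt _ ih

theorem le_g (H : Guide Γ y c g) {p : ℕ} (hp : p < Γ.n) : p ≤ g p := by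
  rcases Nat.lt_or_ge (p + 1) Γ.n with h | h
  · exact (H.g_gt p h).le
  · exact (H.g_last p (by omega)).ge

theorem iterate_mono (H : Guide Γ y c g) : Monotone (fun m => g^[m] 0) :=
  monotone_nat_of_le_succ fun m => by
    rw [Function.iterate_succ_apply']; exact H.le_g (H.iterate_lt m)

/-- The skeleton advances by at least one position per step until it reaches the last one, where it
stays, so `n` steps are enough. -/
theorem min_le_iterate (H : Guide Γ y c g) (m : ℕ) : m ≤ g^[m] 0 ∨ g^[m] 0 + 1 = Γ.n := by
  induction m with
  | zero => left; exact Nat.zero_le _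
  | succ m ih =>
    rw [Function.iterate_succ_apply']
    have h1 := H.iterate_lt m
    rcases Nat.lt_or_ge (g^[m] 0 + 1) Γ.n with h | h
    · have := H.g_gt _ h
      left; omega
    · right
      rw [H.g_last _ (by omega)]; omega

theorem iterate_n (H : Guide Γ y c g) : g^[Γ.n] 0 + 1 = Γ.n := by
  have := H.iterate_lt Γ.n
  rcases H.min_le_iterate Γ.n with h | h
  · omega
  · exact h

/-- `step` goes from one skeleton vertex to the next. -/
theorem den_step {s : State} {nb : ℕ → ℕ} {p : ℕ} (hf : Follows Γ y c g s)
    (hp : p < Γ.n) (hx : s.reg rX = y p) (hj : s.reg rJ = c p) :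
    (step.den nb s).reg rX = y (g p) ∧ (step.den nb s).reg rJ = c (g p) := by
  have h := POH.den_step (nb := nb) s
  rw [hx, hj, hf p hp, Prod.mk.injEq] at h
  exact h

/-- A skeleton vertex that is due later may be a common neighbour of the current pair. The marks
keep `fill` from using it up. -/
theorem den_markSkeleton (H : Guide Γ y c g) {s : State} (hf : Follows Γ y c g s)
    (hS : s.reg rS = y 0) (hI : ∀ v < Γ.n, s.mem mI v 0 = 0) :
    ∀ v < Γ.n, (markSkeleton.den Γ.nb s).mem mI v 0 ≠ 0 ↔ ∃ m ≤ Γ.n, v = y (g^[m] 0) := by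
  have key := Cmd.forto_inv (nb := Γ.nb) (x := rM) (y := rN)
    (s := (Cmd.store mI (.reg rX) (.const 0) (.const 1)).den Γ.nb
      ((Cmd.assign rJ (.const 0)).den Γ.nb ((Cmd.assign rX (.reg rS)).den Γ.nb s)))
    (P := step ;; .store mI (.reg rX) (.const 0) (.const 1))
    (fun i s' => Follows Γ y c g s' ∧ s'.reg rX = y (g^[i] 0) ∧ s'.reg rJ = c (g^[i] 0) ∧
      ∀ v < Γ.n, s'.mem mI v 0 ≠ 0 ↔ ∃ m ≤ i, v = y (g^[m] 0)) ?_ ?_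
  · exact key.2.2.2
  · refine ⟨?_, by simp [Expr.eval, hS], by simp [Expr.eval, H.c_zero], ?_⟩
    · exact Follows.setReg (((hf.frame _ (by decide) (by decide)).frame _ (by decide)
        (by decide)).frame _ (by decide) (by decide)) (by decide) (by decide)
    · intro v hv
      simp [Expr.eval, State.setMem_mem_same, hS, hI v hv]
  · rintro i s' - - ⟨hf, hx, hj, hI⟩
    obtain ⟨hx', hj'⟩ := den_step (nb := Γ.nb) hf (H.iterate_lt i) hx hj
    rw [← Function.iterate_succ_apply' g] at hx' hj'
    have hm : (step.den Γ.nb s').mem mI = s'.mem mI := Cmd.frame_mem _ _ (by decide)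
    refine ⟨Follows.setReg ((hf.frame step (by decide) (by decide)).frame _ (by decide)
      (by decide)) (by decide) (by decide), ?_, ?_, ?_⟩
    · simpa [Expr.eval] using hx'
    · simpa [Expr.eval] using hj'
    · intro v hv
      have h1 := hI v hv
      simp only [Cmd.den_seq, Cmd.den_store, Expr.eval, State.setReg_mem, State.setMem_mem_same,
        hx', hm, and_true]
      by_cases hvx : v = y (g^[i + 1] 0)
      · rw [if_pos hvx]
        exact ⟨fun _ => ⟨i + 1, le_rfl, hvx⟩, fun _ => one_ne_zero⟩
      · rw [if_neg hvx, h1]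
        constructor
        · rintro ⟨m, hm, e⟩; exact ⟨m, by omega, e⟩
        · rintro ⟨m, hm, e⟩
          rcases Nat.lt_or_eq_of_le hm with h | rfl
          · exact ⟨m, by omega, e⟩
          · exact absurd e hvx

/-- The situation between the skeleton vertices at positions `p` and `g p`, when the vertices at
positions `< k` have been visited. -/
structure Between (Γ : Env) (y g : ℕ → ℕ) (I : ℕ → ℕ → ℕ) (p k : ℕ) (s : State) : Prop where
  static : Static Γ s
  mark : s.mem mI = I
  x : s.reg rX = y (g p)
  prev : s.reg rY = y p
  vis : ∀ q < k, q < Γ.n → s.mem mV (y q) 0 ≠ 0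
  -- Filling avoids marked vertices, so the next skeleton vertex is still free when its turn comes.
  fresh : ∀ v < Γ.n, s.mem mV v 0 ≠ 0 → I v 0 ≠ 0 → ∃ q ≤ p, v = y q
  -- The path ends at the skeleton vertex or inside the gap, so it can be continued to `y (g p)`.
  -- The condition `p < g p` excludes the second case at the last position.
  cur : s.reg rC = y p ∨ p < g p ∧ Γ.B (y p) (s.reg rC) ∧ Γ.B (s.reg rC) (y (g p))
  curvis : s.mem mV (s.reg rC) 0 ≠ 0
  len : s.reg rL ≠ 0
  first : s.reg rB = y 0

theorem Between.setReg {I : ℕ → ℕ → ℕ} {p k : ℕ} {s : State} (h : Between Γ y g I p k s) {z v : ℕ}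
    (hz : z ∉ [rN, rX, rY, rC, rL, rB]) : Between Γ y g I p k (s.setReg z v) := by
  simp only [List.mem_cons, List.not_mem_nil, or_false, not_or] at hz
  obtain ⟨h1, h2, h3, h4, h5, h6⟩ := hz
  refine ⟨h.static.setReg h1, h.mark, ?_, ?_, h.vis, h.fresh, ?_, ?_, ?_, ?_⟩
  · simp [Ne.symm h2, h.x]
  · simp [Ne.symm h3, h.prev]
  · simpa [Ne.symm h4] using h.cur
  · simpa [Ne.symm h4] using h.curvis
  · simpa [Ne.symm h5] using h.len
  · simpa [Ne.symm h6] using h.first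

theorem Between.mono {I : ℕ → ℕ → ℕ} {p k k' : ℕ} {s : State} (h : Between Γ y g I p k s)
    (hk : k' ≤ k) : Between Γ y g I p k' s :=
  { h with vis := fun q hq => h.vis q (by omega) }

/-- The body of the loop of `fill`. -/
theorem Between.body (H : Guide Γ y c g) {I : ℕ → ℕ → ℕ} {p k : ℕ} {s : State} (hp : p < Γ.n)
    (hpk : p < k) (hI : ∀ i, p < i → i < g p → I (y i) 0 = 0) (h : Between Γ y g I p k s) :
    Between Γ y g I p k ((Cmd.when (.and (.eq (.get mI (.reg rW) (.const 0)) (.const 0))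
      (.and (.adjB (.reg rY) (.reg rW)) (.adjB (.reg rW) (.reg rX))))
      (.assign rV (.reg rW) ;; tryVisit)).den Γ.nb s) ∧
    (s.reg rW = y k → k < g p →
      Between Γ y g I p (k + 1) ((Cmd.when (.and (.eq (.get mI (.reg rW) (.const 0)) (.const 0))
        (.and (.adjB (.reg rY) (.reg rW)) (.adjB (.reg rW) (.reg rX))))
        (.assign rV (.reg rW) ;; tryVisit)).den Γ.nb s)) := by
  have hext : ∀ {s' : State}, Between Γ y g I p k s' → s'.mem mV (y k) 0 ≠ 0 →
      Between Γ y g I p (k + 1) s' := by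
    intro s' h' hk
    refine { h' with vis := fun q hq hqn => ?_ }
    rcases Nat.lt_or_eq_of_le (Nat.le_of_lt_succ hq) with hq | rfl
    · exact h'.vis q hq hqn
    · exact hk
  have hguard : Cond.eval s (.and (.eq (.get mI (.reg rW) (.const 0)) (.const 0))
      (.and (.adjB (.reg rY) (.reg rW)) (.adjB (.reg rW) (.reg rX)))) ↔
      I (s.reg rW) 0 = 0 ∧ Γ.B (y p) (s.reg rW) ∧ Γ.B (s.reg rW) (y (g p)) := by
    simp only [Cond.eval, h.static.adjB, Expr.eval, h.mark, h.x, h.prev]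
  by_cases hg : I (s.reg rW) 0 = 0 ∧ Γ.B (y p) (s.reg rW) ∧ Γ.B (s.reg rW) (y (g p))
  · rw [Cmd.when, Cmd.den_cond_pos (hguard.2 hg), Cmd.den_seq]
    set s₁ := (Cmd.assign rV (.reg rW)).den Γ.nb s with hs₁
    have h1 : Between Γ y g I p k s₁ := h.setReg (by decide)
    have eV : s₁.reg rV = s.reg rW := by simp [hs₁, Expr.eval]
    obtain ⟨t1, t2⟩ := den_tryVisit h1.static
    have fr : ∀ z ∉ Cmd.regs tryVisit, (tryVisit.den Γ.nb s₁).reg z = s₁.reg z :=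
      fun z hz => Cmd.frame_reg _ _ hz
    by_cases hc : CanVisit Γ s₁
    · obtain ⟨a1, a2, a3, a4⟩ := t1 hc
      obtain ⟨b1, b2, b3, b4⟩ := hc
      rw [eV] at a1 a3 b2 b3
      have hmono : ∀ v, s₁.mem mV v 0 ≠ 0 → (tryVisit.den Γ.nb s₁).mem mV v 0 ≠ 0 := by
        intro v hv
        rw [a1]
        split_ifs
        · exact one_ne_zero
        · exact hv
      -- At the last position every vertex has been visited, so nothing could be appended.
      have hlt : p < g p := by
        rcases Nat.lt_or_ge (p + 1) Γ.n with h' | h'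
        · exact H.g_gt p h'
        · obtain ⟨q, hq, e⟩ := H.surj _ b2
          exact absurd b3 (e ▸ h1.vis q (by omega) hq)
      have hres : Between Γ y g I p k (tryVisit.den Γ.nb s₁) := by
        refine ⟨h1.static.frame _ (by decide) (by decide), ?_, ?_, ?_, ?_, ?_, ?_, ?_, ?_, ?_⟩
        · rw [Cmd.frame_mem _ _ (by decide)]; exact h1.mark
        · rw [fr _ (by decide)]; exact h1.x
        · rw [fr _ (by decide)]; exact h1.prev
        · exact fun q hq hqn => hmono _ (h1.vis q hq hqn)
        · intro v hv hv1 hv2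
          rw [a1] at hv1
          split_ifs at hv1 with e
          · rw [e] at hv2
            exact absurd hg.1 hv2
          · exact h1.fresh v hv hv1 hv2
        · right
          rw [a3]
          exact ⟨hlt, hg.2⟩
        · rw [a3, a1, if_pos rfl]
          exact one_ne_zero
        · rw [a2]; omega
        · rw [a4, if_neg h1.len]; exact h1.first
      refine ⟨hres, fun hw hk => hext hres ?_⟩
      rw [a1, if_pos hw.symm]
      exact one_ne_zero
    · obtain ⟨a1, a2, a3, a4⟩ := t2 hc
      have hres : Between Γ y g I p k (tryVisit.den Γ.nb s₁) := by
        refine ⟨h1.static.frame _ (by decide) (by decide), ?_, ?_, ?_, ?_, ?_, ?_, ?_, ?_, ?_⟩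
        · rw [Cmd.frame_mem _ _ (by decide)]; exact h1.mark
        · rw [fr _ (by decide)]; exact h1.x
        · rw [fr _ (by decide)]; exact h1.prev
        · rw [a1]; exact h1.vis
        · rw [a1]; exact h1.fresh
        · rw [a3]; exact h1.cur
        · rw [a1, a3]; exact h1.curvis
        · rw [a2]; exact h1.len
        · rw [a4]; exact h1.first
      -- If `y k` were unvisited it could be appended, against `hc`: its predecessors are at
      -- positions `< k`, and the path ends at `y p` or at another common neighbour, which is
      -- adjacent to `y k` by `clique`.
      refine ⟨hres, fun hw hk => hext hres ?_⟩
      rw [a1]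
      intro hz
      have hkn : k < Γ.n := hk.trans (H.g_lt p hp)
      rw [← hw] at hz
      apply hc
      refine ⟨?_, ?_, ?_, ?_⟩
      · rw [eV, hw]
        intro w hwn hR hne
        obtain ⟨q, hq, rfl⟩ := H.surj w hwn
        have := H.ord q hq k hkn hR
        refine h1.vis q (lt_of_le_of_ne this ?_) hq
        rintro rfl
        exact hne rfl
      · rw [eV, hw]; exact H.lt k hkn
      · rw [eV]; exact hz
      · right
        rw [eV]
        rcases h1.cur with e | ⟨-, e1, e2⟩
        · rw [e]; exact hg.2.1.1
        · refine (H.clique _ _ _ _ (H.between p hp (by omega)).1 e1 e2 hg.2.1 hg.2.2 ?_).1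
          intro e
          exact h1.curvis (e ▸ hz)
  · rw [Cmd.when, Cmd.den_cond_neg (fun e => hg (hguard.1 e)), Cmd.den_skip]
    refine ⟨h, fun hw hk => absurd ?_ hg⟩
    rw [hw]
    exact ⟨hI k hpk hk, (H.between p hp (by omega)).2 k hpk hk⟩

/-- Each sweep settles one more tour position `k`: the sweep meets `y k` and appends it unless it
has been visited already. Extra vertices inserted by the greedy rule do no harm. -/
theorem Between.fill (H : Guide Γ y c g) {I : ℕ → ℕ → ℕ} {p : ℕ} {s : State} (hp : p < Γ.n)
    (hI : ∀ i, p < i → i < g p → I (y i) 0 = 0) (h : Between Γ y g I p (p + 1) s) :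
    Between Γ y g I p (max (p + 1) (g p)) (fill.den Γ.nb s) := by
  have key := Cmd.forto_inv (nb := Γ.nb) (x := rH) (y := rN) (s := s)
    (P := .forto rW rN <|
    .when (.and (.eq (.get mI (.reg rW) (.const 0)) (.const 0))
      (.and (.adjB (.reg rY) (.reg rW)) (.adjB (.reg rW) (.reg rX))))
      (.assign rV (.reg rW) ;; tryVisit))
    -- After `h` sweeps the positions below `p + 1 + h` are settled, as far as they belong to the
    -- gap; the `max` takes care of `g p = p`.
    (fun h s' => Between Γ y g I p (max (p + 1) (min (p + 1 + h) (g p))) s')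
    ((h.setReg (by decide)).mono (by omega)) ?_
  · refine Between.mono key ?_
    have := H.g_lt p hp
    rw [Env.nb_n]
    omega
  · intro i s' hi _ hs
    apply Between.setReg _ (by decide)
    set k := max (p + 1) (min (p + 1 + i) (g p)) with hk
    have inner := Cmd.forto_inv (nb := Γ.nb) (x := rW) (y := rN) (s := s')
      (P := .when (.and (.eq (.get mI (.reg rW) (.const 0)) (.const 0))
        (.and (.adjB (.reg rY) (.reg rW)) (.adjB (.reg rW) (.reg rX))))
        (.assign rV (.reg rW) ;; tryVisit))
      (fun w s' => Between Γ y g I p k s' ∧ (y k < w → k < g p → Between Γ y g I p (k + 1) s'))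
      ⟨hs.setReg (by decide), fun h => by omega⟩ ?_
    · by_cases hkg : k < g p
      · exact (inner.2 (H.lt k (hkg.trans (H.g_lt p hp))) hkg).mono (by omega)
      · exact inner.1.mono (by omega)
    · rintro w s'' - hw ⟨h1, h2⟩
      obtain ⟨b1, b2⟩ := h1.body H hp (by omega) hI
      refine ⟨b1.setReg (by decide), fun hyw hkg => Between.setReg ?_ (by decide)⟩
      rcases Nat.lt_or_eq_of_le (Nat.le_of_lt_succ hyw) with h | h
      · exact ((h2 h hkg).body H hp (by omega) hI).1
      · exact b2 (by rw [hw, h]) hkg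

/-- The situation at the skeleton vertex at position `p`. -/
structure At (Γ : Env) (y c g : ℕ → ℕ) (I : ℕ → ℕ → ℕ) (p : ℕ) (s : State) : Prop where
  static : Static Γ s
  follows : Follows Γ y c g s
  mark : s.mem mI = I
  x : s.reg rX = y p
  j : s.reg rJ = c p
  vis : ∀ q ≤ p, s.mem mV (y q) 0 ≠ 0
  fresh : ∀ v < Γ.n, s.mem mV v 0 ≠ 0 → I v 0 ≠ 0 → ∃ q ≤ p, v = y q
  cur : s.reg rC = y p
  len : s.reg rL ≠ 0
  first : s.reg rB = y 0

theorem At.setReg {I : ℕ → ℕ → ℕ} {p : ℕ} {s : State} (h : At Γ y c g I p s) {v : ℕ} :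
    At Γ y c g I p (s.setReg rM v) :=
  ⟨h.static.setReg (by decide), h.follows.setReg (by decide) (by decide), h.mark,
    by simpa using h.x, by simpa using h.j, h.vis, h.fresh, by simpa using h.cur,
    by simpa using h.len, by simpa using h.first⟩

/-- From one skeleton vertex to the next. -/
theorem At.next (H : Guide Γ y c g) {I : ℕ → ℕ → ℕ} {p : ℕ} {s : State} (hp : p < Γ.n)
    (hI : ∀ i, p < i → i < g p → I (y i) 0 = 0) (hIg : I (y (g p)) 0 ≠ 0)
    (h : At Γ y c g I p s) :
    At Γ y c g I (g p) ((.assign rY (.reg rX) ;; step ;; fill ;; .assign rV (.reg rX) ;;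
      tryVisit : Cmd).den Γ.nb s) := by
  simp only [Cmd.den_seq]
  set s₁ := (Cmd.assign rY (.reg rX)).den Γ.nb s with hs₁
  have f1 : Follows Γ y c g s₁ := h.follows.setReg (by decide) (by decide)
  obtain ⟨hx, hj⟩ := den_step (nb := Γ.nb) f1 hp (by simpa [hs₁] using h.x)
    (by simpa [hs₁] using h.j)
  have f2 : Follows Γ y c g (step.den Γ.nb s₁) := f1.frame _ (by decide) (by decide)
  have b2 : Between Γ y g I p (p + 1) (step.den Γ.nb s₁) := by
    have hr : ∀ z, z ≠ rY → z ∉ step.regs → (step.den Γ.nb s₁).reg z = s.reg z := by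
      intro z hz hz'
      rw [Cmd.frame_reg _ _ hz']
      simp [hs₁, hz]
    have hV : (step.den Γ.nb s₁).mem mV = s.mem mV := by
      rw [Cmd.frame_mem _ _ (by decide)]; rfl
    refine ⟨(h.static.setReg (by decide)).frame _ (by decide) (by decide), ?_, hx, ?_, ?_, ?_,
      Or.inl ?_, ?_, ?_, ?_⟩
    · rw [Cmd.frame_mem _ _ (by decide)]; exact h.mark
    · rw [Cmd.frame_reg _ _ (by decide)]
      simpa [hs₁, Expr.eval] using h.x
    · rw [hV]; exact fun q hq _ => h.vis q (by omega)
    · rw [hV]; exact h.fresh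
    · rw [hr _ (by decide) (by decide)]; exact h.cur
    · rw [hr _ (by decide) (by decide), hV, h.cur]; exact h.vis p le_rfl
    · rw [hr _ (by decide) (by decide)]; exact h.len
    · rw [hr _ (by decide) (by decide)]; exact h.first
  generalize step.den Γ.nb s₁ = s₂ at *
  have b3 := b2.fill H hp hI
  have f3 : Follows Γ y c g (fill.den Γ.nb s₂) := f2.frame _ (by decide) (by decide)
  have hj3 : (fill.den Γ.nb s₂).reg rJ = c (g p) := by
    rw [Cmd.frame_reg _ _ (by decide)]; exact hj
  generalize fill.den Γ.nb s₂ = s₃ at *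
  set s₄ := (Cmd.assign rV (.reg rX)).den Γ.nb s₃ with hs₄
  have b4 : Between Γ y g I p (max (p + 1) (g p)) s₄ := b3.setReg (by decide)
  have f4 : Follows Γ y c g s₄ := f3.setReg (by decide) (by decide)
  have hj4 : s₄.reg rJ = c (g p) := by simpa [hs₄] using hj3
  have eV : s₄.reg rV = y (g p) := by simpa [hs₄, Expr.eval] using b3.x
  have hgn := H.g_lt p hp
  obtain ⟨t1, t2⟩ := den_tryVisit b4.static
  rcases Nat.lt_or_ge (p + 1) Γ.n with hlast | hlast
  · have hlt := H.g_gt p hlast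
    have hc : CanVisit Γ s₄ := by
      refine ⟨?_, by rw [eV]; exact H.lt _ hgn, ?_, Or.inr ?_⟩
      · rw [eV]
        intro w hw hR hne
        obtain ⟨q, hq, rfl⟩ := H.surj w hw
        have := H.ord q hq _ hgn hR
        refine b4.vis q ?_ hq
        have : q ≠ g p := by rintro rfl; exact hne rfl
        omega
      · rw [eV]
        by_contra hv
        obtain ⟨q, hq, e⟩ := b4.fresh _ (H.lt _ hgn) hv hIg
        have := H.inj _ hgn _ (by omega) e
        omega
      · rw [eV]
        rcases b4.cur with e | ⟨-, -, e⟩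
        · rw [e]
          rcases Nat.lt_or_ge (p + 1) (g p) with h' | h'
          · exact (H.between p hp h').1.1
          · have : g p = p + 1 := by omega
            rw [this]
            exact H.adj p hlast
        · exact e.1
    obtain ⟨a1, a2, a3, a4⟩ := t1 hc
    rw [eV] at a1 a3
    refine ⟨b4.static.frame _ (by decide) (by decide), f4.frame _ (by decide) (by decide),
      ?_, ?_, ?_, ?_, ?_, a3, ?_, ?_⟩
    · rw [Cmd.frame_mem _ _ (by decide)]; exact b4.mark
    · rw [Cmd.frame_reg _ _ (by decide)]; exact b4.x
    · rw [Cmd.frame_reg _ _ (by decide)]; exact hj4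
    · intro q hq
      rw [a1]
      split_ifs with e
      · exact one_ne_zero
      · have : q ≠ g p := by rintro rfl; exact e rfl
        exact b4.vis q (by omega) (by omega)
    · intro v hv hv1 hv2
      rw [a1] at hv1
      split_ifs at hv1 with e
      · exact ⟨g p, le_rfl, e⟩
      · obtain ⟨q, hq, e⟩ := b4.fresh v hv hv1 hv2
        exact ⟨q, by omega, e⟩
    · rw [a2]; omega
    · rw [a4, if_neg b4.len]; exact b4.first
  -- At the end of the tour the skeleton stands still and `tryVisit` rejects the vertex, which has
  -- been visited before.
  · have hgp : g p = p := H.g_last p (by omega)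
    have hc : ¬ CanVisit Γ s₄ := by
      rintro ⟨-, -, hc, -⟩
      rw [eV] at hc
      exact b4.vis (g p) (by omega) hgn hc
    obtain ⟨a1, a2, a3, a4⟩ := t2 hc
    refine ⟨b4.static.frame _ (by decide) (by decide), f4.frame _ (by decide) (by decide),
      ?_, ?_, ?_, ?_, ?_, ?_, ?_, ?_⟩
    · rw [Cmd.frame_mem _ _ (by decide)]; exact b4.mark
    · rw [Cmd.frame_reg _ _ (by decide)]; exact b4.x
    · rw [Cmd.frame_reg _ _ (by decide)]; exact hj4
    · rw [a1]; exact fun q hq => b4.vis q (by omega) (by omega)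
    · rw [a1, hgp]; exact b4.fresh
    · rw [a3, hgp]
      rcases b4.cur with e | ⟨e, -⟩
      · exact e
      · omega
    · rw [a2]; exact b4.len
    · rw [a4]; exact b4.first

/-- After `n` steps the skeleton is at the last position of the tour, where the invariant `At` says
that all vertices have been visited. -/
theorem den_follow (H : Guide Γ y c g) {s : State} (hst : Static Γ s) (hf : Follows Γ y c g s)
    (hS : s.reg rS = y 0) (hV : ∀ v < Γ.n, s.mem mV v 0 = 0) (hL : s.reg rL = 0)
    (hI : ∀ v < Γ.n, s.mem mI v 0 ≠ 0 ↔ ∃ m ≤ Γ.n, v = y (g^[m] 0)) :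
    At Γ y c g (s.mem mI) (Γ.n - 1) (follow.den Γ.nb s) := by
  have h0n : 0 < Γ.n := H.pos
  have hn : Γ.n - 1 = g^[Γ.nb rN] 0 := by have := H.iterate_n; rw [Env.nb_n]; omega
  rw [hn]
  simp only [follow, Cmd.den_seq]
  refine Cmd.forto_inv (fun i s' => At Γ y c g (s.mem mI) (g^[i] 0) s') ?_ ?_
  · apply At.setReg
    set s₁ := (Cmd.assign rV (.reg rX)).den Γ.nb ((Cmd.assign rJ (.const 0)).den Γ.nb
      ((Cmd.assign rX (.reg rS)).den Γ.nb s)) with hs₁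
    have h1 : Static Γ s₁ := ((hst.frame _ (by decide) (by decide)).frame _ (by decide)
      (by decide)).frame _ (by decide) (by decide)
    have f1 : Follows Γ y c g s₁ := ((hf.frame _ (by decide) (by decide)).frame _ (by decide)
      (by decide)).frame _ (by decide) (by decide)
    have eV : s₁.reg rV = y 0 := by simp [hs₁, Expr.eval, hS]
    have eL : s₁.reg rL = 0 := by simp [hs₁, hL]
    have hc : CanVisit Γ s₁ := by
      refine ⟨?_, by rw [eV]; exact H.lt 0 h0n, by rw [eV]; exact hV _ (H.lt 0 h0n), Or.inl eL⟩
      rw [eV]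
      intro w hw hR hne
      obtain ⟨q, hq, rfl⟩ := H.surj w hw
      have := H.ord q hq 0 h0n hR
      obtain rfl : q = 0 := by omega
      exact absurd rfl hne
    obtain ⟨a1, a2, a3, a4⟩ := (den_tryVisit h1).1 hc
    rw [eV] at a1 a3 a4
    refine ⟨h1.frame _ (by decide) (by decide), f1.frame _ (by decide) (by decide), ?_, ?_, ?_, ?_,
      ?_, a3, ?_, ?_⟩
    · rw [Cmd.frame_mem _ _ (by decide)]; rfl
    · rw [Cmd.frame_reg _ _ (by decide)]; simp [hs₁, Expr.eval, hS]
    · rw [Cmd.frame_reg _ _ (by decide)]; simp [hs₁, Expr.eval, H.c_zero]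
    · intro q hq
      obtain rfl : q = 0 := by simpa using hq
      rw [a1, if_pos rfl]; exact one_ne_zero
    · intro v hv hv1 _
      rw [a1] at hv1
      split_ifs at hv1 with e
      · exact ⟨0, le_rfl, e⟩
      · exact absurd (hV v hv) hv1
    · rw [a2]; omega
    · rw [a4, if_pos eL]
  · intro i s' hi _ hs
    rw [Env.nb_n] at hi
    apply At.setReg
    have hp := H.iterate_lt i
    rw [Function.iterate_succ_apply']
    refine hs.next H hp ?_ ?_
    -- No skeleton position lies strictly between two consecutive ones, since the iterates of `g`
    -- are monotone.
    · intro k hk1 hk2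
      have hkn : k < Γ.n := hk2.trans (H.g_lt _ hp)
      by_contra hne
      obtain ⟨m, -, e⟩ := (hI _ (H.lt k hkn)).1 hne
      have e' := H.inj _ hkn _ (H.iterate_lt m) e
      rw [← Function.iterate_succ_apply' g] at hk2
      rcases Nat.lt_or_ge i m with h | h
      · have : g^[i.succ] 0 ≤ g^[m] 0 := H.iterate_mono h
        omega
      · have : g^[m] 0 ≤ g^[i] 0 := H.iterate_mono h
        omega
    · rw [← Function.iterate_succ_apply' g]
      exact (hI _ (H.lt _ (H.iterate_lt (i + 1)))).2 ⟨i + 1, by omega, rfl⟩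

/-- A trial with the right guess records success. -/
theorem den_trial (H : Guide Γ y c g) {cyc : Bool} {s : State} (hst : Static Γ s)
    (hf : Follows Γ y c g s) (hS : s.reg rS = y 0)
    (hcyc : cyc = true → Γ.A (y 0) (y (Γ.n - 1))) :
    ((clear ;; markSkeleton ;; follow ;; record cyc).den Γ.nb s).reg rG = 1 := by
  simp only [Cmd.den_seq]
  have h1 := hst.frame (nb := Γ.nb) clear (by decide) (by decide)
  have f1 := hf.frame (nb := Γ.nb) clear (by decide) (by decide)
  obtain ⟨k1, k2⟩ := den_clear (Γ := Γ) (s := s)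
  have t1 := track_clear (Γ := Γ) (s := s)
  have S1 : (clear.den Γ.nb s).reg rS = y 0 := by rw [Cmd.frame_reg _ _ (by decide), hS]
  generalize clear.den Γ.nb s = s₁ at *
  have h2 := h1.frame (nb := Γ.nb) markSkeleton (by decide) (by decide)
  have f2 := f1.frame (nb := Γ.nb) markSkeleton (by decide) (by decide)
  have t2 := t1.frame (nb := Γ.nb) markSkeleton (by decide) (by decide)
  have S2 : (markSkeleton.den Γ.nb s₁).reg rS = y 0 := by
    rw [Cmd.frame_reg _ _ (by decide), S1]
  have I2 := H.den_markSkeleton f1 S1 (fun v hv => (k1 v hv).2)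
  have V2 : ∀ v < Γ.n, (markSkeleton.den Γ.nb s₁).mem mV v 0 = 0 := by
    rw [Cmd.frame_mem _ _ (by decide)]; exact fun v hv => (k1 v hv).1
  have L2 : (markSkeleton.den Γ.nb s₁).reg rL = 0 := by
    rw [Cmd.frame_reg _ _ (by decide)]; exact k2
  generalize markSkeleton.den Γ.nb s₁ = s₂ at *
  have h3 := H.den_follow h2 f2 S2 V2 L2 I2
  obtain ⟨l, hl⟩ := exists_track_follow h2 ⟨_, t2⟩
  generalize follow.den Γ.nb s₂ = s₃ at *
  have hsub : List.range Γ.n ⊆ l := by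
    intro v hv
    have hv' : v < Γ.n := by simpa using hv
    obtain ⟨q, hq, rfl⟩ := H.surj v hv'
    by_contra hnot
    exact h3.vis q (by omega) ((hl.vis _ hv').2 hnot)
  have hle : Γ.n ≤ l.length := by
    simpa using (List.nodup_range.subperm hsub).length_le
  have hge : l.length ≤ Γ.n := by
    have hsub' : l ⊆ List.range Γ.n := fun v hv => by simpa using hl.good.lt v hv
    simpa using (hl.good.nodup.subperm hsub').length_le
  rw [record, Cmd.when, Cmd.den_cond_pos]
  · simp [Expr.eval]
  · refine ⟨?_, ?_⟩
    · simp only [Cond.eval, Expr.eval, h3.static.hN, hl.len]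
      omega
    · cases cyc with
      | false => simp [Cond.eval]
      | true =>
        simp only [if_true, Cond.eval, Expr.eval, h3.static.hA, mat_eq_one, h3.first, h3.cur]
        exact hcyc rfl

/-- The trials record success if the digits and the permutation are right. -/
theorem den_trials (H : Guide Γ y c g) {cyc : Bool} {s : State} (hst : Static Γ s)
    (hf : ∀ s' : State, s'.mem mP = s.mem mP → s'.mem mQ = s.mem mQ → s'.mem mE = s.mem mE →
      s'.mem mX = s.mem mX → s'.reg rK = s.reg rK → s'.reg rE = y (Γ.n - 1) → Follows Γ y c g s')
    (hcyc : cyc = true → Γ.A (y 0) (y (Γ.n - 1))) :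
    ((trials cyc).den Γ.nb s).reg rG = 1 := by
  set body := (clear ;; markSkeleton ;; follow ;; record cyc) with hbody
  have hn := H.pos
  have hfr : rN ∉ body.regs ∧ rK ∉ body.regs ∧ rS ∉ body.regs ∧ rE ∉ body.regs ∧
      mA ∉ body.arrs ∧ mR ∉ body.arrs ∧ mF ∉ body.arrs ∧ mP ∉ body.arrs ∧ mQ ∉ body.arrs ∧
      mE ∉ body.arrs ∧ mX ∉ body.arrs := by
    rw [hbody]; clear hbody body hcyc; revert cyc; decide
  obtain ⟨r1, r2, r3, r4, a0, a1, a2, a3, a4, a5, a6⟩ := hfr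
  let J : State → Prop := fun s' => Static Γ s' ∧ s'.mem mP = s.mem mP ∧ s'.mem mQ = s.mem mQ ∧
    s'.mem mE = s.mem mE ∧ s'.mem mX = s.mem mX ∧ s'.reg rK = s.reg rK
  have Jset : ∀ {s' : State} {x v : ℕ}, x ≠ rN → x ≠ rK → J s' → J (s'.setReg x v) := by
    rintro s' x v h1 h2 ⟨j1, j2, j3, j4, j5, j6⟩
    exact ⟨j1.setReg h1, j2, j3, j4, j5, by simpa [h2.symm] using j6⟩
  have Jbody : ∀ {s' : State}, J s' → J (body.den Γ.nb s') := by
    rintro s' ⟨j1, j2, j3, j4, j5, j6⟩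
    exact ⟨j1.frame _ r1 ⟨a0, a1, a2⟩, by rw [Cmd.frame_mem _ _ a3, j2],
      by rw [Cmd.frame_mem _ _ a4, j3], by rw [Cmd.frame_mem _ _ a5, j4],
      by rw [Cmd.frame_mem _ _ a6, j5], by rw [Cmd.frame_reg _ _ r2, j6]⟩
  have keep : ∀ {s' : State}, J s' → s'.reg rG = 1 → (body.den Γ.nb s').reg rG = 1 := by
    intro s' hJ hG
    rcases den_trial_sound (cyc := cyc) hJ.1 with e | e
    · rw [hbody, e, hG]
    · exact e.1
  -- Success persists once recorded (`keep`), so the two nested invariants only say whether the pair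
  -- `(y 0, y (n - 1))` has been tried.
  refine (Cmd.forto_inv (fun i s' => J s' ∧ (y 0 < i → s'.reg rG = 1))
    ⟨Jset (by decide) (by decide) ⟨hst, rfl, rfl, rfl, rfl, rfl⟩, fun h => by omega⟩ ?_).2
      (H.lt 0 hn)
  rintro i s' - hi ⟨hJ, hG⟩
  have inner := Cmd.forto_inv (nb := Γ.nb) (x := rE) (y := rN) (s := s') (P := body)
    (fun k s'' => J s'' ∧ s''.reg rS = i ∧
      (y 0 < i ∨ y 0 = i ∧ y (Γ.n - 1) < k → s''.reg rG = 1))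
    ⟨Jset (by decide) (by decide) hJ, by simpa using hi, ?_⟩ ?_
  · refine ⟨Jset (by decide) (by decide) inner.1, fun h => ?_⟩
    simp only [State.setReg_reg]
    refine inner.2.2 ?_
    have : y (Γ.n - 1) < Γ.nb rN := H.lt _ (by omega)
    omega
  · rintro (h | h)
    · simpa using hG h
    · omega
  · rintro k s'' - hk ⟨hJ', hS', hG'⟩
    refine ⟨Jset (by decide) (by decide) (Jbody hJ'), ?_, fun h => ?_⟩
    · simp only [State.setReg_reg]
      rw [if_neg (by decide), Cmd.frame_reg _ _ r3, hS']
    · simp only [State.setReg_reg]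
      rw [if_neg (by decide)]
      by_cases h' : y 0 < i ∨ y 0 = i ∧ y (Γ.n - 1) < k
      · exact keep hJ' (hG' h')
      · obtain ⟨e1, e2⟩ : y 0 = i ∧ y (Γ.n - 1) = k := by omega
        obtain ⟨j1, j2, j3, j4, j5, j6⟩ := hJ'
        exact H.den_trial j1 (hf s'' j2 j3 j4 j5 j6 (by rw [hk, e2])) (by rw [hS', e1]) hcyc

end Guide

end POH

namespace POH

/-! ### The list of edges -/

/-- `E` lists the `K` pairs `u < v` with `F u v`. -/
structure EdgeTable (n K : ℕ) (F : ℕ → ℕ → Prop) (E : ℕ → ℕ → ℕ) : Prop where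
  row : ∀ i < K, E i 0 < E i 1 ∧ E i 1 < n ∧ F (E i 0) (E i 1) ∧ E i 2 = E i 0
  inj : ∀ i < K, ∀ j < K, E i 0 = E j 0 → E i 1 = E j 1 → i = j
  surj : ∀ u v, u < v → v < n → F u v → ∃ i < K, E i 0 = u ∧ E i 1 = v

/-- The state of the listing before the pair `(u, w)` is considered. -/
structure Listed (n : ℕ) (F : ℕ → ℕ → Prop) (u w K : ℕ) (E : ℕ → ℕ → ℕ) : Prop where
  row : ∀ i < K, E i 0 < E i 1 ∧ E i 1 < n ∧ F (E i 0) (E i 1) ∧ E i 2 = E i 0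
  inj : ∀ i < K, ∀ j < K, E i 0 = E j 0 → E i 1 = E j 1 → i = j
  before : ∀ i < K, E i 0 < u ∨ E i 0 = u ∧ E i 1 < w
  surj : ∀ u' v, u' < v → v < n → F u' v → u' < u ∨ u' = u ∧ v < w →
    ∃ i < K, E i 0 = u' ∧ E i 1 = v

theorem Listed.skip {n u w K : ℕ} {F : ℕ → ℕ → Prop} {E : ℕ → ℕ → ℕ} (h : Listed n F u w K E)
    (hc : ¬ (u < w ∧ F u w)) : Listed n F u (w + 1) K E := by
  refine ⟨h.row, h.inj, fun i hi => ?_, fun u' v h1 h2 h3 h4 => ?_⟩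
  · have := h.before i hi; omega
  · by_cases h5 : u' = u ∧ v = w
    · rw [h5.1, h5.2] at h1 h3
      exact absurd ⟨h1, h3⟩ hc
    · exact h.surj u' v h1 h2 h3 (by omega)

/-- Pairs are met in lexicographic order, so `before` separates the new row from all earlier ones.
-/
theorem Listed.add {n u w K : ℕ} {F : ℕ → ℕ → Prop} {E E' : ℕ → ℕ → ℕ} (h : Listed n F u w K E)
    (hw : w < n) (huw : u < w) (hF : F u w) (hE : ∀ i, i ≠ K → E' i = E i) (h0 : E' K 0 = u)
    (h1 : E' K 1 = w) (h2 : E' K 2 = u) : Listed n F u (w + 1) (K + 1) E' := by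
  have hlt : ∀ i < K, E' i = E i := fun i hi => hE i (by omega)
  refine ⟨fun i hi => ?_, fun i hi j hj e0 e1 => ?_, fun i hi => ?_, fun u' v g1 g2 g3 g4 => ?_⟩
  · rcases Nat.lt_or_eq_of_le (Nat.le_of_lt_succ hi) with hi | rfl
    · rw [hlt i hi]; exact h.row i hi
    · rw [h0, h1, h2]; exact ⟨huw, hw, hF, rfl⟩
  · rcases Nat.lt_or_eq_of_le (Nat.le_of_lt_succ hi) with hi | rfl <;>
      rcases Nat.lt_or_eq_of_le (Nat.le_of_lt_succ hj) with hj | rfl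
    · rw [hlt i hi, hlt j hj] at e0 e1
      exact h.inj i hi j hj e0 e1
    · rw [hlt i hi, h0] at e0
      rw [hlt i hi, h1] at e1
      have := h.before i hi
      omega
    · rw [hlt j hj, h0] at e0
      rw [hlt j hj, h1] at e1
      have := h.before j hj
      omega
    · rfl
  · rcases Nat.lt_or_eq_of_le (Nat.le_of_lt_succ hi) with hi | rfl
    · rw [hlt i hi]; have := h.before i hi; omega
    · rw [h0, h1]; omega
  · by_cases h5 : u' = u ∧ v = w
    · exact ⟨K, by omega, by rw [h0, h5.1], by rw [h1, h5.2]⟩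
    · obtain ⟨i, hi, e⟩ := h.surj u' v g1 g2 g3 (by omega)
      exact ⟨i, by omega, by rw [hlt i hi]; exact e⟩

/-- The register `rK` is one more than the number of listed edges; the additional index `K` will be
the separator in the permutations. -/
theorem den_listEdges {n : ℕ} {F : ℕ → ℕ → Prop} {nb : ℕ → ℕ} {s : State} (hnb : nb rN = n)
    (hF : s.mem mF = mat F) (hK : s.reg rK = 1) :
    ∃ K, (listEdges.den nb s).reg rK = K + 1 ∧
      EdgeTable n K F ((listEdges.den nb s).mem mE) := by
  have key := Cmd.forto_inv (nb := nb) (x := rU) (y := rN) (s := s)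
    (P := .forto rW rN <|
      .when (.and (.lt (.reg rU) (.reg rW)) (.eq (.get mF (.reg rU) (.reg rW)) (.const 1))) <|
      .store mE (.pred (.reg rK)) (.const 0) (.reg rU) ;;
      .store mE (.pred (.reg rK)) (.const 1) (.reg rW) ;;
      .store mE (.pred (.reg rK)) (.const 2) (.reg rU) ;;
      .assign rK (.succ (.reg rK)))
    (fun u s' => s'.mem mF = mat F ∧ ∃ K, s'.reg rK = K + 1 ∧ Listed n F u 0 K (s'.mem mE))
    ⟨hF, 0, by simpa using hK, by simp, by simp, by simp, by simp⟩ ?_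
  · obtain ⟨-, K, h1, h2⟩ := key
    exact ⟨K, h1, h2.row, h2.inj, fun u v h3 h4 h5 => h2.surj u v h3 h4 h5 (by omega)⟩
  · rintro u s' - hu ⟨hF', K₀, hK₀, hL₀⟩
    have inner := Cmd.forto_inv (nb := nb) (x := rW) (y := rN) (s := s')
      (P := .when (.and (.lt (.reg rU) (.reg rW)) (.eq (.get mF (.reg rU) (.reg rW)) (.const 1))) <|
        .store mE (.pred (.reg rK)) (.const 0) (.reg rU) ;;
        .store mE (.pred (.reg rK)) (.const 1) (.reg rW) ;;
        .store mE (.pred (.reg rK)) (.const 2) (.reg rU) ;;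
        .assign rK (.succ (.reg rK)))
      (fun w s' => s'.mem mF = mat F ∧ s'.reg rU = u ∧
        ∃ K, s'.reg rK = K + 1 ∧ Listed n F u w K (s'.mem mE))
      ⟨hF', by simpa using hu, K₀, by simpa using hK₀, hL₀⟩ ?_
    · obtain ⟨h1, -, K, h2, h3⟩ := inner
      refine ⟨h1, K, by simpa using h2, h3.row, h3.inj, fun i hi => ?_,
        fun u' v g1 g2 g3 g4 => h3.surj u' v g1 g2 g3 (by omega)⟩
      have := h3.before i hi
      simp only [State.setReg_mem]
      omega
    · rintro w s'' hw hw' ⟨h1, h2, K, h3, h4⟩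
      rw [hnb] at hw
      by_cases hc : u < w ∧ F u w
      · rw [Cmd.when, Cmd.den_cond_pos
          (by simpa [Cond.eval, Expr.eval, h1, h2, hw'] using hc)]
        refine ⟨?_, by simpa using h2, K + 1, by simp [Expr.eval, h3],
          h4.add hw hc.1 hc.2 (fun i hi => ?_) ?_ ?_ ?_⟩
        · funext i j
          simp [State.setMem_mem, h1]
        · funext j
          simp [State.setMem_mem, Expr.eval, h3, hi]
        · simp [State.setMem_mem, Expr.eval, h3, h2]
        · simp [State.setMem_mem, Expr.eval, h3, hw']
        · simp [State.setMem_mem, Expr.eval, h3, h2]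
      · rw [Cmd.when, Cmd.den_cond_neg
          (by simpa [Cond.eval, Expr.eval, h1, h2, hw'] using hc)]
        exact ⟨h1, by simpa using h2, K, by simpa using h3, h4.skip hc⟩

/-! ### Breadth first search -/

/-- The state of a search from `a` when the levels up to `ρ + 1` are complete and those of the
pairs `(u', w')` before `(u, w)` have been considered for level `ρ + 2`. -/
structure Searching (B : ℕ → ℕ → Prop) (a ρ u w : ℕ) (D X : ℕ → ℕ) : Prop where
  top : ∀ v, D v ≤ ρ + 2
  root : D a = 1
  one : ∀ v, D v = 1 → v = a
  pred : ∀ v d, D v = d + 2 → B v (X v) ∧ D (X v) = d + 1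
  step : ∀ v z, B v z → 0 < D z → D z ≤ ρ → 0 < D v ∧ D v ≤ D z + 1
  part : ∀ v z, v < u ∨ v = u ∧ z < w → B v z → D z = ρ + 1 → 0 < D v

theorem Searching.skip {B : ℕ → ℕ → Prop} {a ρ u w : ℕ} {D X : ℕ → ℕ}
    (h : Searching B a ρ u w D X) (hc : ¬ (D u = 0 ∧ D w = ρ + 1 ∧ B u w)) :
    Searching B a ρ u (w + 1) D X := by
  refine { h with part := fun v z hvz hB hz => ?_ }
  by_cases e : v = u ∧ z = w
  · obtain ⟨rfl, rfl⟩ := e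
    by_contra h0
    exact hc ⟨by omega, hz, hB⟩
  · exact h.part v z (by omega) hB hz

/-- The level written is `ρ + 2`, whereas neighbours are searched at level `ρ + 1`, so the update in
place does not disturb the sweep. -/
theorem Searching.add {B : ℕ → ℕ → Prop} {a ρ u w : ℕ} {D X D' X' : ℕ → ℕ}
    (h : Searching B a ρ u w D X) (h0 : D u = 0) (hw : D w = ρ + 1) (hB : B u w)
    (hD : ∀ v, v ≠ u → D' v = D v) (hX : ∀ v, v ≠ u → X' v = X v) (hDu : D' u = ρ + 2)
    (hXu : X' u = w) : Searching B a ρ u (w + 1) D' X' := by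
  have hne : ∀ v, 0 < D v → v ≠ u := by rintro v hv rfl; omega
  have hold : ∀ v, D' v ≠ ρ + 2 → v ≠ u := by rintro v hv rfl; exact hv hDu
  have hpos : ∀ v, 0 < D v → 0 < D' v := fun v hv => by rw [hD v (hne v hv)]; exact hv
  refine ⟨fun v => ?_, ?_, fun v hv => ?_, fun v d hv => ?_, fun v z hvz h1 h2 => ?_,
    fun v z hvz hvB hz => ?_⟩
  · by_cases e : v = u
    · rw [e, hDu]
    · rw [hD v e]; exact h.top v
  · rw [hD a (hne a (by rw [h.root]; omega))]; exact h.root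
  · have e := hold v (by omega)
    exact h.one v (by rw [← hD v e]; exact hv)
  · by_cases e : v = u
    · subst e
      rw [hXu, hD w (hne w (by omega))]
      exact ⟨hB, by omega⟩
    · rw [hD v e] at hv
      obtain ⟨p1, p2⟩ := h.pred v d hv
      rw [hX v e, hD _ (hne _ (by omega))]
      exact ⟨p1, p2⟩
  · have e := hold z (by omega)
    rw [hD z e] at h1 h2 ⊢
    obtain ⟨p1, p2⟩ := h.step v z hvz h1 h2
    rw [hD v (hne v p1)]
    exact ⟨p1, p2⟩
  · have e := hold z (by omega)
    rw [hD z e] at hz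
    by_cases e' : v = u
    · rw [e', hDu]; omega
    · rw [hD v e']
      exact h.part v z (by omega) hvB hz

/-- The state of a search from `a` when the levels up to `ρ + 1` are complete. -/
structure Searched (B : ℕ → ℕ → Prop) (a ρ : ℕ) (D X : ℕ → ℕ) : Prop where
  top : ∀ v, D v ≤ ρ + 1
  root : D a = 1
  one : ∀ v, D v = 1 → v = a
  pred : ∀ v d, D v = d + 2 → B v (X v) ∧ D (X v) = d + 1
  step : ∀ v z, B v z → 0 < D z → D z ≤ ρ → 0 < D v ∧ D v ≤ D z + 1

theorem den_searchLevel {Γ : Env} {s : State} {a ρ : ℕ} (hB : ∀ u v, Γ.B u v → u < Γ.n ∧ v < Γ.n)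
    (hst : Static Γ s) (ha : s.reg rA = a) (hρ : s.reg rH = ρ)
    (h : Searched Γ.B a ρ (s.mem mD a) (s.mem mX a)) :
    Searched Γ.B a (ρ + 1) ((searchLevel.den Γ.nb s).mem mD a)
      ((searchLevel.den Γ.nb s).mem mX a) ∧
    ∀ a', a' ≠ a → (searchLevel.den Γ.nb s).mem mD a' = s.mem mD a' ∧
      (searchLevel.den Γ.nb s).mem mX a' = s.mem mX a' := by
  let J : ℕ → ℕ → State → Prop := fun u w s' => Static Γ s' ∧ s'.reg rA = a ∧ s'.reg rH = ρ ∧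
    Searching Γ.B a ρ u w (s'.mem mD a) (s'.mem mX a) ∧
    ∀ a', a' ≠ a → s'.mem mD a' = s.mem mD a' ∧ s'.mem mX a' = s.mem mX a'
  have Jset : ∀ {u w : ℕ} {s' : State} {x v : ℕ}, x ≠ rN → x ≠ rA → x ≠ rH → J u w s' →
      J u w (s'.setReg x v) := by
    rintro u w s' x v h1 h2 h3 ⟨j1, j2, j3, j4, j5⟩
    exact ⟨j1.setReg h1, by simpa [h2.symm] using j2, by simpa [h3.symm] using j3, j4, j5⟩
  have key := Cmd.forto_inv (nb := Γ.nb) (x := rU) (y := rN) (s := s)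
    (P := .forto rW rN <|
    .when (.and (.eq (.get mD (.reg rA) (.reg rU)) (.const 0))
      (.and (.eq (.get mD (.reg rA) (.reg rW)) (.succ (.reg rH)))
        (.adjB (.reg rU) (.reg rW)))) <|
      .store mD (.reg rA) (.reg rU) (.succ (.succ (.reg rH))) ;;
      .store mX (.reg rA) (.reg rU) (.reg rW))
    (fun u s' => J u 0 s') ?_ ?_
  · obtain ⟨-, -, -, j4, j5⟩ := key
    refine ⟨⟨j4.top, j4.root, j4.one, j4.pred, fun v z hvz h1 h2 => ?_⟩, j5⟩
    rcases Nat.lt_or_eq_of_le h2 with h2 | h2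
    · exact j4.step v z hvz h1 (Nat.le_of_lt_succ h2)
    · refine ⟨j4.part v z (Or.inl (hB v z hvz).1) hvz h2, ?_⟩
      rw [h2]
      exact j4.top v
  · refine Jset (by decide) (by decide) (by decide) ⟨hst, ha, hρ, ⟨fun v => ?_, h.root, h.one,
      h.pred, h.step, by simp⟩, fun _ _ => ⟨rfl, rfl⟩⟩
    have := h.top v
    omega
  · rintro u s' - hu hJ
    have inner := Cmd.forto_inv (nb := Γ.nb) (x := rW) (y := rN) (s := s')
      (P := .when (.and (.eq (.get mD (.reg rA) (.reg rU)) (.const 0))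
        (.and (.eq (.get mD (.reg rA) (.reg rW)) (.succ (.reg rH)))
          (.adjB (.reg rU) (.reg rW)))) <|
        .store mD (.reg rA) (.reg rU) (.succ (.succ (.reg rH))) ;;
        .store mX (.reg rA) (.reg rU) (.reg rW))
      (fun w s' => s'.reg rU = u ∧ J u w s')
      ⟨by simpa using hu, Jset (by decide) (by decide) (by decide) hJ⟩ ?_
    · apply Jset (by decide) (by decide) (by decide)
      obtain ⟨-, j1, j2, j3, j4, j5⟩ := inner
      refine ⟨j1, j2, j3, { j4 with part := fun v z hvz hb hz => ?_ }, j5⟩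
      exact j4.part v z (by have := (hB v z hb).2; rw [Env.nb_n]; omega) hb hz
    · rintro w s'' - hw ⟨hu', j1, j2, j3, j4, j5⟩
      have hcond : Cond.eval s'' (.and (.eq (.get mD (.reg rA) (.reg rU)) (.const 0))
          (.and (.eq (.get mD (.reg rA) (.reg rW)) (.succ (.reg rH)))
          (.adjB (.reg rU) (.reg rW)))) ↔
          s''.mem mD a u = 0 ∧ s''.mem mD a w = ρ + 1 ∧ Γ.B u w := by
        simp only [Cond.eval, j1.adjB, Expr.eval, j2, j3, hu', hw]
      by_cases hc : s''.mem mD a u = 0 ∧ s''.mem mD a w = ρ + 1 ∧ Γ.B u w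
      · rw [Cmd.when, Cmd.den_cond_pos (hcond.2 hc)]
        refine ⟨by simpa using hu', Jset (by decide) (by decide) (by decide)
          ⟨j1.frame _ (by decide) (by decide), by simpa using j2, by simpa using j3,
            j4.add hc.1 hc.2.1 hc.2.2 ?_ ?_ ?_ ?_, ?_⟩⟩
        · intro v hv
          simp [State.setMem_mem, Expr.eval, hu', hv]
        · intro v hv
          simp [State.setMem_mem, Expr.eval, hu', hv]
        · simp [State.setMem_mem, Expr.eval, hu', j2, j3]
        · simp [State.setMem_mem, Expr.eval, hu', j2, hw]
        · intro a' ha'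
          obtain ⟨e1, e2⟩ := j5 a' ha'
          rw [← e1, ← e2]
          constructor <;> funext i <;> simp [State.setMem_mem, Expr.eval, j2, ha']
      · rw [Cmd.when, Cmd.den_cond_neg (fun e => hc (hcond.1 e))]
        exact ⟨by simpa using hu', Jset (by decide) (by decide) (by decide)
          ⟨j1, j2, j3, j4.skip hc, j5⟩⟩

/-- A search with `n` levels is complete. -/
theorem Searched.step_all {B : ℕ → ℕ → Prop} {a n : ℕ} {D X : ℕ → ℕ} (h : Searched B a n D X)
    (hB : ∀ u v, B u v → u < n ∧ v < n) {v z : ℕ} (hvz : B v z) (hz : 0 < D z) :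
    0 < D v ∧ D v ≤ D z + 1 := by
  by_contra hcon
  have hz' : D z = n + 1 := by
    have := h.top z
    by_contra hne
    exact hcon (h.step v z hvz hz (by omega))
  -- Following predecessors from a vertex of level `n + 1` would give `n + 1` vertices of different
  -- levels.
  have hlev : ∀ k ≤ n, ∃ u < n, D u = n + 1 - k := by
    intro k
    induction k with
    | zero => exact fun _ => ⟨z, (hB v z hvz).2, hz'⟩
    | succ k ih =>
      intro hk
      obtain ⟨u, -, hu⟩ := ih (by omega)
      obtain ⟨p1, p2⟩ := h.pred u (n + 1 - (k + 1) - 1) (by omega)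
      exact ⟨X u, (hB _ _ p1).2, by omega⟩
  choose! f hf1 hf2 using hlev
  obtain ⟨i, hi, j, hj, hij, e⟩ := Finset.exists_ne_map_eq_of_card_lt_of_maps_to
    (s := Finset.range (n + 1)) (t := Finset.range n) (f := f) (by simp)
    (fun k hk => by simpa using hf1 k (by simpa [Nat.lt_succ_iff] using hk))
  simp only [Finset.mem_range, Nat.lt_succ_iff] at hi hj
  have h1 := hf2 i (by omega)
  have h2 := hf2 j (by omega)
  rw [e] at h1
  omega

theorem den_searchAll {Γ : Env} {s : State} (hB : ∀ u v, Γ.B u v → u < Γ.n ∧ v < Γ.n)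
    (hst : Static Γ s) (hD : ∀ a u, s.mem mD a u = 0) :
    ∀ a < Γ.n, Searched Γ.B a Γ.n ((searchAll.den Γ.nb s).mem mD a)
      ((searchAll.den Γ.nb s).mem mX a) := by
  have key := Cmd.forto_inv (nb := Γ.nb) (x := rA) (y := rN) (s := s)
    (P := .store mD (.reg rA) (.reg rA) (.const 1) ;; .forto rH rN searchLevel)
    (fun a s' => Static Γ s' ∧ (∀ b < a, Searched Γ.B b Γ.n (s'.mem mD b) (s'.mem mX b)) ∧
      ∀ b, a ≤ b → ∀ u, s'.mem mD b u = 0)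
    ⟨hst.setReg (by decide), by simp, fun b _ u => hD b u⟩ ?_
  · exact key.2.1
  · rintro a s' - ha ⟨h1, h2, h3⟩
    rw [Cmd.den_seq]
    set s₁ := (Cmd.store mD (.reg rA) (.reg rA) (.const 1)).den Γ.nb s' with hs₁
    have e1 : ∀ u, s₁.mem mD a u = if u = a then 1 else 0 := by
      intro u
      simp [hs₁, State.setMem_mem, Expr.eval, ha, h3 a le_rfl u]
    have e2 : ∀ b, b ≠ a → s₁.mem mD b = s'.mem mD b := by
      intro b hb
      funext u
      simp [hs₁, State.setMem_mem, Expr.eval, ha, hb]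
    have e3 : s₁.mem mX = s'.mem mX := Cmd.frame_mem (nb := Γ.nb) _ _ (by decide)
    have inner := Cmd.forto_inv (nb := Γ.nb) (x := rH) (y := rN) (s := s₁) (P := searchLevel)
      (fun ρ s'' => Static Γ s'' ∧ s''.reg rA = a ∧
        Searched Γ.B a ρ (s''.mem mD a) (s''.mem mX a) ∧
        ∀ b, b ≠ a → s''.mem mD b = s'.mem mD b ∧ s''.mem mX b = s'.mem mX b) ?_ ?_
    · obtain ⟨g1, g2, g3, g4⟩ := inner
      refine ⟨g1.setReg (by decide), fun b hb => ?_, fun b hb u => ?_⟩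
      · simp only [State.setReg_mem]
        rcases Nat.lt_or_eq_of_le (Nat.le_of_lt_succ hb) with hb | rfl
        · rw [(g4 b (by omega)).1, (g4 b (by omega)).2]
          exact h2 b hb
        · exact g3
      · simp only [State.setReg_mem]
        rw [(g4 b (by omega)).1]
        exact h3 b (by omega) u
    · refine ⟨(h1.frame _ (by decide) (by decide)).setReg (by decide), by simpa [hs₁] using ha,
        ?_, fun b hb => ⟨e2 b hb, by rw [State.setReg_mem, e3]⟩⟩
      simp only [State.setReg_mem]
      refine ⟨fun v => ?_, by simp [e1], fun v hv => ?_, fun v d hv => ?_, fun v z _ h4 h5 => ?_⟩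
      · rw [e1]; split_ifs <;> omega
      · rw [e1] at hv
        by_contra hne
        simp [hne] at hv
      · rw [e1] at hv
        split_ifs at hv
        all_goals omega
      · omega
    · rintro ρ s'' - hρ ⟨g1, g2, g3, g4⟩
      obtain ⟨k1, k2⟩ := den_searchLevel hB g1 g2 hρ g3
      refine ⟨(g1.frame _ (by decide) (by decide)).setReg (by decide), ?_, k1, fun b hb => ?_⟩
      · simp only [State.setReg_reg]
        rw [if_neg (by decide), Cmd.frame_reg _ _ (by decide)]
        exact g2
      · simp only [State.setReg_mem]
        rw [(k2 b hb).1, (k2 b hb).2]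
        exact g4 b hb

/-! ### Enumeration of permutations with orientations -/

/-- Row `j` of the digits consists of a number from `j` to `K` and a bit. -/
def ValidDigits (K : ℕ) (Q : ℕ → ℕ → ℕ) : Prop :=
  ∀ j ≤ K, j ≤ Q j 0 ∧ Q j 0 ≤ K ∧ Q j 1 ≤ 1

/-- The weights of the digits in the mixed radix system. -/
def weight (K : ℕ) : ℕ → ℕ
  | 0 => 1
  | m + 1 => weight K m * (2 * (K + 1 - m))

/-- The number given by the first `m` digits. -/
def value (K : ℕ) (Q : ℕ → ℕ → ℕ) : ℕ → ℕ
  | 0 => 0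
  | m + 1 => value K Q m + (2 * (Q m 0 - m) + Q m 1) * weight K m

/-- The radix of row `m` is `2 * (K + 1 - m)`; the second factor on the left is the product of the
radices of the remaining rows. -/
theorem weight_mul (K : ℕ) : ∀ m ≤ K + 1,
    weight K m * (2 ^ (K + 1 - m) * (K + 1 - m).factorial) = 2 ^ (K + 1) * (K + 1).factorial := by
  intro m
  induction m with
  | zero => intro _; simp [weight]
  | succ m ih =>
    intro hm
    rw [← ih (by omega)]
    obtain ⟨d, hd⟩ : ∃ d, K + 1 - m = d + 1 := ⟨K - m, by omega⟩
    have hd' : K + 1 - (m + 1) = d := by omega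
    rw [weight, hd, hd', Nat.factorial_succ, pow_succ]
    ring

theorem weight_last (K : ℕ) : weight K (K + 1) = 2 ^ (K + 1) * (K + 1).factorial := by
  simpa using weight_mul K (K + 1) le_rfl

theorem value_congr {K : ℕ} {Q Q' : ℕ → ℕ → ℕ} : ∀ m,
    (∀ j < m, Q j 0 = Q' j 0 ∧ Q j 1 = Q' j 1) → value K Q m = value K Q' m := by
  intro m
  induction m with
  | zero => intro _; rfl
  | succ m ih =>
    intro h
    rw [value, value, ih (fun j hj => h j (by omega)), (h m (by omega)).1, (h m (by omega)).2]

theorem value_lt {K : ℕ} {Q : ℕ → ℕ → ℕ} (hQ : ValidDigits K Q) :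
    ∀ m ≤ K + 1, value K Q m < weight K m := by
  intro m
  induction m with
  | zero => intro _; simp [value, weight]
  | succ m ih =>
    intro hm
    obtain ⟨h1, h2, h3⟩ := hQ m (by omega)
    have h4 := ih (by omega)
    have h5 : 2 * (Q m 0 - m) + Q m 1 + 1 ≤ 2 * (K + 1 - m) := by omega
    have h6 := Nat.mul_le_mul_right (weight K m) h5
    rw [value, weight, Nat.mul_comm (weight K m)]
    rw [Nat.add_mul, Nat.one_mul] at h6
    omega

/-- Division with remainder by `weight K m` separates row `m` from the value of the earlier rows.
Hence the round with a given number works with known digits. -/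
theorem value_inj {K : ℕ} {Q Q' : ℕ → ℕ → ℕ} (hQ : ValidDigits K Q) (hQ' : ValidDigits K Q') :
    ∀ m ≤ K + 1, value K Q m = value K Q' m → ∀ j < m, Q j 0 = Q' j 0 ∧ Q j 1 = Q' j 1 := by
  intro m
  induction m with
  | zero => intro _ _ j hj; omega
  | succ m ih =>
    intro hm he
    have h1 := value_lt hQ m (by omega)
    have h2 := value_lt hQ' m (by omega)
    have hw : 0 < weight K m := by omega
    rw [value, value] at he
    have hmod := congrArg (· % weight K m) he
    have hdiv := congrArg (· / weight K m) he
    simp only [Nat.add_mul_mod_self_right, Nat.mod_eq_of_lt h1, Nat.mod_eq_of_lt h2] at hmod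
    simp only [Nat.add_mul_div_right _ _ hw, Nat.div_eq_of_lt h1, Nat.div_eq_of_lt h2] at hdiv
    intro j hj
    rcases Nat.lt_or_eq_of_le (Nat.le_of_lt_succ hj) with hj | rfl
    · exact ih (by omega) hmod j hj
    · obtain ⟨a1, a2, a3⟩ := hQ j (by omega)
      obtain ⟨b1, b2, b3⟩ := hQ' j (by omega)
      omega

theorem value_initial (K : ℕ) {Q : ℕ → ℕ → ℕ} : ∀ m, (∀ j < m, Q j 0 = j ∧ Q j 1 = 0) →
    value K Q m = 0 := by
  intro m
  induction m with
  | zero => intro _; rfl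
  | succ m ih =>
    intro h
    rw [value, ih (fun j hj => h j (by omega)), (h m (by omega)).1, (h m (by omega)).2]
    simp

theorem den_initDigits {Γ : Env} {s : State} (hQ : ∀ i j, s.mem mQ i j = 0) :
    ∀ j ≤ Γ.K, (initDigits.den Γ.nb s).mem mQ j 0 = j ∧ (initDigits.den Γ.nb s).mem mQ j 1 = 0 := by
  have key := Cmd.forto_inv (nb := Γ.nb) (x := rJ) (y := rK) (s := s)
    (P := .store mQ (.reg rJ) (.const 0) (.reg rJ))
    (fun i s' => ∀ j, s'.mem mQ j 1 = 0 ∧ (j < i → s'.mem mQ j 0 = j))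
    (by simp [hQ]) ?_
  · exact fun j hj => ⟨(key j).2 (Nat.lt_succ_of_le hj), (key j).1⟩
  · intro i s' _ hi h j
    refine ⟨by simp [State.setMem_mem, Expr.eval, h j], fun hj => ?_⟩
    by_cases e : j = i
    · simp [State.setMem_mem, Expr.eval, hi, e]
    · simp [State.setMem_mem, Expr.eval, hi, e, (h j).2 (by omega)]

/-- Incrementing with a carry: after `i` rows, their value plus the carry times `weight K i` is the
old value plus one. A carry at the end means that the counter has overflowed. -/
theorem den_nextDigits {Γ : Env} {s : State} (hK : s.reg rK = Γ.K + 1)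
    (hQ : ValidDigits Γ.K (s.mem mQ)) :
    ValidDigits Γ.K ((nextDigits.den Γ.nb s).mem mQ) ∧ (nextDigits.den Γ.nb s).reg rZ ≤ 1 ∧
    value Γ.K ((nextDigits.den Γ.nb s).mem mQ) (Γ.K + 1) +
      (nextDigits.den Γ.nb s).reg rZ * weight Γ.K (Γ.K + 1) =
      value Γ.K (s.mem mQ) (Γ.K + 1) + 1 := by
  have key := Cmd.forto_inv (nb := Γ.nb) (x := rJ) (y := rK)
    (s := (Cmd.assign rZ (.const 1)).den Γ.nb s)
    (P := .when (.eq (.reg rZ) (.const 1)) <|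
    .cond (.eq (.get mQ (.reg rJ) (.const 1)) (.const 0))
      (.store mQ (.reg rJ) (.const 1) (.const 1) ;; .assign rZ (.const 0))
      (.store mQ (.reg rJ) (.const 1) (.const 0) ;;
        .cond (.lt (.succ (.get mQ (.reg rJ) (.const 0))) (.reg rK))
          (.store mQ (.reg rJ) (.const 0) (.succ (.get mQ (.reg rJ) (.const 0))) ;;
            .assign rZ (.const 0))
          (.store mQ (.reg rJ) (.const 0) (.reg rJ))))
    (fun i s' => s'.reg rK = Γ.K + 1 ∧ ValidDigits Γ.K (s'.mem mQ) ∧ s'.reg rZ ≤ 1 ∧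
      (∀ j, i ≤ j → s'.mem mQ j = s.mem mQ j) ∧
      value Γ.K (s'.mem mQ) i + s'.reg rZ * weight Γ.K i = value Γ.K (s.mem mQ) i + 1)
    ?_ ?_
  · exact ⟨key.2.1, key.2.2.1, key.2.2.2.2⟩
  · refine ⟨by simpa using hK, hQ, by simp [Expr.eval], fun _ _ => rfl, ?_⟩
    simp [Expr.eval, value, weight]
  · rintro i s' hi hJ ⟨h1, h2, h3, h4, h5⟩
    rw [Env.nb_K] at hi
    obtain ⟨v1, v2, v3⟩ := h2 i (by omega)
    have e4 : s.mem mQ i = s'.mem mQ i := (h4 i le_rfl).symm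
    -- the three possible new values of row `i`
    have upd : ∀ (s'' : State) (q o z : ℕ), s''.reg rK = Γ.K + 1 → s''.reg rZ = z →
        s''.mem mQ i 0 = q → s''.mem mQ i 1 = o → (∀ j, j ≠ i → s''.mem mQ j = s'.mem mQ j) →
        i ≤ q → q ≤ Γ.K → o ≤ 1 → z ≤ 1 →
        -- The balance of one row: new digit plus outgoing carry times the radix equals old digit
        -- plus incoming carry.
        (2 * (q - i) + o) + z * (2 * (Γ.K + 1 - i)) =
          (2 * (s'.mem mQ i 0 - i) + s'.mem mQ i 1) + s'.reg rZ →
        (s''.setReg rJ (i + 1)).reg rK = Γ.K + 1 ∧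
        ValidDigits Γ.K ((s''.setReg rJ (i + 1)).mem mQ) ∧ (s''.setReg rJ (i + 1)).reg rZ ≤ 1 ∧
        (∀ j, i + 1 ≤ j → (s''.setReg rJ (i + 1)).mem mQ j = s.mem mQ j) ∧
        value Γ.K ((s''.setReg rJ (i + 1)).mem mQ) (i + 1) +
          (s''.setReg rJ (i + 1)).reg rZ * weight Γ.K (i + 1) =
          value Γ.K (s.mem mQ) (i + 1) + 1 := by
      intro s'' q o z k1 k2 k3 k4 k5 k6 k7 k8 k9 k10
      refine ⟨by simpa using k1, fun j hj => ?_, by simpa [k2] using k9, fun j hj => ?_, ?_⟩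
      · simp only [State.setReg_mem]
        by_cases e : j = i
        · subst e; rw [k3, k4]; exact ⟨k6, k7, k8⟩
        · rw [k5 j e]; exact h2 j hj
      · simp only [State.setReg_mem]
        rw [k5 j (by omega)]
        exact h4 j (by omega)
      · have hz : (s''.setReg rJ (i + 1)).reg rZ = z := by simpa using k2
        have hv : value Γ.K (s''.mem mQ) i = value Γ.K (s'.mem mQ) i :=
          value_congr i (fun j hj => by rw [k5 j (by omega)]; exact ⟨rfl, rfl⟩)
        rw [State.setReg_mem, hz, value, value, weight, hv, k3, k4, e4]
        have k11 := congrArg (· * weight Γ.K i) k10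
        simp only [Nat.add_mul] at k11
        have : z * (weight Γ.K i * (2 * (Γ.K + 1 - i))) =
          z * (2 * (Γ.K + 1 - i)) * weight Γ.K i := by ring
        rw [this, Nat.add_mul, Nat.add_mul]
        omega
    by_cases hz : s'.reg rZ = 1
    · rw [Cmd.when, Cmd.den_cond_pos (by simpa [Cond.eval, Expr.eval] using hz)]
      by_cases ho : s'.mem mQ i 1 = 0
      · rw [Cmd.den_cond_pos (by simpa [Cond.eval, Expr.eval, hJ] using ho)]
        refine upd _ (s'.mem mQ i 0) 1 0 (by simpa using h1) (by simp [Expr.eval]) ?_ ?_ ?_ v1 v2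
          (by omega) (by omega) (by omega)
        · simp [State.setMem_mem, Expr.eval]
        · simp [State.setMem_mem, Expr.eval, hJ]
        · intro j hj
          funext k
          simp [State.setMem_mem, Expr.eval, hJ, hj]
      · rw [Cmd.den_cond_neg (by simpa [Cond.eval, Expr.eval, hJ] using ho), Cmd.den_seq]
        by_cases hq : s'.mem mQ i 0 + 1 < Γ.K + 1
        · rw [Cmd.den_cond_pos (by
            simpa [Cond.eval, Expr.eval, hJ, State.setMem_mem, h1] using hq)]
          refine upd _ (s'.mem mQ i 0 + 1) 0 0 (by simpa using h1) (by simp [Expr.eval]) ?_ ?_ ?_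
            (by omega) (by omega) (by omega) (by omega) (by omega)
          · simp [State.setMem_mem, Expr.eval, hJ]
          · simp [State.setMem_mem, Expr.eval, hJ]
          · intro j hj
            funext k
            simp [State.setMem_mem, Expr.eval, hJ, hj]
        · rw [Cmd.den_cond_neg (by
            simpa [Cond.eval, Expr.eval, hJ, State.setMem_mem, h1] using hq)]
          refine upd _ i 0 1 (by simpa using h1) (by simpa using hz) ?_ ?_ ?_
            (by omega) (by omega) (by omega) (by omega) (by omega)
          · simp [State.setMem_mem, Expr.eval, hJ]
          · simp [State.setMem_mem, Expr.eval, hJ]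
          · intro j hj
            funext k
            simp [State.setMem_mem, Expr.eval, hJ, hj]
    · rw [Cmd.when, Cmd.den_cond_neg (by simpa [Cond.eval, Expr.eval] using hz)]
      have hz0 : s'.reg rZ = 0 := by omega
      exact upd s' _ _ 0 h1 hz0 rfl rfl (fun _ _ => rfl) v1 v2 v3 (by omega) (by omega)

/-! ### Permutations from digits by successive transpositions -/

/-- The permutation after the first `m` transpositions. -/
def permAfter (q : ℕ → ℕ) : ℕ → ℕ → ℕ
  | 0 => id
  | m + 1 => fun i =>
    if i = q m then permAfter q m m else if i = m then permAfter q m (q m) else permAfter q m i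

theorem permAfter_congr {q q' : ℕ → ℕ} : ∀ m, (∀ j < m, q j = q' j) →
    permAfter q m = permAfter q' m := by
  intro m
  induction m with
  | zero => intro _; rfl
  | succ m ih =>
    intro h
    rw [permAfter, permAfter, ih (fun j hj => h j (by omega)), h m (by omega)]

/-- Every list of distinct numbers `≤ K` is an initial segment of some permutation. -/
theorem exists_permAfter {K : ℕ} (L : List ℕ) (hnd : L.Nodup) (hL : ∀ v ∈ L, v ≤ K) :
    ∃ q : ℕ → ℕ, (∀ j ≤ K, j ≤ q j ∧ q j ≤ K) ∧
      ∀ i (hi : i < L.length), permAfter q (K + 1) i = L[i] := by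
  -- All numbers up to `K` must still occur, so that `L[m]` is found at some position; since `L` has
  -- no duplicates, that position is at least `m`, and one transposition moves `L[m]` into place.
  -- Later ones do not touch it.
  have key : ∀ m ≤ K + 1, ∃ q : ℕ → ℕ, (∀ j ≤ K, j ≤ q j ∧ q j ≤ K) ∧
      (∀ i (hi : i < L.length), i < m → permAfter q m i = L[i]) ∧
      ∀ v ≤ K, ∃ i ≤ K, permAfter q m i = v := by
    intro m
    induction m with
    | zero =>
      intro _
      exact ⟨id, fun j hj => ⟨le_rfl, hj⟩, by simp, fun v hv => ⟨v, hv, rfl⟩⟩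
    | succ m ih =>
      intro hm
      obtain ⟨q, h1, h2, h3⟩ := ih (by omega)
      obtain ⟨k, hk1, hk2, hk3⟩ : ∃ k, m ≤ k ∧ k ≤ K ∧
          ∀ hi : m < L.length, permAfter q m k = L[m] := by
        by_cases hi : m < L.length
        · obtain ⟨k, hk, e⟩ := h3 L[m] (hL _ (List.getElem_mem hi))
          refine ⟨k, ?_, hk, fun _ => e⟩
          by_contra hlt
          have e' := h2 k (by omega) (by omega)
          rw [e] at e'
          have := (List.Nodup.getElem_inj_iff hnd).1 e'
          omega
        · exact ⟨m, le_rfl, by omega, fun h => absurd h hi⟩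
      let q' := Function.update q m k
      have hq' : permAfter q' m = permAfter q m :=
        permAfter_congr m (fun j hj => Function.update_of_ne (by omega) _ _)
      have hqm : q' m = k := Function.update_self _ _ _
      refine ⟨q', fun j hj => ?_, fun i hi him => ?_, fun v hv => ?_⟩
      · by_cases e : j = m
        · rw [e, hqm]; exact ⟨hk1, hk2⟩
        · rw [show q' j = q j from Function.update_of_ne e _ _]; exact h1 j hj
      · simp only [permAfter, hq', hqm]
        rcases Nat.lt_or_eq_of_le (Nat.le_of_lt_succ him) with hlt | rfl
        · rw [if_neg (by omega), if_neg (by omega)]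
          exact h2 i hi hlt
        · rw [if_pos rfl, ← hk3 hi]
          split_ifs with e
          · rw [← e]
          · rfl
      · obtain ⟨i, hi, e⟩ := h3 v hv
        simp only [permAfter, hq', hqm]
        by_cases e1 : i = m
        · exact ⟨k, hk2, by rw [e1] at e; rw [if_pos rfl]; exact e⟩
        · by_cases e2 : i = k
          · refine ⟨m, by omega, ?_⟩
            rw [if_neg (by omega), if_pos rfl, ← e2]
            exact e
          · exact ⟨i, hi, by rw [if_neg e2, if_neg e1]; exact e⟩
  obtain ⟨q, h1, h2, h3⟩ := key (K + 1) le_rfl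
  refine ⟨q, h1, fun i hi => h2 i hi ?_⟩
  have hsub : L ⊆ List.range (K + 1) := fun v hv => by
    simpa [Nat.lt_succ_iff] using hL v hv
  have := (hnd.subperm hsub).length_le
  simp only [List.length_range] at this
  omega

theorem den_makePerm {Γ : Env} {s : State} (hQ : ValidDigits Γ.K (s.mem mQ)) :
    ∀ i ≤ Γ.K, (makePerm.den Γ.nb s).mem mP i 0 =
      permAfter (fun j => s.mem mQ j 0) (Γ.K + 1) i := by
  rw [makePerm, Cmd.den_seq]
  set d : Cmd := .forto rJ rK <| .store mP (.reg rJ) (.const 0) (.reg rJ) with hd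
  have hinit : ∀ i ≤ Γ.K, (d.den Γ.nb s).mem mP i 0 = i := by
    have key := Cmd.forto_inv (nb := Γ.nb) (x := rJ) (y := rK) (s := s)
      (P := .store mP (.reg rJ) (.const 0) (.reg rJ))
      (fun i s' => ∀ j < i, s'.mem mP j 0 = j) (by simp) ?_
    · exact fun j hj => key j (Nat.lt_succ_of_le hj)
    · intro i s' _ hi h j hj
      by_cases e : j = i
      · simp [State.setMem_mem, Expr.eval, hi, e]
      · simp [State.setMem_mem, Expr.eval, hi, e, h j (by omega)]
  have hmQ : (d.den Γ.nb s).mem mQ = s.mem mQ := Cmd.frame_mem _ _ (by decide)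
  generalize d.den Γ.nb s = s₁ at *
  refine (Cmd.forto_inv (nb := Γ.nb) (x := rJ) (y := rK)
    (fun m s' => s'.mem mQ = s.mem mQ ∧ ∀ i ≤ Γ.K, s'.mem mP i 0 =
      permAfter (fun j => s.mem mQ j 0) m i) ⟨hmQ, hinit⟩ ?_).2
  rintro m s' hm hJ ⟨h1, h2⟩
  rw [Env.nb_K] at hm
  obtain ⟨v1, v2, -⟩ := hQ m (by omega)
  refine ⟨?_, fun i hi => ?_⟩
  · rw [State.setReg_mem, Cmd.frame_mem _ _ (by decide), h1]
  · simp only [permAfter, ← h2 i hi, ← h2 m (by omega), ← h2 _ v2]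
    simp [State.setMem_mem, Expr.eval, hJ, h1]

end POH

namespace POH

/-! ### The right guess for a given tour -/

/-- A relation on `Fin n` as a relation on natural numbers. -/
def lift {n : ℕ} (R : Fin n → Fin n → Prop) (i j : ℕ) : Prop :=
  ∃ u v : Fin n, u.val = i ∧ v.val = j ∧ R u v

theorem lift_val {n : ℕ} {R : Fin n → Fin n → Prop} {u v : Fin n} :
    lift R u.val v.val ↔ R u v := by
  constructor
  · rintro ⟨u', v', h1, h2, h⟩
    rw [Fin.ext h1, Fin.ext h2] at h
    exact h
  · exact fun h => ⟨u, v, rfl, rfl, h⟩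

/-- The neighbour found by the search comes next on the skeleton. -/
theorem Searched.next_on_path {n : ℕ} {H : SimpleGraph (Fin n)} (hH : IsBlockGraph H) {a : ℕ}
    {D X : ℕ → ℕ} (hs : Searched (lift H.Adj) a n D X) {y : ℕ → ℕ} (hlt : ∀ i < n, y i < n)
    (hinj : ∀ i < n, ∀ j < n, y i = y j → i = j) {p f : ℕ} (hpf : p < f) (hf : f < n)
    (ha : y f = a) (hpath : ∀ i, p ≤ i → i < f → lift H.Adj (y i) (y (i + 1))) :
    ∃ p', p < p' ∧ p' ≤ f ∧ X (y p) = y p' ∧ lift H.Adj (y p) (y p') ∧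
      ∀ i, p < i → i < p' → lift H.Adj (y p) (y i) ∧ lift H.Adj (y i) (y p') := by
  have hB : ∀ u v, lift H.Adj u v → u < n ∧ v < n := by
    rintro _ _ ⟨u, v, rfl, rfl, -⟩
    exact ⟨u.2, v.2⟩
  -- Every vertex of the segment is reached by the search from `a`, by walking back from position
  -- `f`.
  have hDpos : ∀ k ≤ f - p, 0 < D (y (f - k)) := by
    intro k
    induction k with
    | zero => intro _; rw [Nat.sub_zero, ha, hs.root]; exact one_pos
    | succ k ih =>
      intro hk
      have h := hpath (f - (k + 1)) (by omega) (by omega)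
      rw [show f - (k + 1) + 1 = f - k by omega] at h
      exact (hs.step_all hB h (ih (by omega))).1
  have hDp : 0 < D (y p) := by
    have := hDpos (f - p) le_rfl
    rwa [show f - (f - p) = p by omega] at this
  obtain ⟨d, hd⟩ : ∃ d, D (y p) = d + 2 := by
    refine ⟨D (y p) - 2, ?_⟩
    have : D (y p) ≠ 1 := by
      intro h1
      have := hinj p (by omega) f hf ((hs.one _ h1).trans ha.symm)
      omega
    omega
  obtain ⟨hpX, hDX⟩ := hs.pred _ _ hd
  have hXn := (hB _ _ hpX).2
  -- The value at positions `≥ n` is never used; `X (y p)` merely is a vertex at hand.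
  let yF : ℕ → Fin n := fun i => if h : i < n then ⟨y i, hlt i h⟩ else ⟨X (y p), hXn⟩
  have hyF : ∀ i < n, (yF i).val = y i := fun i hi => by simp [yF, hi]
  have hadj : ∀ i, p ≤ i → i < f → H.Adj (yF i) (yF (i + 1)) := by
    intro i h1 h2
    rw [← lift_val (R := H.Adj), hyF i (by omega), hyF (i + 1) (by omega)]
    exact hpath i h1 h2
  have hchain : ∀ k q, p ≤ q → q + k ≤ f → (List.map yF (List.range' q (k + 1))).IsChain H.Adj := by
    intro k
    induction k with
    | zero => intro q _ _; simp
    | succ k ih =>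
      intro q h1 h2
      have := ih (q + 1) (by omega) (by omega)
      rw [List.range'_succ, List.map_cons] at this ⊢
      rw [List.range'_succ, List.map_cons, List.isChain_cons_cons]
      exact ⟨hadj q h1 (by omega), this⟩
  have hlist : yF p :: List.map yF (List.range' (p + 1) (f - p)) =
      List.map yF (List.range' p (f - p + 1)) := by
    rw [List.range'_succ, List.map_cons]
  have hmem : ∀ i ∈ List.range' p (f - p + 1), i < n := by
    intro i hi
    simp only [List.mem_range'_1] at hi
    omega
  have key := closer_neighbour_mem_path hH (δ := fun v => D v.val) (a := ⟨a, ha ▸ hlt f hf⟩)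
    (x := yF p) (y := ⟨X (y p), hXn⟩) (fun u hu => Fin.ext (hs.one _ hu)) ?_ ?_ ?_ ?_ ?_
    (List.map yF (List.range' (p + 1) (f - p))) ?_ ?_ ?_
  · obtain ⟨P, P', h1, h2⟩ := key
    obtain ⟨l₁, l₂, h3, h4, h5⟩ := List.map_eq_append_iff.1 h1
    obtain ⟨k, hk, rfl, rfl⟩ := List.range'_eq_append_iff.1 h3
    have hkf : k < f - p := by
      by_contra hge
      rw [show f - p - k = 0 by omega] at h5
      simp at h5
    obtain ⟨m, hm⟩ : ∃ m, f - p - k = m + 1 := ⟨f - p - k - 1, by omega⟩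
    rw [hm, List.range'_succ, List.map_cons, List.cons.injEq] at h5
    have hX : X (y p) = y (p + 1 + k) := by
      rw [← hyF (p + 1 + k) (by omega)]
      have := h5.1
      rw [Nat.mul_one] at this
      rw [this]
    refine ⟨p + 1 + k, by omega, by omega, hX, hX ▸ hpX, fun i hi1 hi2 => ?_⟩
    have hiP : yF i ∈ P := by
      rw [← h4]
      refine List.mem_map_of_mem ?_
      simp only [List.mem_range'_1]
      omega
    obtain ⟨g1, g2⟩ := h2 _ hiP
    rw [← lift_val (R := H.Adj), hyF p (by omega), hyF i (by omega)] at g1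
    rw [← lift_val (R := H.Adj), hyF i (by omega)] at g2
    exact ⟨g1, hX ▸ g2⟩
  · intro u d hu
    obtain ⟨g1, g2⟩ := hs.pred _ _ hu
    exact ⟨⟨X u, (hB _ _ g1).2⟩, (lift_val (R := H.Adj)).1 g1, g2⟩
  · intro u w huw hw
    exact (hs.step_all hB ((lift_val (R := H.Adj)).2 huw) hw).2
  · rw [← lift_val (R := H.Adj), hyF p (by omega)]
    exact hpX
  · simp only [hDX]; omega
  · simp only [hyF p (by omega : p < n), hDX, hd]
  · rw [hlist]
    exact hchain (f - p) p le_rfl (by omega)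
  · rw [hlist]
    refine List.Nodup.map_on (fun i hi j hj e => ?_) (List.nodup_range' (step := 1))
    have hi' := hmem i hi
    have hj' := hmem j hj
    exact hinj i hi' j hj' (by rw [← hyF i hi', ← hyF j hj', e])
  · rw [List.mem_map]
    refine ⟨f, by simp only [List.mem_range'_1]; omega, Fin.ext ?_⟩
    exact (hyF f hf).trans ha

/-- The data prepared by the program. -/
structure Prepared (Γ : Env) (E X : ℕ → ℕ → ℕ) : Prop where
  edges : EdgeTable Γ.n Γ.K Γ.F E
  symm : ∀ u v, Γ.F u v → Γ.F v u
  next : ∀ y, Tour Γ y → ∀ p f, p < f → f < Γ.n → (∀ i, p ≤ i → i < f → Γ.B (y i) (y (i + 1))) →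
    ∃ p', p < p' ∧ p' ≤ f ∧ X (y f) (y p) = y p' ∧ Γ.B (y p) (y p') ∧
      ∀ i, p < i → i < p' → Γ.B (y p) (y i) ∧ Γ.B (y i) (y p')
  clique : ∀ a b v w, Γ.B a b → Γ.B a v → Γ.B v b → Γ.B a w → Γ.B w b → v ≠ w → Γ.B v w

/-- It locates an edge in the guess: the jump at position `i` comes after as many jumps as there are
before `i`. -/
theorem getElem?_filter_range {P : ℕ → Bool} {n i : ℕ} (hi : i < n) (hP : P i = true) :
    ((List.range n).filter P)[((List.range i).filter P).length]? = some i := by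
  have h : List.range n = List.range i ++ i :: List.range' (i + 1) (n - i - 1) := by
    rw [← List.range'_succ, List.range_eq_range', List.range_eq_range']
    have h := List.range'_append_1 (s := 0) (m := i) (n := n - i - 1 + 1)
    rw [Nat.zero_add, show i + (n - i - 1 + 1) = n by omega] at h
    exact h.symm
  rw [h, List.filter_append, List.filter_cons_of_pos hP]
  simp

/-- For every tour there are digits and a skeleton such that `step` follows the skeleton. -/
theorem Prepared.exists_guide {Γ : Env} {E X : ℕ → ℕ → ℕ} (H : Prepared Γ E X) {y : ℕ → ℕ}
    (T : Tour Γ y) : ∃ (Q : ℕ → ℕ → ℕ) (c g : ℕ → ℕ), ValidDigits Γ.K Q ∧ Guide Γ y c g ∧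
      ∀ s : State, (∀ i ≤ Γ.K, s.mem mP i 0 = permAfter (fun j => Q j 0) (Γ.K + 1) i) →
        (∀ j ≤ Γ.K, s.mem mQ j 1 = Q j 1) → s.mem mE = E → s.mem mX = X → s.reg rK = Γ.K + 1 →
        s.reg rE = y (Γ.n - 1) → Guide.Follows Γ y c g s := by
  classical
  have hpos := T.pos
  -- A jump is a position that the tour leaves along an edge of `F`.
  let jump : ℕ → Bool := fun i => decide (i + 1 < Γ.n ∧ Γ.F (y i) (y (i + 1)))
  have hjump : ∀ {i}, jump i = true ↔ i + 1 < Γ.n ∧ Γ.F (y i) (y (i + 1)) := by simp [jump]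
  let c : ℕ → ℕ := fun p => ((List.range p).filter jump).length
  have c_succ : ∀ p, c (p + 1) = c p + if jump p = true then 1 else 0 := by
    intro p
    simp only [c, List.range_succ, List.filter_append, List.length_append]
    congr 1
    by_cases h : jump p = true
    · simp [h]
    · simp [h]
  have c_const : ∀ p d, (∀ i, p ≤ i → i < p + d → ¬ jump i = true) → c (p + d) = c p := by
    intro p d
    induction d with
    | zero => intro _; rfl
    | succ d ih =>
      intro h
      rw [← Nat.add_assoc, c_succ, if_neg (h (p + d) (by omega) (by omega)),
        ih (fun i h1 h2 => h i h1 (by omega))]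
      rfl
  have c_eq : ∀ p f, p ≤ f → (∀ i, p ≤ i → i < f → ¬ jump i = true) → c f = c p := by
    intro p f hpf h
    obtain ⟨d, rfl⟩ := Nat.exists_eq_add_of_le hpf
    exact c_const p d h
  -- the edge of `F` used after a jump position, and its orientation
  have hedge : ∀ i, ∃ k o, jump i = true → k < Γ.K ∧ o ≤ 1 ∧ E k o = y i ∧
      E k (o + 1) = y (i + 1) := by
    intro i
    by_cases hi : jump i = true
    · obtain ⟨h1, h2⟩ := hjump.1 hi
      rcases lt_trichotomy (y i) (y (i + 1)) with h | h | h
      · obtain ⟨k, hk, e0, e1⟩ := H.edges.surj _ _ h (T.lt _ h1) h2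
        exact ⟨k, 0, fun _ => ⟨hk, by omega, e0, e1⟩⟩
      · have := T.inj i (by omega) _ h1 h
        omega
      · obtain ⟨k, hk, e0, e1⟩ := H.edges.surj _ _ h (T.lt _ (by omega)) (H.symm _ _ h2)
        exact ⟨k, 1, fun _ => ⟨hk, le_rfl, e1, by rw [(H.edges.row k hk).2.2.2, e0]⟩⟩
    · exact ⟨0, 0, fun h => absurd h hi⟩
  choose idx ori hidx using hedge
  -- The guess lists the `F`-edges of the tour in order of use, then the separator `K`;
  -- `exists_permAfter` completes it to a permutation.
  let L : List ℕ := ((List.range Γ.n).filter jump).map idx ++ [Γ.K]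
  have hLjump : ∀ i, jump i = true → L[c i]? = some (idx i) := by
    intro i hi
    have h := getElem?_filter_range (P := jump) (n := Γ.n)
      (by have := (hjump.1 hi).1; omega : i < Γ.n) hi
    have hlt := (List.getElem?_eq_some_iff.1 h).1
    rw [List.getElem?_append_left (by simpa using hlt), List.getElem?_map, h]
    rfl
  have hlast : ¬ jump (Γ.n - 1) = true := by
    rw [hjump]
    omega
  have hLlast : L[c (Γ.n - 1)]? = some Γ.K := by
    have h : c (Γ.n - 1) = ((List.range Γ.n).filter jump).length := by
      have := c_succ (Γ.n - 1)
      rw [if_neg hlast, show Γ.n - 1 + 1 = Γ.n by omega] at this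
      exact this.symm
    rw [h, List.getElem?_append_right (by simp)]
    simp
  have hLnd : L.Nodup := by
    rw [List.nodup_append]
    refine ⟨?_, by simp, ?_⟩
    · refine List.Nodup.map_on ?_ (List.nodup_range.filter _)
      intro i hi j hj e
      simp only [List.mem_filter, List.mem_range] at hi hj
      obtain ⟨-, o1, a1, a2⟩ := hidx i hi.2
      obtain ⟨-, o2, b1, b2⟩ := hidx j hj.2
      have hi1 := (hjump.1 hi.2).1
      have hj1 := (hjump.1 hj.2).1
      rw [e] at a1 a2
      -- Using one edge in both directions would force `j = i + 1` and `i = j + 1`; using it twice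
      -- in the same direction would repeat a vertex.
      rcases Nat.lt_trichotomy (ori i) (ori j) with h | h | h
      · obtain ⟨h0, h1⟩ : ori i = 0 ∧ ori j = 1 := by omega
        have r := (H.edges.row _ (hidx j hj.2).1).2.2.2
        rw [h0] at a1 a2
        rw [h1] at b1 b2
        have := T.inj _ hi1 j hj.1 (a2.symm.trans b1)
        have := T.inj _ hj1 i hi.1 (b2.symm.trans (r.trans a1))
        omega
      · rw [h] at a1
        exact T.inj i hi.1 j hj.1 (a1.symm.trans b1)
      · obtain ⟨h0, h1⟩ : ori j = 0 ∧ ori i = 1 := by omega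
        have r := (H.edges.row _ (hidx j hj.2).1).2.2.2
        rw [h0] at b1 b2
        rw [h1] at a1 a2
        have := T.inj _ hj1 i hi.1 (b2.symm.trans a1)
        have := T.inj _ hi1 j hj.1 (a2.symm.trans (r.trans b1))
        omega
    · rintro a ha b hb rfl
      rw [List.mem_singleton] at hb
      obtain ⟨i, hi, rfl⟩ := List.mem_map.1 ha
      have := (hidx i (List.mem_filter.1 hi).2).1
      omega
  have hLle : ∀ v ∈ L, v ≤ Γ.K := by
    intro v hv
    rcases List.mem_append.1 hv with hv | hv
    · obtain ⟨i, hi, rfl⟩ := List.mem_map.1 hv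
      exact (hidx i (List.mem_filter.1 hi).2).1.le
    · rw [List.mem_singleton.1 hv]
  have hLlen : L.length ≤ Γ.K + 1 := by
    have hsub : L ⊆ List.range (Γ.K + 1) := fun v hv => by
      simpa [Nat.lt_succ_iff] using hLle v hv
    simpa using (hLnd.subperm hsub).length_le
  obtain ⟨q, hq1, hq2⟩ := exists_permAfter L hLnd hLle
  have hperm : ∀ i v, L[i]? = some v → i ≤ Γ.K ∧ permAfter q (Γ.K + 1) i = v := by
    intro i v h
    obtain ⟨hi, e⟩ := List.getElem?_eq_some_iff.1 h
    exact ⟨by omega, by rw [hq2 i hi, e]⟩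
  let O : List ℕ := ((List.range Γ.n).filter jump).map ori
  let Q : ℕ → ℕ → ℕ := fun j k => if k = 0 then q j else O[j]?.getD 0
  have hO : ∀ j : ℕ, O[j]?.getD 0 ≤ 1 := by
    intro j
    rcases h : O[j]? with _ | v
    · simp
    · obtain ⟨i, hi, rfl⟩ := List.mem_map.1 (List.mem_of_getElem? h)
      exact (hidx i (List.mem_filter.1 hi).2).2.1
  have hOjump : ∀ i, jump i = true → Q (c i) 1 = ori i := by
    intro i hi
    have h := getElem?_filter_range (P := jump) (n := Γ.n)
      (by have := (hjump.1 hi).1; omega : i < Γ.n) hi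
    simp only [Q, O, List.getElem?_map]
    rw [show c i = ((List.range i).filter jump).length from rfl, h]
    simp
  -- the next jump position
  have hnextjump : ∀ p < Γ.n, ∃ f, p ≤ f ∧ f < Γ.n ∧ (jump f = true ∨ f + 1 = Γ.n) ∧
      ∀ i, p ≤ i → i < f → ¬ jump i = true := by
    intro p hp
    have hex : ∃ f, p ≤ f ∧ (jump f = true ∨ f + 1 = Γ.n) := ⟨Γ.n - 1, by omega, by omega⟩
    refine ⟨Nat.find hex, (Nat.find_spec hex).1, ?_, (Nat.find_spec hex).2, fun i h1 h2 h3 =>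
      Nat.find_min hex h2 ⟨h1, Or.inl h3⟩⟩
    have := Nat.find_min' hex (m := Γ.n - 1) ⟨by omega, by omega⟩
    omega
  let Good : State → Prop := fun s =>
    (∀ i ≤ Γ.K, s.mem mP i 0 = permAfter (fun j => Q j 0) (Γ.K + 1) i) ∧
    (∀ j ≤ Γ.K, s.mem mQ j 1 = Q j 1) ∧ s.mem mE = E ∧ s.mem mX = X ∧ s.reg rK = Γ.K + 1 ∧
    s.reg rE = y (Γ.n - 1)
  have hQ0 : (fun j => Q j 0) = q := by
    funext j
    simp [Q]
  -- `step` at a position whose next jump is at `f`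
  have hsep : ∀ s, Good s → ∀ x, stepFun s x (c (Γ.n - 1)) =
      if x = y (Γ.n - 1) then (x, c (Γ.n - 1)) else (X (y (Γ.n - 1)) x, c (Γ.n - 1)) := by
    rintro s ⟨g1, g2, g3, g4, g5, g6⟩ x
    obtain ⟨k1, k2⟩ := hperm _ _ hLlast
    have e : s.mem mP (c (Γ.n - 1)) 0 = Γ.K := by rw [g1 _ k1, hQ0, k2]
    rw [stepFun, e, g5, if_pos rfl, g6, g4]
  have hedgestep : ∀ s, Good s → ∀ f, jump f = true → ∀ x, stepFun s x (c f) =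
      if x = y f then (y (f + 1), c f + 1) else (X (y f) x, c f) := by
    rintro s ⟨g1, g2, g3, g4, g5, g6⟩ f hf x
    obtain ⟨k1, k2⟩ := hperm _ _ (hLjump f hf)
    obtain ⟨i1, i2, i3, i4⟩ := hidx f hf
    have e : s.mem mP (c f) 0 = idx f := by rw [g1 _ k1, hQ0, k2]
    rw [stepFun, e, g5, if_neg (by omega), g2 _ k1, hOjump f hf, g3, g4, i3, i4]
  -- The last position stays, a jump leads to the following position, and otherwise the search table
  -- directed at the next jump, or at the end of the tour, gives the next skeleton vertex.
  have hstep : ∀ p, ∃ p', p < Γ.n → p' < Γ.n ∧ (p + 1 = Γ.n → p' = p) ∧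
      (p + 1 < Γ.n → p < p') ∧ (p + 1 < p' → Γ.B (y p) (y p') ∧
        ∀ i, p < i → i < p' → Γ.B (y p) (y i) ∧ Γ.B (y i) (y p')) ∧
      ∀ s, Good s → stepFun s (y p) (c p) = (y p', c p') := by
    intro p
    by_cases hp : p < Γ.n
    swap
    · exact ⟨0, fun h => absurd h hp⟩
    by_cases hpl : p + 1 = Γ.n
    · refine ⟨p, fun _ => ⟨hp, fun _ => rfl, by omega, by omega, fun s hs => ?_⟩⟩
      obtain rfl : p = Γ.n - 1 := by omega
      rw [hsep s hs, if_pos rfl]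
    by_cases hpj : jump p = true
    · refine ⟨p + 1, fun _ => ⟨by omega, by omega, by omega, by omega, fun s hs => ?_⟩⟩
      rw [hedgestep s hs p hpj, if_pos rfl, c_succ, if_pos hpj]
    · obtain ⟨f, hf1, hf2, hf3, hf4⟩ := hnextjump p hp
      have hpf : p < f := by
        refine lt_of_le_of_ne hf1 ?_
        rintro rfl
        rcases hf3 with h | h
        · exact hpj h
        · exact hpl h
      have hpath : ∀ i, p ≤ i → i < f → Γ.B (y i) (y (i + 1)) := by
        intro i h1 h2
        exact ⟨T.adj i (by omega), fun hF => hf4 i h1 h2 (hjump.2 ⟨by omega, hF⟩)⟩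
      obtain ⟨p', h1, h2, h3, h4, h5⟩ := H.next y T p f hpf hf2 hpath
      refine ⟨p', fun _ => ⟨by omega, by omega, fun _ => h1, fun _ => ⟨h4, h5⟩, fun s hs => ?_⟩⟩
      -- There is no jump from `p` up to `f`, so the counter already points to the edge used at `f`,
      -- or to the separator.
      have cf : c f = c p := c_eq p f hf1 hf4
      have cp' : c p' = c p := c_eq p p' h1.le (fun i g1 g2 => hf4 i g1 (by omega))
      have hne : y p ≠ y f := fun e => by
        have := T.inj p hp f hf2 e
        omega
      rw [cp', ← cf]
      rcases hf3 with h | h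
      · rw [hedgestep s hs f h, if_neg hne, h3]
      · obtain rfl : f = Γ.n - 1 := by omega
        rw [hsep s hs, if_neg hne, h3]
  choose g hg using hstep
  refine ⟨Q, c, g, fun j hj => ⟨?_, ?_, ?_⟩, ⟨T, rfl, fun p hp => (hg p hp).1,
    fun p hp => (hg p (by omega)).2.1 hp, fun p hp => (hg p (by omega)).2.2.1 hp,
    fun p hp => (hg p hp).2.2.2.1, H.clique⟩, fun s g1 g2 g3 g4 g5 g6 p hp =>
      (hg p hp).2.2.2.2 s ⟨g1, g2, g3, g4, g5, g6⟩⟩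
  · simpa [Q] using (hq1 j hj).1
  · simpa [Q] using (hq1 j hj).2
  · simpa [Q] using hO j

end POH

namespace POH

/-! ### Ordered Hamiltonian paths as lists and as sequences -/

/-- Both problems: the path problem (`cyc = false`) and the cycle problem (`cyc = true`). -/
def Problem (cyc : Bool) {V : Type*} [DecidableEq V] (G : SimpleGraph V) (r : V → V → Prop) :
    Prop :=
  ∃ (u v : V) (p : G.Walk u v), p.IsHamiltonian ∧ (cyc = true → G.Adj u v) ∧ Extends r p

/-- The instance on natural numbers. -/
def instanceEnv {n : ℕ} (G : SimpleGraph (Fin n)) (r : Fin n → Fin n → Prop)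
    (F : Finset (Sym2 (Fin n))) (K : ℕ) : Env :=
  ⟨n, K, lift G.Adj, lift r, lift (fun u v => s(u, v) ∈ F)⟩

section Translate

variable {n : ℕ} {G : SimpleGraph (Fin n)} {r : Fin n → Fin n → Prop}
  {F : Finset (Sym2 (Fin n))} {K : ℕ}

theorem instanceEnv_B : (instanceEnv G r F K).B =
    lift (G.deleteEdges (F : Set (Sym2 (Fin n)))).Adj := by
  funext i j
  apply propext
  constructor
  · rintro ⟨⟨u, v, rfl, rfl, h⟩, hF⟩
    refine ⟨u, v, rfl, rfl, ?_⟩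
    rw [SimpleGraph.deleteEdges_adj]
    exact ⟨h, fun hm => hF ⟨u, v, rfl, rfl, hm⟩⟩
  · rintro ⟨u, v, rfl, rfl, h⟩
    rw [SimpleGraph.deleteEdges_adj] at h
    exact ⟨⟨u, v, rfl, rfl, h.1⟩, fun hm => h.2 (lift_val.1 hm)⟩

theorem boolMatrix_eq_mat (R : Fin n → Fin n → Prop) : boolMatrix R = mat (lift R) := by
  funext i j
  simp only [boolMatrix, mat, lift]
  congr

/-- A duplicate-free list of `n` vertices contains all of them. By `closed`, a related pair in the
wrong order would make a vertex occur twice. -/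
theorem Sol.problem {cyc : Bool} {l : List ℕ} (hn : 1 ≤ n)
    (h : Sol (instanceEnv G r F K) cyc l) : Problem cyc G r := by
  obtain ⟨hg, hlen, hadj⟩ := h
  have hlen' : l.length = n := hlen
  obtain ⟨l', rfl⟩ : ∃ l' : List (Fin n), l'.map Fin.val = l :=
    ⟨l.pmap Fin.mk (show ∀ v ∈ l, v < n from hg.lt), by simp [List.map_pmap]⟩
  have hne : l' ≠ [] := by
    rintro rfl
    simp at hlen'
    omega
  have hnd : l'.Nodup := hg.nodup.of_map _
  have hch : l'.IsChain G.Adj := by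
    have := (List.isChain_map _).1 hg.chain
    exact this.imp (fun u v h => lift_val.1 h)
  have hsupp := SimpleGraph.Walk.support_ofSupport hne hch
  rw [List.length_map] at hlen'
  have hall : ∀ w, w ∈ l' := by
    intro w
    have : l'.toFinset = Finset.univ := by
      apply Finset.eq_univ_of_card
      rw [List.toFinset_card_of_nodup hnd, hlen', Fintype.card_fin]
    have hw := Finset.mem_univ w
    rwa [← this, List.mem_toFinset] at hw
  refine ⟨_, _, SimpleGraph.Walk.ofSupport l' hne hch, ?_, fun hc => ?_, ?_⟩
  · refine SimpleGraph.Walk.IsPath.isHamiltonian_of_mem ?_ (by rw [hsupp]; exact hall)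
    rw [SimpleGraph.Walk.isPath_def, hsupp]
    exact hnd
  · have := hadj hc (l'.head hne).val (by simp [List.head?_eq_some_head hne])
      (l'.getLast hne).val (by simp [List.getLast?_eq_some_getLast hne])
    exact lift_val.1 this
  · intro i j hi hj hr
    rw [SimpleGraph.Walk.length_ofSupport] at hi hj
    have hi' : i < l'.length := by omega
    have hj' : j < l'.length := by omega
    have hget : ∀ k (hk : k < l'.length),
        (SimpleGraph.Walk.ofSupport l' hne hch).getVert k = l'[k] := by
      intro k hk
      rw [SimpleGraph.Walk.getVert_eq_support_getElem _ (by
        rw [SimpleGraph.Walk.length_ofSupport]; omega)]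
      simp only [hsupp]
    rw [hget i hi', hget j hj'] at hr
    by_contra hlt
    have hsplit : l'.map Fin.val =
        (l'.take j).map Fin.val ++ l'[j].val :: (l'.drop (j + 1)).map Fin.val := by
      rw [← List.map_cons, ← List.map_append, List.getElem_cons_drop, List.take_append_drop]
    have hmem := hg.closed _ _ _ hsplit l'[i].val l'[i].2 (lift_val.2 hr) (by
      intro e
      have := (List.Nodup.getElem_inj_iff hnd).1 (Fin.ext e)
      omega)
    obtain ⟨w, hw, e⟩ := List.mem_map.1 hmem
    rw [Fin.ext e] at hw
    obtain ⟨k, hk, e'⟩ := List.mem_take_iff_getElem.1 hw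
    have := (List.Nodup.getElem_inj_iff hnd).1 e'
    omega

theorem Problem.exists_tour {cyc : Bool} (hn : 1 ≤ n) (h : Problem cyc G r) :
    ∃ y, Tour (instanceEnv G r F K) y ∧
      (cyc = true → (instanceEnv G r F K).A (y 0) (y (n - 1))) := by
  obtain ⟨u, v, p, hp, hc, he⟩ := h
  have hlen : p.length = n - 1 := by simpa using hp.length_eq
  refine ⟨fun i => (p.getVert i).val, ⟨hn, fun i _ => (p.getVert i).2, fun i hi j hj e => ?_,
    fun w hw => ?_, fun i hi => ?_, fun i hi j hj hR => ?_⟩, fun hcyc => ?_⟩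
  · change i < n at hi
    change j < n at hj
    exact hp.isPath.getVert_injOn (by simp; omega) (by simp; omega) (Fin.ext e)
  · obtain ⟨i, hi, hi'⟩ := SimpleGraph.Walk.mem_support_iff_exists_getVert.1
      (hp.mem_support ⟨w, hw⟩)
    refine ⟨i, ?_, congrArg Fin.val hi⟩
    change i < n
    omega
  · change i + 1 < n at hi
    exact lift_val.2 (p.adj_getVert_succ (by omega))
  · change i < n at hi
    change j < n at hj
    exact he i j (by omega) (by omega) (lift_val.1 hR)
  · rw [← hlen]
    simp only [SimpleGraph.Walk.getVert_zero, SimpleGraph.Walk.getVert_length]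
    exact lift_val.2 (hc hcyc)

/-- Rows are increasing pairs, so different rows are different unordered pairs. This bounds the
number of guesses in terms of `k`. -/
theorem EdgeTable.le_card {E : ℕ → ℕ → ℕ}
    (h : EdgeTable n K (lift (fun u v => s(u, v) ∈ F)) E) : K ≤ F.card := by
  have hex : ∀ i : Fin K, ∃ u v : Fin n, u.val = E i 0 ∧ v.val = E i 1 ∧ s(u, v) ∈ F :=
    fun i => (h.row i i.2).2.2.1
  choose u v hu hv hF using hex
  have hinj : Function.Injective (fun i : Fin K => (⟨s(u i, v i), hF i⟩ : F)) := by
    intro i j e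
    have e' : s(u i, v i) = s(u j, v j) := congrArg Subtype.val e
    have hi := (h.row i i.2).1
    have hj := (h.row j j.2).1
    rw [← hu, ← hv] at hi hj
    apply Fin.ext
    rcases Sym2.eq_iff.1 e' with ⟨e1, e2⟩ | ⟨e1, e2⟩
    · exact h.inj i i.2 j j.2 (by rw [← hu, ← hu, e1]) (by rw [← hv, ← hv, e2])
    · rw [e1, e2] at hi
      omega
  simpa using Fintype.card_le_of_injective _ hinj

/-- This bounds the loops over the table in terms of `n` alone, so that one round is polynomial
independently of `k`. -/
theorem EdgeTable.le_sq {F : ℕ → ℕ → Prop} {E : ℕ → ℕ → ℕ} (h : EdgeTable n K F E) :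
    K ≤ n ^ 2 := by
  have := Finset.card_le_card_of_injOn (s := Finset.range K)
    (t := Finset.range n ×ˢ Finset.range n) (fun i => (E i 0, E i 1))
    (fun i hi => by
      have := h.row i (by simpa using hi)
      simp only [Finset.coe_product, Finset.coe_range, Set.mem_prod, Set.mem_Iio]
      omega)
    (fun i hi j hj e => by
      simp only [Prod.mk.injEq] at e
      exact h.inj i (by simpa using hi) j (by simpa using hj) e.1 e.2)
  simpa [sq] using this

end Translate

/-! ### The enumeration -/

/-- The invariant part of the state during the enumeration. -/
structure Ready (Γ : Env) (E X : ℕ → ℕ → ℕ) (s : State) : Prop where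
  static : Static Γ s
  K : s.reg rK = Γ.K + 1
  E : s.mem mE = E
  X : s.mem mX = X
  digits : ValidDigits Γ.K (s.mem mQ)

theorem den_round {Γ : Env} {E X : ℕ → ℕ → ℕ} {cyc : Bool} {s : State} (h : Ready Γ E X s) :
    Ready Γ E X ((round cyc).den Γ.nb s) ∧ ((round cyc).den Γ.nb s).reg rZ ≤ 1 ∧
    value Γ.K (((round cyc).den Γ.nb s).mem mQ) (Γ.K + 1) +
      ((round cyc).den Γ.nb s).reg rZ * weight Γ.K (Γ.K + 1) =
      value Γ.K (s.mem mQ) (Γ.K + 1) + 1 ∧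
    (((round cyc).den Γ.nb s).reg rG = s.reg rG ∨
      ((round cyc).den Γ.nb s).reg rG = 1 ∧ ∃ l, Sol Γ cyc l) := by
  have hfr : rN ∉ (trials cyc).regs ∧ rK ∉ (trials cyc).regs ∧ mA ∉ (trials cyc).arrs ∧
      mR ∉ (trials cyc).arrs ∧ mF ∉ (trials cyc).arrs ∧ mE ∉ (trials cyc).arrs ∧
      mX ∉ (trials cyc).arrs ∧ mQ ∉ (trials cyc).arrs := by
    revert cyc; decide
  obtain ⟨f1, f2, f3, f4, f5, f6, f7, f8⟩ := hfr
  have h1 : Ready Γ E X (makePerm.den Γ.nb s) :=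
    ⟨h.static.frame _ (by decide) (by decide), by rw [Cmd.frame_reg _ _ (by decide), h.K],
      by rw [Cmd.frame_mem _ _ (by decide), h.E], by rw [Cmd.frame_mem _ _ (by decide), h.X],
      by rw [Cmd.frame_mem _ _ (by decide)]; exact h.digits⟩
  have g1 : (makePerm.den Γ.nb s).reg rG = s.reg rG := Cmd.frame_reg _ _ (by decide)
  have q1 : (makePerm.den Γ.nb s).mem mQ = s.mem mQ := Cmd.frame_mem _ _ (by decide)
  rw [round, Cmd.den_seq, Cmd.den_seq]
  generalize makePerm.den Γ.nb s = s₁ at *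
  have h2 : Ready Γ E X ((trials cyc).den Γ.nb s₁) :=
    ⟨h1.static.frame _ f1 ⟨f3, f4, f5⟩, by rw [Cmd.frame_reg _ _ f2, h1.K],
      by rw [Cmd.frame_mem _ _ f6, h1.E], by rw [Cmd.frame_mem _ _ f7, h1.X],
      by rw [Cmd.frame_mem _ _ f8]; exact h1.digits⟩
  have g2 := den_trials_sound (cyc := cyc) h1.static
  have q2 : ((trials cyc).den Γ.nb s₁).mem mQ = s.mem mQ := by
    rw [Cmd.frame_mem _ _ f8, q1]
  generalize (trials cyc).den Γ.nb s₁ = s₂ at *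
  obtain ⟨n1, n2, n3⟩ := den_nextDigits h2.K h2.digits
  refine ⟨⟨h2.static.frame _ (by decide) (by decide), by rw [Cmd.frame_reg _ _ (by decide), h2.K],
      by rw [Cmd.frame_mem _ _ (by decide), h2.E], by rw [Cmd.frame_mem _ _ (by decide), h2.X],
      n1⟩, n2, ?_, ?_⟩
  · rw [n3, q2]
  · rw [Cmd.frame_reg _ _ (by decide), ← g1]
    exact g2

/-- For every tour there is a number such that the round with this number succeeds. -/
theorem Prepared.exists_value {Γ : Env} {E X : ℕ → ℕ → ℕ} (H : Prepared Γ E X) {y : ℕ → ℕ}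
    (T : Tour Γ y) {cyc : Bool} (hcyc : cyc = true → Γ.A (y 0) (y (Γ.n - 1))) :
    ∃ m < weight Γ.K (Γ.K + 1), ∀ s, Ready Γ E X s → value Γ.K (s.mem mQ) (Γ.K + 1) = m →
      ((round cyc).den Γ.nb s).reg rG = 1 := by
  obtain ⟨Q, c, g, hQ, hG, hF⟩ := H.exists_guide T
  refine ⟨_, value_lt hQ _ le_rfl, fun s hs hv => ?_⟩
  have hdig := value_inj hs.digits hQ _ le_rfl hv
  have hperm := den_makePerm (Γ := Γ) hs.digits
  have e : permAfter (fun j => s.mem mQ j 0) (Γ.K + 1) = permAfter (fun j => Q j 0) (Γ.K + 1) :=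
    permAfter_congr _ (fun j hj => (hdig j hj).1)
  rw [e] at hperm
  rw [round, Cmd.den_seq, Cmd.den_seq, Cmd.frame_reg _ _ (by decide)]
  refine hG.den_trials (hs.static.frame _ (by decide) (by decide))
    (fun s' k1 k2 k3 k4 k5 k6 => hF s' ?_ ?_ ?_ ?_ ?_ k6) hcyc
  · intro i hi
    rw [k1, hperm i hi]
  · intro j hj
    rw [k2, Cmd.frame_mem _ _ (by decide)]
    exact (hdig j (by omega)).2
  · rw [k3, Cmd.frame_mem _ _ (by decide), hs.E]
  · rw [k4, Cmd.frame_mem _ _ (by decide), hs.X]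
  · rw [k5, Cmd.frame_reg _ _ (by decide), hs.K]

/-- The result of the whole enumeration. -/
theorem enumeration {Γ : Env} {E X : ℕ → ℕ → ℕ} {cyc : Bool} {s : State} (H : Prepared Γ E X)
    (hs : Ready Γ E X s) (hv : value Γ.K (s.mem mQ) (Γ.K + 1) = 0) (hG : s.reg rG = 0)
    (hZ : s.reg rZ = 0) :
    (∀ i < weight Γ.K (Γ.K + 1), (((round cyc).den Γ.nb)^[i] s).reg rZ = 0) ∧
    (∀ i, Ready Γ E X (((round cyc).den Γ.nb)^[i] s)) ∧
    (((round cyc).den Γ.nb)^[weight Γ.K (Γ.K + 1)] s).reg rZ = 1 ∧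
    ((((round cyc).den Γ.nb)^[weight Γ.K (Γ.K + 1)] s).reg rG = 0 ∨
      (((round cyc).den Γ.nb)^[weight Γ.K (Γ.K + 1)] s).reg rG = 1 ∧ ∃ l, Sol Γ cyc l) ∧
    ∀ y, Tour Γ y → (cyc = true → Γ.A (y 0) (y (Γ.n - 1))) →
      (((round cyc).den Γ.nb)^[weight Γ.K (Γ.K + 1)] s).reg rG = 1 := by
  set M := weight Γ.K (Γ.K + 1) with hM
  set f : ℕ → State := fun i => ((round cyc).den Γ.nb)^[i] s with hf
  have f_succ : ∀ i, f (i + 1) = (round cyc).den Γ.nb (f i) := fun i =>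
    Function.iterate_succ_apply' _ _ _
  have hready : ∀ i, Ready Γ E X (f i) := by
    intro i
    induction i with
    | zero => exact hs
    | succ i ih => rw [f_succ]; exact (den_round ih).1
  have hval : ∀ i < M, (f i).reg rZ = 0 ∧ value Γ.K ((f i).mem mQ) (Γ.K + 1) = i := by
    intro i
    induction i with
    | zero => exact fun _ => ⟨hZ, hv⟩
    | succ i ih =>
      intro hi
      obtain ⟨-, e⟩ := ih (by omega)
      obtain ⟨-, d2, d3, -⟩ := den_round (cyc := cyc) (hready i)
      rw [← f_succ, e] at d3
      rw [← f_succ] at d2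
      have hz : (f (i + 1)).reg rZ = 0 := by
        by_contra hne
        have h1 : (f (i + 1)).reg rZ = 1 := by omega
        rw [h1] at d3
        omega
      rw [hz] at d3
      exact ⟨hz, by omega⟩
  have hMpos : 0 < M := lt_of_le_of_lt (Nat.zero_le _) (value_lt hs.digits _ le_rfl)
  obtain ⟨m, hm⟩ : ∃ m, M = m + 1 := ⟨M - 1, by omega⟩
  -- Without a carry the counter would show `M`, which exceeds every value of valid digits.
  have hend : (f M).reg rZ = 1 := by
    obtain ⟨-, e⟩ := hval m (by omega)
    obtain ⟨d1, d2, d3, -⟩ := den_round (cyc := cyc) (hready m)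
    rw [← f_succ, ← hm] at d1 d2 d3
    by_contra hne
    have hz : (f M).reg rZ = 0 := by omega
    have hlt := value_lt d1.digits (Γ.K + 1) le_rfl
    rw [hz] at d3
    omega
  have hsound : ∀ i, (f i).reg rG = 0 ∨ (f i).reg rG = 1 ∧ ∃ l, Sol Γ cyc l := by
    intro i
    induction i with
    | zero => exact Or.inl hG
    | succ i ih =>
      obtain ⟨-, -, -, d4⟩ := den_round (cyc := cyc) (hready i)
      rw [← f_succ] at d4
      rcases d4 with d | d
      · rw [d]; exact ih
      · exact Or.inr d
  refine ⟨fun i hi => (hval i hi).1, hready, hend, hsound M, fun y T hcyc => ?_⟩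
  obtain ⟨v, hvM, hsucc⟩ := H.exists_value T hcyc
  have hkeep : ∀ d, (f (v + 1 + d)).reg rG = 1 := by
    intro d
    induction d with
    | zero =>
      rw [Nat.add_zero, f_succ]
      exact hsucc (f v) (hready v) (hval v hvM).2
    | succ d ih =>
      obtain ⟨-, -, -, d4⟩ := den_round (cyc := cyc) (hready (v + 1 + d))
      rw [← f_succ] at d4
      rcases d4 with d' | d'
      · rw [← Nat.add_assoc, d', ih]
      · exact d'.1
  have := hkeep (M - (v + 1))
  rwa [show v + 1 + (M - (v + 1)) = M by omega] at this

/-! ### Correctness and running time of the program -/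

theorem program_correct (cyc : Bool) : ∃ C c : ℕ, ∀ (n k : ℕ) (G : SimpleGraph (Fin n))
    (r : Fin n → Fin n → Prop) (F : Finset (Sym2 (Fin n))), 1 ≤ n → F.card ≤ k →
    IsBlockGraph (G.deleteEdges (F : Set (Sym2 (Fin n)))) →
    Decides (program cyc) (input G r F) (Problem cyc G r)
      ((k + 1).factorial * 2 ^ k * (C * n ^ c)) := by
  obtain ⟨C₁, c₁, ht₁⟩ := setupEdges.time_poly
  obtain ⟨C₂, c₂, ht₂⟩ := setupSearch.time_poly
  obtain ⟨C₃, c₃, ht₃⟩ := (round cyc).time_poly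
  -- There are at most `2 * ((k + 1)! * 2 ^ k)` rounds, each costing at most `4 + C₃` times the
  -- power of `n`, whence `8 + 2 * C₃`; the other 8 covers the steps outside the three main parts.
  refine ⟨16 + C₁ + C₂ + 2 * C₃, c₁ + c₂ + c₃, fun n k G r F hn hk hB => ?_⟩
  -- the list of edges
  set s₁ := (input G r F).setReg rN n with hs₁
  have hin : ∀ i j, (∀ a, 3 ≤ a → (input G r F).mem a i j = 0) := by
    intro i j a ha
    match a, ha with
    | (a + 3), _ => rfl
  have hA₁ : s₁.mem mA = mat (lift G.Adj) := boolMatrix_eq_mat _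
  have hR₁ : s₁.mem mR = mat (lift r) := boolMatrix_eq_mat _
  have hF₁ : s₁.mem mF = mat (lift (fun u v => s(u, v) ∈ F)) := boolMatrix_eq_mat _
  have hreg₁ : ∀ x, x ≠ 0 → x ≠ rN → s₁.reg x = 0 := by
    intro x h0 h1
    simp [hs₁, h1, input, h0]
  have hN₁ : s₁.reg rN = n := by simp [hs₁]
  have hmem₁ : ∀ a, 3 ≤ a → ∀ i j, s₁.mem a i j = 0 := fun a ha i j => hin i j a ha
  -- `K` is known only after the edges have been listed, so this command is run with the constant
  -- bound `n`; it loops over vertices only.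
  obtain ⟨t₁, hT₁, e₁⟩ := Cmd.exec_compile (nb := fun _ => n) setupEdges [rN] (by decide)
    (by decide) s₁ (by simpa using hN₁)
  obtain ⟨K, hK, hE⟩ := den_listEdges (n := n) (F := lift (fun u v => s(u, v) ∈ F))
    (nb := fun _ => n) (s := (Cmd.assign rK (.const 1)).den (fun _ => n) s₁) rfl hF₁
    (by simp [Expr.eval])
  rw [← Cmd.den_seq] at hK hE
  change (setupEdges.den (fun _ => n) s₁).reg rK = K + 1 at hK
  change EdgeTable n K _ ((setupEdges.den (fun _ => n) s₁).mem mE) at hE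
  have hKk : K ≤ k := hE.le_card.trans hk
  have hKn := hE.le_sq
  set s₂ := setupEdges.den (fun _ => n) s₁ with hs₂
  set Γ := instanceEnv G r F K with hΓ
  have hΓB : Γ.B = lift (G.deleteEdges (F : Set (Sym2 (Fin n)))).Adj := instanceEnv_B
  have hBlt : ∀ u v, Γ.B u v → u < Γ.n ∧ v < Γ.n := by
    rw [hΓB]
    rintro _ _ ⟨u, v, rfl, rfl, -⟩
    exact ⟨u.2, v.2⟩
  have st₂ : Static Γ s₂ :=
    ⟨by rw [hs₂, Cmd.frame_reg _ _ (by decide)]; exact hN₁,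
      by rw [hs₂, Cmd.frame_mem _ _ (by decide)]; exact hA₁,
      by rw [hs₂, Cmd.frame_mem _ _ (by decide)]; exact hR₁,
      by rw [hs₂, Cmd.frame_mem _ _ (by decide)]; exact hF₁⟩
  have hmem₂ : ∀ a, 4 ≤ a → ∀ i j, s₂.mem a i j = 0 := by
    intro a ha i j
    rw [hs₂, Cmd.frame_mem _ _ (by simp [setupEdges, listEdges, Cmd.when, Cmd.arrs]; omega)]
    exact hmem₁ a (by omega) i j
  have hG₂ : s₂.reg rG = 0 := by
    rw [hs₂, Cmd.frame_reg _ _ (by decide)]; exact hreg₁ _ (by decide) (by decide)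
  have hZ₂ : s₂.reg rZ = 0 := by
    rw [hs₂, Cmd.frame_reg _ _ (by decide)]; exact hreg₁ _ (by decide) (by decide)
  -- breadth first search
  obtain ⟨t₂, hT₂, e₂⟩ := Cmd.exec_compile (nb := Γ.nb) setupSearch [rN, rK] (by decide)
    (by decide) s₂ (by simpa using ⟨st₂.hN, hK⟩)
  have hsearch := den_searchAll hBlt st₂ (hmem₂ mD (by omega))
  have hdig := den_initDigits (Γ := Γ) (s := searchAll.den Γ.nb s₂) (by
    rw [Cmd.frame_mem _ _ (by decide)]; exact hmem₂ mQ (by omega))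
  have hX₃ : (setupSearch.den Γ.nb s₂).mem mX = (searchAll.den Γ.nb s₂).mem mX := by
    rw [setupSearch, Cmd.den_seq, Cmd.frame_mem _ _ (by decide)]
  rw [← Cmd.den_seq] at hdig
  change ∀ j ≤ Γ.K, (setupSearch.den Γ.nb s₂).mem mQ j 0 = j ∧
    (setupSearch.den Γ.nb s₂).mem mQ j 1 = 0 at hdig
  set s₃ := setupSearch.den Γ.nb s₂ with hs₃
  have ready : Ready Γ (s₂.mem mE) (s₃.mem mX) s₃ :=
    ⟨st₂.frame _ (by decide) (by decide), by rw [hs₃, Cmd.frame_reg _ _ (by decide)]; exact hK,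
      by rw [hs₃, Cmd.frame_mem _ _ (by decide)], rfl, fun j hj => by
        rw [(hdig j hj).1, (hdig j hj).2]; exact ⟨le_rfl, hj, Nat.zero_le _⟩⟩
  have prep : Prepared Γ (s₂.mem mE) (s₃.mem mX) := by
    refine ⟨hE, ?_, fun y T p f hpf hf hpath => ?_, ?_⟩
    · rintro _ _ ⟨u, v, rfl, rfl, h⟩
      exact ⟨v, u, rfl, rfl, (congrArg (· ∈ F) Sym2.eq_swap).mp h⟩
    · have hs := hsearch (y f) (T.lt f hf)
      rw [hX₃]
      rw [hΓB] at hs hpath ⊢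
      exact hs.next_on_path hB T.lt T.inj hpf hf rfl hpath
    · rw [hΓB]
      rintro _ _ _ _ ⟨a, b, rfl, rfl, h1⟩ ⟨a', v, h2, rfl, h3⟩ ⟨v', b', h4, h5, h6⟩
        ⟨a'', w, h7, rfl, h8⟩ ⟨w', b'', h9, h10, h11⟩ hne
      obtain rfl := Fin.ext h2
      obtain rfl := Fin.ext h4
      obtain rfl := Fin.ext h5
      obtain rfl := Fin.ext h7
      obtain rfl := Fin.ext h9
      obtain rfl := Fin.ext h10
      exact lift_val.2 (adj_of_common_neighbours hB h1 h3 h6 h8 h11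
        (fun e => hne (congrArg Fin.val e)))
  obtain ⟨r1, r2, r3, r4, r5⟩ := enumeration (cyc := cyc) prep ready
    (value_initial _ _ (fun j hj => hdig j (Nat.le_of_lt_succ hj)))
    (by rw [hs₃, Cmd.frame_reg _ _ (by decide), hG₂])
    (by rw [hs₃, Cmd.frame_reg _ _ (by decide), hZ₂])
  set M := weight Γ.K (Γ.K + 1) with hM
  have hwf : (round cyc).wf [rN, rK] = true ∧ ∀ y ∈ [rN, rK], y ∉ (round cyc).regs := by
    clear * -; revert cyc; decide
  obtain ⟨t₃, hT₃, e₃⟩ := Cmd.exec_loop (b := .eq (.reg rZ) (.const 0))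
    (P := (round cyc).compile) (T := (round cyc).time Γ.nb) M
    (fun i => ((round cyc).den Γ.nb)^[i] s₃) (fun i hi => ⟨r1 i hi, by
      simp only [Function.iterate_succ_apply']
      exact Cmd.exec_compile _ _ hwf.1 hwf.2 _ (by simpa using ⟨(r2 i).static.hN, (r2 i).K⟩)⟩)
    (by simp only [Cond.eval, Expr.eval, r3]; exact one_ne_zero)
  set s₄ := ((round cyc).den Γ.nb)^[M] s₃ with hs₄
  refine ⟨s₄.setReg 0 (s₄.reg rG), 2 + (t₁ + (t₂ + (t₃ + 2))), ?_, ?_, fun hQ => ?_, fun hQ => ?_⟩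
  · exact .seq (.assign (input G r F) rN (.reg 0)) (.seq e₁ (.seq e₂ (.seq e₃
      (.assign s₄ 0 (.reg rG)))))
  · have hnb : ∀ y, Γ.nb y ≤ 2 * n ^ 2 := by
      intro y
      have h1 : 1 ≤ n ^ 2 := Nat.one_le_pow _ _ hn
      have h2 : n ≤ n ^ 2 := Nat.le_self_pow (by decide) n
      have h3 : Γ.n = n := rfl
      have h4 : Γ.K = K := rfl
      unfold Env.nb
      split_ifs <;> omega
    have hnb' : ∀ _ : ℕ, n ≤ 2 * n ^ 2 := fun _ => by
      have h2 : n ≤ n ^ 2 := Nat.le_self_pow (by decide) n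
      omega
    set N := n ^ (c₁ + c₂ + c₃) with hNdef
    have hN : 1 ≤ N := Nat.one_le_pow _ _ hn
    have b : ∀ {C c t : ℕ}, t ≤ C * n ^ c → c ≤ c₁ + c₂ + c₃ → t ≤ C * N := fun h hc =>
      h.trans (Nat.mul_le_mul_left _ (Nat.pow_le_pow_right hn hc))
    have b₁ := b (hT₁.trans (ht₁ n _ hn hnb')) (by omega)
    have b₂ := b (hT₂.trans (ht₂ n _ hn hnb)) (by omega)
    have b₃ := b (ht₃ n _ hn hnb) (by omega)
    set W := (k + 1).factorial * 2 ^ k with hW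
    have hWpos : 1 ≤ W := Nat.mul_pos (Nat.factorial_pos _) (by positivity)
    have hMW : M ≤ 2 * W := by
      have h1 : (K + 1).factorial ≤ (k + 1).factorial := Nat.factorial_le (by omega)
      have h2 : 2 ^ K ≤ 2 ^ k := Nat.pow_le_pow_right (by decide) hKk
      have h3 : M = 2 ^ (K + 1) * (K + 1).factorial := weight_last K
      calc M = 2 * ((K + 1).factorial * 2 ^ K) := by rw [h3, pow_succ]; ring
        _ ≤ 2 * W := Nat.mul_le_mul_left _ (Nat.mul_le_mul h1 h2)
    change t₃ ≤ M * (3 + 1 + (round cyc).time Γ.nb) + (3 + 1) at hT₃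
    have b₄ : 3 + 1 + (round cyc).time Γ.nb ≤ (4 + C₃) * N := by
      rw [Nat.add_mul]; omega
    have b₅ := Nat.mul_le_mul hMW b₄
    have b₆ : 2 * W * ((4 + C₃) * N) = W * ((8 + 2 * C₃) * N) := by ring
    have b₇ : 8 + t₁ + t₂ ≤ (8 + C₁ + C₂) * N := by
      rw [Nat.add_mul, Nat.add_mul]; omega
    have b₈ : (8 + C₁ + C₂) * N ≤ W * ((8 + C₁ + C₂) * N) := Nat.le_mul_of_pos_left _ hWpos
    have b₉ : W * ((16 + C₁ + C₂ + 2 * C₃) * N) =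
        W * ((8 + C₁ + C₂) * N) + W * ((8 + 2 * C₃) * N) := by ring
    rw [b₉]
    omega
  · obtain ⟨y, T, hc⟩ := hQ.exists_tour (F := F) (K := K) hn
    simpa using r5 y T hc
  · rcases r4 with h | ⟨-, l, hl⟩
    · simpa using h
    · exact absurd (hl.problem hn) hQ

end POH

/-! ### The theorem for paths and for cycles -/

theorem mainTheorem8 :
    (∃ (P : POH.Prog) (C c : ℕ), ∀ (n k : ℕ) (G : SimpleGraph (Fin n))
        (r : Fin n → Fin n → Prop) (F : Finset (Sym2 (Fin n))),
        1 ≤ n → IsPartialOrder (Fin n) r →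
        (F : Set (Sym2 (Fin n))) ⊆ G.edgeSet → F.card ≤ k →
        POH.IsBlockGraph (G.deleteEdges (F : Set (Sym2 (Fin n)))) →
        POH.Decides P (POH.input G r F) (POH.POHPP G r)
          ((k + 1).factorial * 2 ^ k * (C * n ^ c))) ∧
    (∃ (P : POH.Prog) (C c : ℕ), ∀ (n k : ℕ) (G : SimpleGraph (Fin n))
        (r : Fin n → Fin n → Prop) (F : Finset (Sym2 (Fin n))),
        1 ≤ n → IsPartialOrder (Fin n) r →
        (F : Set (Sym2 (Fin n))) ⊆ G.edgeSet → F.card ≤ k →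
        POH.IsBlockGraph (G.deleteEdges (F : Set (Sym2 (Fin n)))) →
        POH.Decides P (POH.input G r F) (POH.POHCP G r)
          ((k + 1).factorial * 2 ^ k * (C * n ^ c))) := by
  refine ⟨⟨POH.program false, ?_⟩, ⟨POH.program true, ?_⟩⟩
  · obtain ⟨C, c, h⟩ := POH.program_correct false
    refine ⟨C, c, fun n k G r F hn _ _ hk hB => ?_⟩
    have e : POH.POHPP G r = POH.Problem false G r := by simp [POH.Problem, POH.POHPP]
    rw [e]
    exact h n k G r F hn hk hB
  · obtain ⟨C, c, h⟩ := POH.program_correct true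
    refine ⟨C, c, fun n k G r F hn _ _ hk hB => ?_⟩
    have e : POH.POHCP G r = POH.Problem true G r := by simp [POH.Problem, POH.POHCP]
    rw [e]
    exact h n k G r F hn hk hB
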